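/- A complex quasi-projective variety is a (possibly reducible or empty) reduced variety over $\mathbb C$ isomorphic to a Zariski locally closed subset of some $\mathbb P^N(\mathbb C)$. A pair $(X,Y)$ consists of a complex quasi-projective variety $X$ and a constructible subset $Y\subset X$ (a finite union of Zariski locally closed subsets). Let $K_0^{\rm pairs}({\rm Var}_{\mathbb C})$ be the abelian group generated by the isomorphism classes $[(X,Y)]$ of pairs modulo the relations $[(X,Y)]=[(Z,Y\cap Z)]+[(X\setminus Z,Y\cap(X\setminus Z))]$ for $Z\subset X$ Zariski closed, made into a commutative ring by $[(X_1,Y_1)]\cdot[(X_2,Y_2)]=[(X_1,Y_1)\widehat\times(X_2,Y_2)]$, where $(X_1,Y_1)\widehat\times(X_2,Y_2)=(X_1\times X_2,\,(X_1\times Y_2)\cup(Y_1\times X_2))$, with unit $1=[({\rm pt},\emptyset)]$. A (pre-)$\lambda$-structure on a commutative ring $R$ is a family of series $\lambda_a(t)\in 1+tR[[t]]$, $a\in R$, with $\lambda_a(t)=1+at+(\text{terms of higher order})$ and $\lambda_{a+b}(t)=\lambda_a(t)\lambda_b(t)$. For a pair $(X,Y)$ and $n\ge 0$ let $S^n(X,Y)$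 be the symmetric product $S^nX=X^n/S_n$ together with the subset of unordered $n$-tuples $\{x_1,\dots,x_n\}$ of points of $X$ at least one of which belongs to $Y$, and let $\zeta_{X,Y}(t)=1+\sum_{n\ge1}[S^n(X,Y)]\,t^n$ be the Kapranov zeta function of $(X,Y)$. Then symmetric products and disjoint unions of pairs are again pairs (so that all these classes are defined), and: 1. The Grothendieck group defined by the same generators and relations using only pairs $(X,Y)$ with $Y$ locally closed in $X$ maps isomorphically onto $K_0^{\rm pairs}({\rm Var}_{\mathbb C})$. 2. The Kapranov zeta function defines a (pre-)$\lambda$-structure on $K_0^{\rm pairs}({\rm Var}_{\mathbb C})$: there is one and only one (pre-)$\lambda$-structure $a\mapsto\lambda_a(t)$ on this ring with $\lambda_{[(X,Y)]}(t)=\zeta_{X,Y}(t)$ for all pairs $(X,Y)$. 3. For all pairs $(X_1,Y_1)$, $(X_2,Y_2)$ one has $\zeta_{X_1\sqcup X_2,\,Y_1\sqcup Y_2}(t)=\zeta_{X_1,Y_1}(t)\cdot\zeta_{X_2,Y_2}(t)$. 4. For all pairs $(X_1,Y_1)$, $(X_2,Y_2)$ and all $n\ge0$, the union of unordered tuples is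 an isomorphism of pairs $\bigsqcup_{s=0}^n S^s(X_1,Y_1)\widehat\times S^{n-s}(X_2,Y_2)\to S^n(X_1\sqcup X_2,\,Y_1\sqcup Y_2)$. -/

import Mathlib

open Topology Filter

noncomputable section

namespace KPairs

/-! ### Spaces with functions and complex quasi-projective varieties

A (reduced) complex variety is treated classically: as a set of points with its Zariski topology and
its sheaf of `ℂ`-valued regular functions. -/

/-- A space with functions over `ℂ`: a topological space with a sheaf of `ℂ`-valued functions,
recorded by the predicate `RegAt f x` (the function `f` is regular in a neighbourhood of `x`; the
values of `f` away from `x` do not matter). -/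
structure FnSpace where
  carrier : Type
  [top : TopologicalSpace carrier]
  RegAt : (carrier → ℂ) → carrier → Prop
  congr : ∀ {f g : carrier → ℂ} {x : carrier}, f =ᶠ[𝓝 x] g → RegAt f x → RegAt g x
  eventually_reg : ∀ {f : carrier → ℂ} {x : carrier}, RegAt f x → ∀ᶠ y in 𝓝 x, RegAt f y
  const : ∀ (c : ℂ) (x : carrier), RegAt (fun _ => c) x
  add : ∀ {f g : carrier → ℂ} {x : carrier}, RegAt f x → RegAt g x → RegAt (f + g) x
  mul : ∀ {f g : carrier → ℂ} {x : carrier}, RegAt f x → RegAt g x → RegAt (f * g) x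
  eventually_ne : ∀ {f : carrier → ℂ} {x : carrier}, RegAt f x → f x ≠ 0 → ∀ᶠ y in 𝓝 x, f y ≠ 0
  inv : ∀ {f : carrier → ℂ} {x : carrier}, RegAt f x → f x ≠ 0 → RegAt f⁻¹ x

instance : CoeSort FnSpace Type := ⟨FnSpace.carrier⟩

attribute [instance] FnSpace.top

/-- Morphisms: continuous maps that pull regular functions back to regular functions. -/
def IsMorphism {X Y : FnSpace} (φ : X → Y) : Prop :=
  Continuous φ ∧ ∀ (g : Y → ℂ) (x : X), Y.RegAt g (φ x) → X.RegAt (g ∘ φ) x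

/-- Isomorphisms: bijections that are morphisms in both directions. -/
structure FnSpace.Iso (X Y : FnSpace) where
  toEquiv : X ≃ Y
  isMorphism : IsMorphism (X := X) (Y := Y) toEquiv
  isMorphism_symm : IsMorphism (X := Y) (Y := X) toEquiv.symm

theorem IsMorphism.id (X : FnSpace) : IsMorphism (X := X) (Y := X) (fun x => x) :=
  ⟨continuous_id, fun _ _ h => h⟩

theorem IsMorphism.comp {X Y Z : FnSpace} {ψ : Y → Z} {φ : X → Y} (hψ : IsMorphism ψ)
    (hφ : IsMorphism φ) : IsMorphism (X := X) (Y := Z) (fun x => ψ (φ x)) :=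
  ⟨hψ.1.comp hφ.1, fun g _ h => hφ.2 _ _ (hψ.2 g _ h)⟩

def FnSpace.Iso.symm {X Y : FnSpace} (e : X.Iso Y) : Y.Iso X :=
  ⟨e.toEquiv.symm, e.isMorphism_symm, e.isMorphism⟩

def FnSpace.Iso.trans {X Y Z : FnSpace} (e : X.Iso Y) (f : Y.Iso Z) : X.Iso Z :=
  ⟨e.toEquiv.trans f.toEquiv, f.isMorphism.comp e.isMorphism,
    e.isMorphism_symm.comp f.isMorphism_symm⟩

/-! ### Initial structures: subspaces and products -/

/-- The functions on `T` that are polynomials in pull-backs `f ∘ p i` of functions `f` regular at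
`p i t`. -/
def pulledBack {T ι : Type} (X : ι → FnSpace) (p : ∀ i, T → X i) (t : T) :
    Subalgebra ℂ (T → ℂ) :=
  Algebra.adjoin ℂ {g | ∃ (i : ι) (f : X i → ℂ), (X i).RegAt f (p i t) ∧ g = f ∘ p i}

theorem pulledBack_eventually {T ι : Type} {X : ι → FnSpace} {p : ∀ i, T → X i}
    {W : Type} [TopologicalSpace W] {φ : W → T} (hc : ∀ i, Continuous fun w => p i (φ w))
    {b : T → ℂ} {w : W} (hb : b ∈ pulledBack X p (φ w)) :
    ∀ᶠ w' in 𝓝 w, b ∈ pulledBack X p (φ w') := by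
  unfold pulledBack at hb
  induction hb using Algebra.adjoin_induction with
  | mem g hg =>
    obtain ⟨i, f, hf, rfl⟩ := hg
    have := (hc i).continuousAt.eventually ((X i).eventually_reg hf)
    filter_upwards [this] with w' h
    exact Algebra.subset_adjoin ⟨i, f, h, rfl⟩
  | algebraMap c => exact Eventually.of_forall fun _ => Subalgebra.algebraMap_mem _ c
  | add x y _ _ hx hy => filter_upwards [hx, hy] with w' h h' using add_mem h h'
  | mul x y _ _ hx hy => filter_upwards [hx, hy] with w' h h' using mul_mem h h'

/-- The topology generated by the preimages of open sets and by the non-vanishing loci of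
polynomials in pulled-back regular functions. -/
@[reducible] def initialTop {T ι : Type} (X : ι → FnSpace) (p : ∀ i, T → X i) : TopologicalSpace T :=
  TopologicalSpace.generateFrom
    ({S | ∃ (i : ι) (U : Set (X i)), IsOpen U ∧ S = p i ⁻¹' U} ∪
      {S | ∃ b : T → ℂ, S = {t | b ∈ pulledBack X p t ∧ b t ≠ 0}})

theorem initialTop_continuous {T ι : Type} (X : ι → FnSpace) (p : ∀ i, T → X i) (i : ι) :
    @Continuous _ _ (initialTop X p) _ (p i) := by
  let _ := initialTop X p
  refine ⟨fun U hU => ?_⟩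
  exact TopologicalSpace.isOpen_generateFrom_of_mem (Or.inl ⟨i, U, hU, rfl⟩)

theorem initialTop_eventually_ne {T ι : Type} (X : ι → FnSpace) (p : ∀ i, T → X i) {b : T → ℂ}
    {t : T} (hb : b ∈ pulledBack X p t) (h0 : b t ≠ 0) :
    ∀ᶠ s in @nhds _ (initialTop X p) t, b s ≠ 0 := by
  let _ := initialTop X p
  have ho : IsOpen {t | b ∈ pulledBack X p t ∧ b t ≠ 0} :=
    TopologicalSpace.isOpen_generateFrom_of_mem (Or.inr ⟨b, rfl⟩)
  filter_upwards [ho.mem_nhds ⟨hb, h0⟩] with s hs using hs.2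

/-- The initial (coarsest) structure on `T` making all maps `p i : T → X i` morphisms: a function is
regular at `t` if near `t` it is a quotient of polynomials in pulled-back regular functions, with
denominator not vanishing at `t`. For an inclusion this is the induced structure on a subset; for the
projections of a product of sets it is the product of varieties. -/
def initial {T ι : Type} (X : ι → FnSpace) (p : ∀ i, T → X i) : FnSpace :=
  letI := initialTop X p
  { carrier := T
    RegAt := fun h t => ∃ a ∈ pulledBack X p t, ∃ b ∈ pulledBack X p t,
      b t ≠ 0 ∧ h =ᶠ[𝓝 t] fun s => a s / b s
    congr := by
      rintro f g x hfg ⟨a, ha, b, hb, h0, h⟩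
      exact ⟨a, ha, b, hb, h0, hfg.symm.trans h⟩
    eventually_reg := by
      rintro f x ⟨a, ha, b, hb, h0, h⟩
      have e (c : T → ℂ) (hc : c ∈ pulledBack X p x) : ∀ᶠ y in 𝓝 x, c ∈ pulledBack X p y :=
        pulledBack_eventually (φ := fun t => t) (initialTop_continuous X p) hc
      filter_upwards [e a ha, e b hb, initialTop_eventually_ne X p hb h0,
        h.eventuallyEq_nhds] with y h1 h2 h3 h4
      exact ⟨a, h1, b, h2, h3, h4⟩
    const := fun c x => ⟨_, Subalgebra.algebraMap_mem _ c, 1, one_mem _, by simp,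
      Eventually.of_forall fun y => by simp⟩
    add := by
      rintro f g x ⟨a, ha, b, hb, h0, h⟩ ⟨a', ha', b', hb', h0', h'⟩
      refine ⟨a * b' + a' * b, add_mem (mul_mem ha hb') (mul_mem ha' hb), b * b', mul_mem hb hb',
        mul_ne_zero h0 h0', ?_⟩
      filter_upwards [h, h', initialTop_eventually_ne X p hb h0,
        initialTop_eventually_ne X p hb' h0'] with y h1 h2 h3 h4
      simp only [Pi.add_apply, Pi.mul_apply, h1, h2]
      field_simp
    mul := by
      rintro f g x ⟨a, ha, b, hb, h0, h⟩ ⟨a', ha', b', hb', h0', h'⟩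
      refine ⟨a * a', mul_mem ha ha', b * b', mul_mem hb hb', mul_ne_zero h0 h0', ?_⟩
      filter_upwards [h, h'] with y h1 h2
      simp only [Pi.mul_apply, h1, h2, div_mul_div_comm]
    eventually_ne := by
      rintro f x ⟨a, ha, b, hb, h0, h⟩ hx
      have hx' : a x ≠ 0 := fun h1 => hx (by simpa [h1] using h.self_of_nhds)
      filter_upwards [h, initialTop_eventually_ne X p hb h0,
        initialTop_eventually_ne X p ha hx'] with y h1 h2 h3
      rw [h1]
      exact div_ne_zero h3 h2
    inv := by
      rintro f x ⟨a, ha, b, hb, h0, h⟩ hx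
      have hx' : a x ≠ 0 := fun h1 => hx (by simpa [h1] using h.self_of_nhds)
      refine ⟨b, hb, a, ha, hx', ?_⟩
      filter_upwards [h] with y h1
      simp [h1] }

theorem FnSpace.RegAt_of_pulledBack {T ι : Type} {X : ι → FnSpace} {p : ∀ i, T → X i}
    {W : FnSpace} {φ : W → T} (h : ∀ i, IsMorphism (X := W) (Y := X i) fun w => p i (φ w))
    {b : T → ℂ} {w : W} (hb : b ∈ pulledBack X p (φ w)) : W.RegAt (b ∘ φ) w := by
  unfold pulledBack at hb
  induction hb using Algebra.adjoin_induction with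
  | mem g hg =>
    obtain ⟨i, f, hf, rfl⟩ := hg
    exact (h i).2 f w hf
  | algebraMap c => exact W.const c w
  | add x y _ _ hx hy => exact W.add hx hy
  | mul x y _ _ hx hy => exact W.mul hx hy

theorem initial_proj {T ι : Type} (X : ι → FnSpace) (p : ∀ i, T → X i) (i : ι) :
    IsMorphism (X := initial X p) (Y := X i) (p i) := by
  refine ⟨initialTop_continuous X p i, fun g x hg => ?_⟩
  exact ⟨g ∘ p i, Algebra.subset_adjoin ⟨i, g, hg, rfl⟩, 1, one_mem _, one_ne_zero,
    Eventually.of_forall fun y => (div_one _).symm⟩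

theorem initial_lift {T ι : Type} {X : ι → FnSpace} {p : ∀ i, T → X i} {W : FnSpace}
    {φ : W → T} (h : ∀ i, IsMorphism (X := W) (Y := X i) fun w => p i (φ w)) :
    IsMorphism (X := W) (Y := initial X p) φ := by
  have hc : Continuous (Y := initial X p) φ := by
    refine continuous_generateFrom_iff.2 ?_
    rintro S (⟨i, U, hU, rfl⟩ | ⟨b, rfl⟩)
    · exact hU.preimage (h i).1
    · refine isOpen_iff_mem_nhds.2 ?_
      rintro w ⟨hb, h0⟩
      filter_upwards [pulledBack_eventually (fun i => (h i).1) hb,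
        W.eventually_ne (FnSpace.RegAt_of_pulledBack h hb) h0] with w' h1 h2 using ⟨h1, h2⟩
  refine ⟨hc, ?_⟩
  rintro g x ⟨a, ha, b, hb, h0, hg⟩
  have h1 := W.mul (FnSpace.RegAt_of_pulledBack h ha)
    (W.inv (FnSpace.RegAt_of_pulledBack h hb) h0)
  refine W.congr ?_ h1
  have := hc.continuousAt.eventually hg
  filter_upwards [this] with y hy
  exact ((div_eq_mul_inv _ _).symm.trans hy.symm)

/-- The induced structure on a subset. -/
def FnSpace.sub (X : FnSpace) (S : Set X) : FnSpace :=
  initial (T := S) (fun _ : Unit => X) (fun _ s => s.1)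

theorem sub_val {X : FnSpace} (S : Set X) : IsMorphism (X := X.sub S) (Y := X) Subtype.val :=
  initial_proj (T := S) (fun _ : Unit => X) (fun _ s => s.1) ()

theorem sub_lift {X W : FnSpace} {S : Set X} {φ : W → S}
    (h : IsMorphism (X := W) (Y := X) fun w => (φ w).1) :
    IsMorphism (X := W) (Y := X.sub S) φ :=
  initial_lift (T := S) (X := fun _ : Unit => X) (p := fun _ s => s.1) fun _ => h

/-- The product of two spaces with functions. -/
def FnSpace.prod (X Y : FnSpace) : FnSpace :=
  initial (T := X × Y) (fun b : Bool => match b with | false => X | true => Y)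
    (fun b => match b with | false => Prod.fst | true => Prod.snd)

theorem prod_fst (X Y : FnSpace) : IsMorphism (X := X.prod Y) (Y := X) Prod.fst :=
  initial_proj (T := X × Y) (fun b : Bool => match b with | false => X | true => Y)
    (fun b => match b with | false => Prod.fst | true => Prod.snd) false

theorem prod_snd (X Y : FnSpace) : IsMorphism (X := X.prod Y) (Y := Y) Prod.snd :=
  initial_proj (T := X × Y) (fun b : Bool => match b with | false => X | true => Y)
    (fun b => match b with | false => Prod.fst | true => Prod.snd) true

theorem prod_lift {X Y W : FnSpace} {φ : W → X × Y}
    (h1 : IsMorphism (X := W) (Y := X) fun w => (φ w).1)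
    (h2 : IsMorphism (X := W) (Y := Y) fun w => (φ w).2) :
    IsMorphism (X := W) (Y := X.prod Y) φ :=
  initial_lift (T := X × Y) (X := fun b : Bool => match b with | false => X | true => Y)
    (p := fun b => match b with | false => Prod.fst | true => Prod.snd)
    (fun b => match b with | false => h1 | true => h2)

/-- The Cartesian power `X^n`. -/
def FnSpace.pow (X : FnSpace) (n : ℕ) : FnSpace :=
  initial (T := Fin n → X) (fun _ : Fin n => X) (fun i v => v i)

/-- The one-point space. -/
def FnSpace.point : FnSpace :=
  initial (T := Unit) (fun i : Empty => i.elim) (fun i => i.elim)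

/-! ### Final structures: disjoint unions and quotients -/

/-- The final structure on `T` along maps `q i : X i → T`: a set is open if its preimages are, a
function is regular on an open set if its pull-backs are. For the canonical map to a set of orbits it
is the quotient by the group; for the inclusions of the summands it is the disjoint union. -/
def final {T ι : Type} (X : ι → FnSpace) (q : ∀ i, X i → T) : FnSpace :=
  letI : TopologicalSpace T := ⨆ i, TopologicalSpace.coinduced (q i) (X i).top
  have ho {U : Set T} : IsOpen U ↔ ∀ i, IsOpen (q i ⁻¹' U) := by
    rw [isOpen_iSup_iff]
    exact forall_congr' fun i => isOpen_coinduced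
  have hc (i : ι) : Continuous (q i) := ⟨fun U hU => ho.1 hU i⟩
  { carrier := T
    RegAt := fun f t => ∃ U : Set T, IsOpen U ∧ t ∈ U ∧
      ∀ (i : ι) (x : X i), q i x ∈ U → (X i).RegAt (f ∘ q i) x
    congr := by
      rintro f g t hfg ⟨U, hU, ht, h⟩
      obtain ⟨V, hV, hVo, htV⟩ := eventually_nhds_iff.1 hfg
      refine ⟨U ∩ V, hU.inter hVo, ⟨ht, htV⟩, fun i x hx => (X i).congr ?_ (h i x hx.1)⟩
      have h2 : ∀ᶠ y in 𝓝 (q i x), f y = g y := by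
        filter_upwards [hVo.mem_nhds hx.2] with y hy using hV y hy
      exact (hc i).continuousAt.eventually h2
    eventually_reg := by
      rintro f t ⟨U, hU, ht, h⟩
      filter_upwards [hU.mem_nhds ht] with s hs using ⟨U, hU, hs, h⟩
    const := fun c t => ⟨Set.univ, isOpen_univ, trivial, fun i x _ => (X i).const c x⟩
    add := by
      rintro f g t ⟨U, hU, ht, h⟩ ⟨V, hV, ht', h'⟩
      exact ⟨U ∩ V, hU.inter hV, ⟨ht, ht'⟩,
        fun i x hx => (X i).add (h i x hx.1) (h' i x hx.2)⟩
    mul := by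
      rintro f g t ⟨U, hU, ht, h⟩ ⟨V, hV, ht', h'⟩
      exact ⟨U ∩ V, hU.inter hV, ⟨ht, ht'⟩,
        fun i x hx => (X i).mul (h i x hx.1) (h' i x hx.2)⟩
    eventually_ne := by
      rintro f t ⟨U, hU, ht, h⟩ h0
      have hV : IsOpen {s | s ∈ U ∧ f s ≠ 0} := ho.2 fun i => isOpen_iff_mem_nhds.2 fun x hx => by
        filter_upwards [(hU.preimage (hc i)).mem_nhds hx.1,
          (X i).eventually_ne (h i x hx.1) hx.2] with y h1 h2 using ⟨h1, h2⟩
      filter_upwards [hV.mem_nhds ⟨ht, h0⟩] with s hs using hs.2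
    inv := by
      rintro f t ⟨U, hU, ht, h⟩ h0
      have hV : IsOpen {s | s ∈ U ∧ f s ≠ 0} := ho.2 fun i => isOpen_iff_mem_nhds.2 fun x hx => by
        filter_upwards [(hU.preimage (hc i)).mem_nhds hx.1,
          (X i).eventually_ne (h i x hx.1) hx.2] with y h1 h2 using ⟨h1, h2⟩
      exact ⟨_, hV, ⟨ht, h0⟩, fun i x hx => (X i).inv (h i x hx.1) hx.2⟩ }

/-- The disjoint union of a family. -/
def FnSpace.sigma {ι : Type} (X : ι → FnSpace) : FnSpace :=
  final (T := Σ i, X i) X (fun i x => ⟨i, x⟩)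

/-- The disjoint union of two spaces. -/
def FnSpace.sum (X Y : FnSpace) : FnSpace :=
  final (T := X ⊕ Y) (fun b : Bool => match b with | false => X | true => Y)
    (fun b => match b with | false => Sum.inl | true => Sum.inr)

/-- The unordered tuple underlying an ordered one: the canonical map `X^n → X^n / S_n`. -/
def unordered {X : Type} {n : ℕ} (v : Fin n → X) : Sym X n :=
  ⟨Finset.univ.val.map v, by simp⟩

/-- The symmetric product `S^n X = X^n / S_n` with the quotient structure. -/
def FnSpace.symPow (X : FnSpace) (n : ℕ) : FnSpace :=
  final (T := Sym X n) (fun _ : Unit => X.pow n) (fun _ v => unordered (X := X) v)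

/-! ### Projective space and quasi-projective varieties -/

/-- The points of the complex projective space of dimension `N`. -/
abbrev ProjPt (N : ℕ) : Type := Projectivization ℂ (Fin (N + 1) → ℂ)

/-- The Zariski topology on projective space. -/
@[reducible] def zariskiTop (N : ℕ) : TopologicalSpace (ProjPt N) :=
  TopologicalSpace.generateFrom
    {S | ∃ (d : ℕ) (F : MvPolynomial (Fin (N + 1)) ℂ), F.IsHomogeneous d ∧
      S = {x | MvPolynomial.eval x.rep F ≠ 0}}

theorem zariski_eventually_ne {N d : ℕ} {F : MvPolynomial (Fin (N + 1)) ℂ}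
    (hF : F.IsHomogeneous d) {x : ProjPt N} (h0 : MvPolynomial.eval x.rep F ≠ 0) :
    ∀ᶠ y in @nhds _ (zariskiTop N) x, MvPolynomial.eval y.rep F ≠ 0 := by
  let _ := zariskiTop N
  have ho : IsOpen {x : ProjPt N | MvPolynomial.eval x.rep F ≠ 0} :=
    TopologicalSpace.isOpen_generateFrom_of_mem ⟨d, F, hF, rfl⟩
  exact ho.mem_nhds h0

/-- Complex projective space with its Zariski topology and regular functions: those that locally are
quotients of two homogeneous polynomials of the same degree. -/
def projSpace (N : ℕ) : FnSpace :=
  letI := zariskiTop N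
  { carrier := ProjPt N
    RegAt := fun f x => ∃ (d : ℕ) (F G : MvPolynomial (Fin (N + 1)) ℂ), F.IsHomogeneous d ∧
      G.IsHomogeneous d ∧ MvPolynomial.eval x.rep G ≠ 0 ∧
      f =ᶠ[𝓝 x] fun y => MvPolynomial.eval y.rep F / MvPolynomial.eval y.rep G
    congr := by
      rintro f g x hfg ⟨d, F, G, hF, hG, h0, h⟩
      exact ⟨d, F, G, hF, hG, h0, hfg.symm.trans h⟩
    eventually_reg := by
      rintro f x ⟨d, F, G, hF, hG, h0, h⟩
      filter_upwards [zariski_eventually_ne hG h0, h.eventuallyEq_nhds] with y h1 h2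
      exact ⟨d, F, G, hF, hG, h1, h2⟩
    const := fun c x => ⟨0, MvPolynomial.C c, 1, MvPolynomial.isHomogeneous_C _ _,
      MvPolynomial.isHomogeneous_one _ _, by simp, Eventually.of_forall fun y => by simp⟩
    add := by
      rintro f g x ⟨d, F, G, hF, hG, h0, h⟩ ⟨d', F', G', hF', hG', h0', h'⟩
      refine ⟨d + d', F * G' + G * F', G * G', (hF.mul hG').add (hG.mul hF'), hG.mul hG',
        by simpa using ⟨h0, h0'⟩, ?_⟩
      filter_upwards [h, h', zariski_eventually_ne hG h0,
        zariski_eventually_ne hG' h0'] with y h1 h2 h3 h4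
      simp only [Pi.add_apply, h1, h2, map_add, map_mul]
      field_simp
    mul := by
      rintro f g x ⟨d, F, G, hF, hG, h0, h⟩ ⟨d', F', G', hF', hG', h0', h'⟩
      refine ⟨d + d', F * F', G * G', hF.mul hF', hG.mul hG', by simpa using ⟨h0, h0'⟩, ?_⟩
      filter_upwards [h, h'] with y h1 h2
      simp only [Pi.mul_apply, h1, h2, map_mul, div_mul_div_comm]
    eventually_ne := by
      rintro f x ⟨d, F, G, hF, hG, h0, h⟩ hx
      have hx' : MvPolynomial.eval x.rep F ≠ 0 :=
        fun h1 => hx (by simpa [h1] using h.self_of_nhds)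
      filter_upwards [h, zariski_eventually_ne hG h0, zariski_eventually_ne hF hx'] with y h1 h2 h3
      rw [h1]
      exact div_ne_zero h3 h2
    inv := by
      rintro f x ⟨d, F, G, hF, hG, h0, h⟩ hx
      have hx' : MvPolynomial.eval x.rep F ≠ 0 :=
        fun h1 => hx (by simpa [h1] using h.self_of_nhds)
      refine ⟨d, G, F, hG, hF, hx', ?_⟩
      filter_upwards [h] with y h1
      simp [h1] }

/-- Complex quasi-projective varieties: spaces with functions isomorphic to a Zariski locally closed
subset of a projective space (not necessarily irreducible, possibly empty). -/
def IsQuasiProjective (X : FnSpace) : Prop :=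
  ∃ (N : ℕ) (W : Set (projSpace N)), IsLocallyClosed W ∧ Nonempty (X.Iso ((projSpace N).sub W))

/-! ### Embeddings; subvarieties, products and the point are quasi-projective -/

/-- `φ` identifies `X` with its image, with the induced structure. -/
def IsEmb {X Y : FnSpace} (φ : X → Y) : Prop :=
  Function.Injective φ ∧ IsMorphism φ ∧
    ∀ (W : FnSpace) (ψ : W → X), IsMorphism (X := W) (Y := Y) (fun w => φ (ψ w)) → IsMorphism ψ

theorem IsEmb.comp {X Y Z : FnSpace} {ψ : Y → Z} {φ : X → Y} (hψ : IsEmb ψ) (hφ : IsEmb φ) :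
    IsEmb (X := X) (Y := Z) (fun x => ψ (φ x)) :=
  ⟨hψ.1.comp hφ.1, hψ.2.1.comp hφ.2.1, fun _ _ h => hφ.2.2 _ _ (hψ.2.2 _ _ h)⟩

theorem FnSpace.Iso.isEmb {X Y : FnSpace} (e : X.Iso Y) : IsEmb (X := X) (Y := Y) e.toEquiv :=
  ⟨e.toEquiv.injective, e.isMorphism, fun W ψ h => by
    simpa using e.isMorphism_symm.comp h⟩

theorem isEmb_val {X : FnSpace} (S : Set X) : IsEmb (X := X.sub S) (Y := X) Subtype.val :=
  ⟨Subtype.val_injective, sub_val S, fun _ _ h => sub_lift h⟩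

theorem IsEmb.prodMap {X Y X' Y' : FnSpace} {φ : X → Y} {φ' : X' → Y'} (h : IsEmb φ)
    (h' : IsEmb φ') : IsEmb (X := X.prod X') (Y := Y.prod Y') (Prod.map φ φ') :=
  ⟨h.1.prodMap h'.1,
    prod_lift (h.2.1.comp (prod_fst X X')) (h'.2.1.comp (prod_snd X X')),
    fun W _ hψ => prod_lift
      (h.2.2 W _ ((prod_fst Y Y').comp hψ)) (h'.2.2 W _ ((prod_snd Y Y').comp hψ))⟩

theorem IsEmb.iso_range {X Y : FnSpace} {φ : X → Y} (h : IsEmb φ) :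
    Nonempty (X.Iso (Y.sub (Set.range φ))) := by
  refine ⟨Equiv.ofInjective φ h.1, sub_lift h.2.1, h.2.2 (Y.sub (Set.range φ)) _ ?_⟩
  have : (fun w : Set.range φ => φ ((Equiv.ofInjective φ h.1).symm w)) = Subtype.val := by
    funext w
    exact Equiv.apply_ofInjective_symm h.1 w
  exact this ▸ sub_val _

theorem initial_inducing {T : Type} {X : FnSpace} (φ : T → X) :
    IsInducing (X := initial (fun _ : Unit => X) (fun _ => φ)) (Y := X) φ := by
  refine ⟨le_antisymm (continuous_iff_le_induced.1
    (initial_proj (fun _ : Unit => X) (fun _ => φ) ()).1) ?_⟩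
  refine le_generateFrom ?_
  rintro _ (⟨i, U, hU, rfl⟩ | ⟨b, rfl⟩)
  · exact ⟨U, hU, rfl⟩
  · let _ : TopologicalSpace T := TopologicalSpace.induced φ X.top
    have hc : Continuous φ := continuous_induced_dom
    refine (@isOpen_iff_mem_nhds T (TopologicalSpace.induced φ X.top) _).2 ?_
    rintro t ⟨hb, h0⟩
    obtain ⟨g, hg, rfl⟩ : ∃ g : X → ℂ, X.RegAt g (φ t) ∧ b = g ∘ φ := by
      unfold pulledBack at hb
      clear h0
      induction hb using Algebra.adjoin_induction with
      | mem g hg =>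
        obtain ⟨i, f, hf, rfl⟩ := hg
        exact ⟨f, hf, rfl⟩
      | algebraMap c => exact ⟨_, X.const c _, rfl⟩
      | add x y _ _ hx hy =>
        obtain ⟨f, hf, rfl⟩ := hx
        obtain ⟨g, hg, rfl⟩ := hy
        exact ⟨_, X.add hf hg, rfl⟩
      | mul x y _ _ hx hy =>
        obtain ⟨f, hf, rfl⟩ := hx
        obtain ⟨g, hg, rfl⟩ := hy
        exact ⟨_, X.mul hf hg, rfl⟩
    filter_upwards [pulledBack_eventually (X := fun _ : Unit => X) (p := fun _ => φ)
      (φ := fun t : T => t) (fun _ => hc) hb,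
      hc.continuousAt.eventually (X.eventually_ne hg h0)] with s h1 h2 using ⟨h1, h2⟩

theorem IsEmb.inducing {X Y : FnSpace} {φ : X → Y} (h : IsEmb φ) : IsInducing φ := by
  refine ⟨le_antisymm (continuous_iff_le_induced.1 h.2.1.1) ?_⟩
  have h1 := h.2.2 (initial (fun _ : Unit => Y) (fun _ => φ)) (fun x => x)
    (initial_proj (fun _ : Unit => Y) (fun _ => φ) ())
  have h2 := (initial_inducing φ).eq_induced
  exact (le_of_eq h2.symm).trans (continuous_id_iff_le.1 h1.1)

theorem isQuasiProjective_iff {X : FnSpace} : IsQuasiProjective X ↔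
    ∃ (N : ℕ) (φ : X → projSpace N), IsEmb φ ∧ IsLocallyClosed (Set.range φ) := by
  constructor
  · rintro ⟨N, W, hW, ⟨e⟩⟩
    refine ⟨N, fun x => (e.toEquiv x : W).1, (isEmb_val W).comp e.isEmb, ?_⟩
    have : Set.range (fun x => (e.toEquiv x : W).1) = W := by
      have h := e.toEquiv.surjective.range_comp (fun w : W => w.1)
      exact h.trans Subtype.range_coe
    rwa [this]
  · rintro ⟨N, φ, hφ, hr⟩
    exact ⟨N, _, hr, hφ.iso_range⟩

theorem IsQuasiProjective.sub {X : FnSpace} (hX : IsQuasiProjective X) {S : Set X}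
    (hS : IsLocallyClosed S) : IsQuasiProjective (X.sub S) := by
  obtain ⟨N, φ, hφ, hr⟩ := isQuasiProjective_iff.1 hX
  refine isQuasiProjective_iff.2 ⟨N, _, hφ.comp (isEmb_val S), ?_⟩
  have : Set.range (fun s : S => φ s.1) = φ '' S := by
    ext y; simp
  exact this ▸ hS.image hφ.inducing hr

theorem eval_mul_homogeneous {σ : Type} {d : ℕ} {F : MvPolynomial σ ℂ} (hF : F.IsHomogeneous d)
    (c : ℂ) (v : σ → ℂ) :
    MvPolynomial.eval (fun i => c * v i) F = c ^ d * MvPolynomial.eval v F := by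
  rw [MvPolynomial.eval_eq, MvPolynomial.eval_eq, Finset.mul_sum]
  refine Finset.sum_congr rfl fun m hm => ?_
  have hd : ∑ i ∈ m.support, m i = d := by
    have := hF (MvPolynomial.mem_support_iff.1 hm)
    rw [← this]
    simp [Finsupp.weight_apply, Finsupp.sum]
  simp_rw [mul_pow, Finset.prod_mul_distrib, Finset.prod_pow_eq_pow_sum, hd]
  ring

theorem regAt_eval {T : FnSpace} {σ : Type} {t : T} {f : σ → T → ℂ} (hf : ∀ i, T.RegAt (f i) t)
    (F : MvPolynomial σ ℂ) : T.RegAt (fun s => MvPolynomial.eval (fun i => f i s) F) t := by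
  induction F using MvPolynomial.induction_on with
  | C a => simpa using T.const a t
  | add p q hp hq => simpa [Pi.add_def] using T.add hp hq
  | mul_X p i hp => simpa [Pi.mul_def] using T.mul hp (hf i)

/-- A map to projective space given near each point by regular homogeneous coordinates. -/
theorem isMorphism_of_coord {T : FnSpace} {N : ℕ} {φ : T → projSpace N}
    (h : ∀ t, ∃ f : Fin (N + 1) → T → ℂ, (∀ i, T.RegAt (f i) t) ∧
      ∀ᶠ s in 𝓝 t, ∃ c : ℂ, ∀ i, (φ s : ProjPt N).rep i = c * f i s) : IsMorphism φ := by
  have key {s : T} {c : ℂ} {f : Fin (N + 1) → T → ℂ}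
      (hc : ∀ i, (φ s : ProjPt N).rep i = c * f i s) :
      c ≠ 0 ∧ ∀ {d : ℕ} {F : MvPolynomial (Fin (N + 1)) ℂ}, F.IsHomogeneous d →
        MvPolynomial.eval (φ s : ProjPt N).rep F =
          c ^ d * MvPolynomial.eval (fun i => f i s) F := by
    constructor
    · rintro rfl
      exact (φ s : ProjPt N).rep_nonzero (funext fun i => by simp [hc i])
    · intro d F hF
      rw [← eval_mul_homogeneous hF, ← funext hc]
  have hcont : Continuous φ := by
    refine continuous_generateFrom_iff.2 ?_
    rintro _ ⟨d, F, hF, rfl⟩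
    refine isOpen_iff_mem_nhds.2 fun t ht => ?_
    obtain ⟨f, hf, hev⟩ := h t
    have h0 : MvPolynomial.eval (fun i => f i t) F ≠ 0 := by
      obtain ⟨c, hc⟩ := hev.self_of_nhds
      intro h0
      exact ht (by rw [(key hc).2 hF, h0, mul_zero])
    filter_upwards [hev, T.eventually_ne (regAt_eval hf F) h0] with s ⟨c, hc⟩ hs
    have := mul_ne_zero (pow_ne_zero d (key hc).1) hs
    rwa [← (key hc).2 hF] at this
  refine ⟨hcont, ?_⟩
  rintro g t ⟨d, F, G, hF, hG, h0, hg⟩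
  obtain ⟨f, hf, hev⟩ := h t
  have h0' : MvPolynomial.eval (fun i => f i t) G ≠ 0 := by
    obtain ⟨c, hc⟩ := hev.self_of_nhds
    intro h1
    exact h0 (by rw [(key hc).2 hG, h1, mul_zero])
  refine T.congr ?_ (T.mul (regAt_eval hf F) (T.inv (regAt_eval hf G) h0'))
  filter_upwards [hev, hcont.continuousAt.eventually hg] with s ⟨c, hc⟩ hs
  refine Eq.trans ?_ hs.symm
  rw [(key hc).2 hF, (key hc).2 hG, mul_div_mul_left _ _ (pow_ne_zero d (key hc).1)]
  exact (div_eq_mul_inv _ _).symm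

theorem regAt_coord {N : ℕ} {x : ProjPt N} (i : Fin (N + 1)) {j : Fin (N + 1)}
    (hj : x.rep j ≠ 0) : (projSpace N).RegAt (fun y : ProjPt N => y.rep i / y.rep j) x :=
  ⟨1, MvPolynomial.X i, MvPolynomial.X j, MvPolynomial.isHomogeneous_X _ _,
    MvPolynomial.isHomogeneous_X _ _, by simpa using hj, Eventually.of_forall fun y => by simp⟩

theorem coord_eventually_ne {N : ℕ} {x : ProjPt N} {j : Fin (N + 1)} (hj : x.rep j ≠ 0) :
    ∀ᶠ y in @nhds _ (zariskiTop N) x, y.rep j ≠ 0 := by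
  have := zariski_eventually_ne (MvPolynomial.isHomogeneous_X ℂ j) (x := x) (by simpa using hj)
  simpa using this

theorem exists_coord_ne {N : ℕ} (x : ProjPt N) : ∃ j, x.rep j ≠ 0 :=
  Function.ne_iff.1 x.rep_nonzero

theorem proj_ext {N : ℕ} {x y : ProjPt N} {c : ℂ} (h : ∀ i, x.rep i = c * y.rep i) : x = y := by
  rw [← x.mk_rep, ← y.mk_rep, Projectivization.mk_eq_mk_iff']
  exact ⟨c, funext fun i => (h i).symm⟩

/-- Numbering of the homogeneous coordinates in the Segre embedding. -/
def segreIdx (N M : ℕ) : Fin (N + 1) × Fin (M + 1) ≃ Fin (N * M + N + M + 1) :=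
  finProdFinEquiv.trans (finCongr (by ring))

/-- The Segre embedding, in homogeneous coordinates `z_ij = x_i y_j`. -/
def segre (N M : ℕ) (p : ProjPt N × ProjPt M) : ProjPt (N * M + N + M) :=
  Projectivization.mk ℂ
    (fun k => p.1.rep ((segreIdx N M).symm k).1 * p.2.rep ((segreIdx N M).symm k).2) (by
      obtain ⟨i, hi⟩ := exists_coord_ne p.1
      obtain ⟨j, hj⟩ := exists_coord_ne p.2
      refine Function.ne_iff.2 ⟨segreIdx N M (i, j), ?_⟩
      simpa using ⟨hi, hj⟩)

theorem segre_rep {N M : ℕ} (p : ProjPt N × ProjPt M) :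
    ∃ c : ℂ, c ≠ 0 ∧ ∀ i j, (segre N M p).rep (segreIdx N M (i, j)) =
      c * (p.1.rep i * p.2.rep j) := by
  obtain ⟨a, ha⟩ := Projectivization.exists_smul_eq_mk_rep ℂ
    (fun k => p.1.rep ((segreIdx N M).symm k).1 * p.2.rep ((segreIdx N M).symm k).2) (by
      obtain ⟨i, hi⟩ := exists_coord_ne p.1
      obtain ⟨j, hj⟩ := exists_coord_ne p.2
      refine Function.ne_iff.2 ⟨segreIdx N M (i, j), ?_⟩
      simpa using ⟨hi, hj⟩)
  refine ⟨a, a.ne_zero, fun i j => ?_⟩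
  have := congrFun ha (segreIdx N M (i, j))
  unfold segre
  rw [← this]
  simp [Units.smul_def]

theorem segre_isEmb (N M : ℕ) :
    IsEmb (X := (projSpace N).prod (projSpace M)) (Y := projSpace (N * M + N + M))
      (segre N M) := by
  refine ⟨?_, ?_, ?_⟩
  · rintro p q hpq
    obtain ⟨c, hc, h⟩ := segre_rep p
    obtain ⟨c', hc', h'⟩ := segre_rep q
    have hpq' : ∀ i j, c * (p.1.rep i * p.2.rep j) = c' * (q.1.rep i * q.2.rep j) :=
      fun i j => by rw [← h, ← h', show segre N M p = segre N M q from hpq]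
    obtain ⟨i₀, hi⟩ := exists_coord_ne p.1
    obtain ⟨j₀, hj⟩ := exists_coord_ne p.2
    refine Prod.ext (proj_ext (c := c' * q.2.rep j₀ / (c * p.2.rep j₀)) fun i => ?_)
      (proj_ext (c := c' * q.1.rep i₀ / (c * p.1.rep i₀)) fun j => ?_)
    · have := hpq' i j₀
      field_simp
      linear_combination this
    · have := hpq' i₀ j
      field_simp
      linear_combination this
  · refine isMorphism_of_coord fun p => ?_
    obtain ⟨i₀, hi⟩ := exists_coord_ne p.1
    obtain ⟨j₀, hj⟩ := exists_coord_ne p.2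
    refine ⟨fun k q => (q.1.rep ((segreIdx N M).symm k).1 / q.1.rep i₀) *
      (q.2.rep ((segreIdx N M).symm k).2 / q.2.rep j₀), fun k => ?_, ?_⟩
    · exact FnSpace.mul _
        ((prod_fst (projSpace N) (projSpace M)).2 _ p (regAt_coord _ hi))
        ((prod_snd (projSpace N) (projSpace M)).2 _ p (regAt_coord _ hj))
    · filter_upwards [(prod_fst (projSpace N) (projSpace M)).1.continuousAt.eventually
          (coord_eventually_ne hi),
        (prod_snd (projSpace N) (projSpace M)).1.continuousAt.eventually
          (coord_eventually_ne hj)] with q h1 h2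
      obtain ⟨c, hc, h⟩ := segre_rep q
      refine ⟨c * q.1.rep i₀ * q.2.rep j₀, fun k => ?_⟩
      have := h ((segreIdx N M).symm k).1 ((segreIdx N M).symm k).2
      simp only [Prod.mk.eta, Equiv.apply_symm_apply] at this
      rw [this]
      field_simp
  · intro W ψ hψ
    refine prod_lift (isMorphism_of_coord fun w => ?_) (isMorphism_of_coord fun w => ?_) <;>
    obtain ⟨i₀, hi⟩ := exists_coord_ne (ψ w : ProjPt N × ProjPt M).1 <;>
    obtain ⟨j₀, hj⟩ := exists_coord_ne (ψ w : ProjPt N × ProjPt M).2 <;>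
    have hz : (segre N M (ψ w)).rep (segreIdx N M (i₀, j₀)) ≠ 0 := by
      obtain ⟨c, hc, h⟩ := segre_rep (ψ w : ProjPt N × ProjPt M)
      rw [h]
      exact mul_ne_zero hc (mul_ne_zero hi hj)
    · refine ⟨fun i v => (segre N M (ψ v)).rep (segreIdx N M (i, j₀)) /
        (segre N M (ψ v)).rep (segreIdx N M (i₀, j₀)), fun i => hψ.2 _ w (regAt_coord _ hz), ?_⟩
      filter_upwards [hψ.1.continuousAt.eventually (coord_eventually_ne hz)] with v hv
      obtain ⟨c, hc, h⟩ := segre_rep (ψ v : ProjPt N × ProjPt M)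
      refine ⟨(ψ v : ProjPt N × ProjPt M).1.rep i₀, fun i => ?_⟩
      rw [h] at hv
      obtain ⟨h1, h2⟩ := mul_ne_zero_iff.1 (mul_ne_zero_iff.1 hv).2
      rw [h, h]
      field_simp
    · refine ⟨fun j v => (segre N M (ψ v)).rep (segreIdx N M (i₀, j)) /
        (segre N M (ψ v)).rep (segreIdx N M (i₀, j₀)), fun i => hψ.2 _ w (regAt_coord _ hz), ?_⟩
      filter_upwards [hψ.1.continuousAt.eventually (coord_eventually_ne hz)] with v hv
      obtain ⟨c, hc, h⟩ := segre_rep (ψ v : ProjPt N × ProjPt M)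
      refine ⟨(ψ v : ProjPt N × ProjPt M).2.rep j₀, fun i => ?_⟩
      rw [h] at hv
      obtain ⟨h1, h2⟩ := mul_ne_zero_iff.1 (mul_ne_zero_iff.1 hv).2
      rw [h, h]
      field_simp

theorem segre_range_closed (N M : ℕ) :
    IsClosed (X := projSpace (N * M + N + M)) (Set.range (segre N M)) := by
  have hE : Set.range (segre N M) = {z : ProjPt (N * M + N + M) | ∀ i i' j j',
      z.rep (segreIdx N M (i, j)) * z.rep (segreIdx N M (i', j')) -
        z.rep (segreIdx N M (i, j')) * z.rep (segreIdx N M (i', j)) = 0} := by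
    ext z
    constructor
    · rintro ⟨p, rfl⟩ i i' j j'
      obtain ⟨c, hc, h⟩ := segre_rep p
      rw [h, h, h, h]
      ring
    · intro hz
      obtain ⟨k, hk⟩ := exists_coord_ne z
      obtain ⟨⟨i₀, j₀⟩, rfl⟩ := (segreIdx N M).surjective k
      have hx : (fun i => z.rep (segreIdx N M (i, j₀))) ≠ 0 := Function.ne_iff.2 ⟨i₀, hk⟩
      have hy : (fun j => z.rep (segreIdx N M (i₀, j))) ≠ 0 := Function.ne_iff.2 ⟨j₀, hk⟩
      obtain ⟨a, ha⟩ := Projectivization.exists_smul_eq_mk_rep ℂ _ hx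
      obtain ⟨b, hb⟩ := Projectivization.exists_smul_eq_mk_rep ℂ _ hy
      refine ⟨(Projectivization.mk ℂ _ hx, Projectivization.mk ℂ _ hy), ?_⟩
      obtain ⟨c, hc, h⟩ := segre_rep (Projectivization.mk ℂ _ hx, Projectivization.mk ℂ _ hy)
      refine proj_ext (c := c * a * b * z.rep (segreIdx N M (i₀, j₀))) fun k => ?_
      obtain ⟨⟨i, j⟩, rfl⟩ := (segreIdx N M).surjective k
      rw [h]
      simp only [← ha, ← hb, Pi.smul_apply, Units.smul_def, smul_eq_mul]
      linear_combination (-c * a * b) * hz i i₀ j j₀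
  have hE' : Set.range (segre N M) = ⋂ i, ⋂ i', ⋂ j, ⋂ j',
      {z : ProjPt (N * M + N + M) | z.rep (segreIdx N M (i, j)) * z.rep (segreIdx N M (i', j')) -
        z.rep (segreIdx N M (i, j')) * z.rep (segreIdx N M (i', j)) = 0} := by
    rw [hE]; ext z; simp
  refine hE' ▸ isClosed_iInter fun i => isClosed_iInter fun i' => isClosed_iInter fun j =>
    isClosed_iInter fun j' => ⟨?_⟩
  refine TopologicalSpace.isOpen_generateFrom_of_mem ⟨2,
    MvPolynomial.X (segreIdx N M (i, j)) * MvPolynomial.X (segreIdx N M (i', j')) -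
      MvPolynomial.X (segreIdx N M (i, j')) * MvPolynomial.X (segreIdx N M (i', j)), ?_, ?_⟩
  · exact ((MvPolynomial.isHomogeneous_X _ _).mul (MvPolynomial.isHomogeneous_X _ _)).sub
      ((MvPolynomial.isHomogeneous_X _ _).mul (MvPolynomial.isHomogeneous_X _ _))
  · ext z
    simp only [map_sub, map_mul, MvPolynomial.eval_X]
    rfl

theorem IsQuasiProjective.prod {X Y : FnSpace} (hX : IsQuasiProjective X)
    (hY : IsQuasiProjective Y) : IsQuasiProjective (X.prod Y) := by
  obtain ⟨N, φ, hφ, hr⟩ := isQuasiProjective_iff.1 hX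
  obtain ⟨M, χ, hχ, hs⟩ := isQuasiProjective_iff.1 hY
  refine isQuasiProjective_iff.2 ⟨_, _, (segre_isEmb N M).comp (hφ.prodMap hχ), ?_⟩
  have h1 : Set.range (fun p : X × Y => segre N M (Prod.map φ χ p)) =
      segre N M '' (Prod.fst ⁻¹' Set.range φ ∩ Prod.snd ⁻¹' Set.range χ) := by
    have h := Set.range_comp (segre N M) (Prod.map φ χ)
    exact h.trans (congrArg _ Set.range_prodMap)
  have h2 : IsLocallyClosed (X := (projSpace N).prod (projSpace M))
      (Prod.fst ⁻¹' Set.range φ ∩ Prod.snd ⁻¹' Set.range χ) :=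
    (hr.preimage (prod_fst (projSpace N) (projSpace M)).1).inter
      (hs.preimage (prod_snd (projSpace N) (projSpace M)).1)
  have h3 := h2.image (segre_isEmb N M).inducing (segre_range_closed N M).isLocallyClosed
  exact h1 ▸ h3

theorem isQuasiProjective_point : IsQuasiProjective FnSpace.point := by
  let p : ProjPt 0 := Projectivization.mk ℂ (fun _ => 1) (Function.ne_iff.2 ⟨0, one_ne_zero⟩)
  refine isQuasiProjective_iff.2 ⟨0, fun _ => p, ⟨fun a b _ => rfl, ?_, ?_⟩, ?_⟩
  · refine isMorphism_of_coord fun t => ⟨fun i _ => p.rep i, fun i => FnSpace.const _ _ _, ?_⟩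
    exact Eventually.of_forall fun s => ⟨1, fun i => (one_mul _).symm⟩
  · exact fun W ψ _ => initial_lift fun i => i.elim
  · have : Set.range (fun _ : FnSpace.point => (p : projSpace 0)) = Set.univ := by
      refine Set.eq_univ_of_forall fun x => ⟨(() : Unit), ?_⟩
      obtain ⟨j, hj⟩ := exists_coord_ne (x : ProjPt 0)
      refine proj_ext (y := x) (c := p.rep 0 / (x : ProjPt 0).rep j) fun i => ?_
      obtain rfl : i = 0 := Subsingleton.elim (α := Fin 1) i 0
      obtain rfl : j = 0 := Subsingleton.elim (α := Fin 1) j 0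
      exact (div_mul_cancel₀ _ hj).symm
    exact this ▸ isOpen_univ.isLocallyClosed

/-! ### Pairs of varieties -/

/-- A pair `(X, Y)` of a space with functions `X` and a subset `Y`. -/
structure SpacePair where
  amb : FnSpace
  subv : Set amb

/-- An isomorphism of pairs: an isomorphism of the ambient spaces carrying one subset to the other. -/
structure SpacePair.Iso (P Q : SpacePair) extends FnSpace.Iso P.amb Q.amb where
  mem_iff : ∀ x, toEquiv x ∈ Q.subv ↔ x ∈ P.subv

/-- The pair `(S, Y ∩ S)`. -/
def SpacePair.restrict (P : SpacePair) (S : Set P.amb) : SpacePair :=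
  ⟨P.amb.sub S, (Subtype.val : S → P.amb) ⁻¹' P.subv⟩

/-- The product `(X₁ × X₂, (X₁ × Y₂) ∪ (Y₁ × X₂))`. -/
def SpacePair.prod (P Q : SpacePair) : SpacePair :=
  ⟨P.amb.prod Q.amb, {x : P.amb × Q.amb | x.1 ∈ P.subv ∨ x.2 ∈ Q.subv}⟩

/-- The pair `(pt, ∅)`. -/
def SpacePair.point : SpacePair := ⟨FnSpace.point, (∅ : Set Unit)⟩

/-- The disjoint union of two pairs. -/
def SpacePair.sum (P Q : SpacePair) : SpacePair :=
  ⟨P.amb.sum Q.amb, Sum.inl '' P.subv ∪ Sum.inr '' Q.subv⟩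

/-- The disjoint union of a family of pairs. -/
def SpacePair.sigma {ι : Type} (P : ι → SpacePair) : SpacePair :=
  ⟨FnSpace.sigma fun i => (P i).amb, {x : Σ i, (P i).amb | x.2 ∈ (P x.1).subv}⟩

/-- The symmetric product `S^n(X, Y)`: the variety `S^n X` with the set of unordered `n`-tuples of
points of `X` at least one of which belongs to `Y`. -/
def SpacePair.symPow (P : SpacePair) (n : ℕ) : SpacePair :=
  ⟨P.amb.symPow n, {s : Sym P.amb n | ∃ x ∈ s, x ∈ P.subv}⟩

/-- The unordered `n`-tuple in `X ⊔ Y` formed by an unordered `s`-tuple in `X` and an unordered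
`(n - s)`-tuple in `Y`. -/
def joinTuples {X Y : Type} {n : ℕ} (s : Fin (n + 1)) (a : Sym X s) (b : Sym Y (n - s)) :
    Sym (X ⊕ Y) n :=
  ⟨(a : Multiset X).map Sum.inl + (b : Multiset Y).map Sum.inr, by
    have := s.2
    simp
    omega⟩

/-- Finite unions of locally closed subsets. -/
def IsConstructibleSet {X : Type} [TopologicalSpace X] (S : Set X) : Prop :=
  ∃ F : Set (Set X), F.Finite ∧ (∀ T ∈ F, IsLocallyClosed T) ∧ S = ⋃₀ F

/-- A pair of a complex quasi-projective variety and a constructible subset. -/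
def IsVarPair (P : SpacePair) : Prop :=
  IsQuasiProjective P.amb ∧ IsConstructibleSet P.subv

/-- A pair of a complex quasi-projective variety and a locally closed subvariety. -/
def IsLCPair (P : SpacePair) : Prop :=
  IsQuasiProjective P.amb ∧ IsLocallyClosed P.subv

theorem IsConstructibleSet.preimage {X Y : Type} [TopologicalSpace X] [TopologicalSpace Y]
    {S : Set Y} (hS : IsConstructibleSet S) {f : X → Y} (hf : Continuous f) :
    IsConstructibleSet (f ⁻¹' S) := by
  obtain ⟨F, hF, hl, rfl⟩ := hS
  refine ⟨Set.preimage f '' F, hF.image _, ?_, ?_⟩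
  · rintro _ ⟨T, hT, rfl⟩
    exact (hl T hT).preimage hf
  · rw [Set.sUnion_image, Set.preimage_sUnion]

theorem IsConstructibleSet.union {X : Type} [TopologicalSpace X] {S T : Set X}
    (hS : IsConstructibleSet S) (hT : IsConstructibleSet T) : IsConstructibleSet (S ∪ T) := by
  obtain ⟨F, hF, hl, rfl⟩ := hS
  obtain ⟨G, hG, hm, rfl⟩ := hT
  refine ⟨F ∪ G, hF.union hG, ?_, Set.sUnion_union F G |>.symm⟩
  rintro T (h | h)
  exacts [hl T h, hm T h]

theorem isConstructibleSet_empty {X : Type} [TopologicalSpace X] :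
    IsConstructibleSet (∅ : Set X) :=
  ⟨∅, Set.finite_empty, by simp, by simp⟩

theorem IsLCPair.isVarPair (P : SpacePair) (h : IsLCPair P) : IsVarPair P :=
  ⟨h.1, {P.subv}, Set.finite_singleton _, by simpa using h.2, by simp⟩

theorem IsVarPair.restrict {P : SpacePair} (h : IsVarPair P) {S : Set P.amb}
    (hS : IsLocallyClosed S) : IsVarPair (P.restrict S) :=
  ⟨h.1.sub hS, h.2.preimage (sub_val S).1⟩

theorem IsVarPair.prod {P Q : SpacePair} (h : IsVarPair P) (h' : IsVarPair Q) :
    IsVarPair (P.prod Q) :=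
  ⟨h.1.prod h'.1, (h.2.preimage (prod_fst P.amb Q.amb).1).union
    (h'.2.preimage (prod_snd P.amb Q.amb).1)⟩

theorem isVarPair_point : IsVarPair SpacePair.point :=
  ⟨isQuasiProjective_point, isConstructibleSet_empty⟩

/-! ### Isomorphisms of products -/

def SpacePair.prodMapIso {P P' Q Q' : SpacePair} (e : P.Iso P') (f : Q.Iso Q') :
    (P.prod Q).Iso (P'.prod Q') where
  toEquiv := e.toEquiv.prodCongr f.toEquiv
  isMorphism := prod_lift (e.isMorphism.comp (prod_fst P.amb Q.amb))
    (f.isMorphism.comp (prod_snd P.amb Q.amb))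
  isMorphism_symm := prod_lift (e.isMorphism_symm.comp (prod_fst P'.amb Q'.amb))
    (f.isMorphism_symm.comp (prod_snd P'.amb Q'.amb))
  mem_iff x := or_congr (e.mem_iff x.1) (f.mem_iff x.2)

def SpacePair.reflIso (P : SpacePair) : P.Iso P where
  toEquiv := Equiv.refl _
  isMorphism := IsMorphism.id _
  isMorphism_symm := IsMorphism.id _
  mem_iff _ := Iff.rfl

def SpacePair.prodComm (P Q : SpacePair) : (P.prod Q).Iso (Q.prod P) where
  toEquiv := Equiv.prodComm P.amb Q.amb
  isMorphism := prod_lift (prod_snd P.amb Q.amb) (prod_fst P.amb Q.amb)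
  isMorphism_symm := prod_lift (prod_snd Q.amb P.amb) (prod_fst Q.amb P.amb)
  mem_iff _ := or_comm

def SpacePair.prodAssoc (P Q R : SpacePair) :
    ((P.prod Q).prod R).Iso (P.prod (Q.prod R)) where
  toEquiv := Equiv.prodAssoc P.amb Q.amb R.amb
  isMorphism := prod_lift
    ((prod_fst P.amb Q.amb).comp (prod_fst (P.amb.prod Q.amb) R.amb))
    (prod_lift ((prod_snd P.amb Q.amb).comp (prod_fst (P.amb.prod Q.amb) R.amb))
      (prod_snd (P.amb.prod Q.amb) R.amb))
  isMorphism_symm := prod_lift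
    (prod_lift (prod_fst P.amb (Q.amb.prod R.amb))
      ((prod_fst Q.amb R.amb).comp (prod_snd P.amb (Q.amb.prod R.amb))))
    ((prod_snd Q.amb R.amb).comp (prod_snd P.amb (Q.amb.prod R.amb)))
  mem_iff _ := or_assoc.symm

def SpacePair.pointProd (P : SpacePair) : (SpacePair.point.prod P).Iso P where
  toEquiv := Equiv.punitProd P.amb
  isMorphism := prod_snd FnSpace.point P.amb
  isMorphism_symm := prod_lift (initial_lift fun i => i.elim) (IsMorphism.id _)
  mem_iff _ := ⟨Or.inr, fun h => h.resolve_left fun h => h⟩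

def SpacePair.restrictProd (P Q : SpacePair) (S : Set P.amb) :
    ((P.prod Q).restrict ((Prod.fst : P.amb × Q.amb → P.amb) ⁻¹' S)).Iso
      ((P.restrict S).prod Q) where
  toEquiv :=
    { toFun := fun x : {x : P.amb × Q.amb // x.1 ∈ S} => ((⟨x.1.1, x.2⟩ : S), x.1.2)
      invFun := fun x : S × Q.amb => ⟨(x.1.1, x.2), x.1.2⟩
      left_inv := fun _ => rfl
      right_inv := fun _ => rfl }
  isMorphism := prod_lift
    (sub_lift ((prod_fst P.amb Q.amb).comp (sub_val _)))
    ((prod_snd P.amb Q.amb).comp (sub_val _))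
  isMorphism_symm := sub_lift (prod_lift
    ((sub_val S).comp (prod_fst (P.amb.sub S) Q.amb))
    (prod_snd (P.amb.sub S) Q.amb))
  mem_iff _ := Iff.rfl

/-! ### The Grothendieck ring of pairs -/

/-- The relations of the Grothendieck group of the pairs satisfying `C`: isomorphic pairs are
identified, and `[(X, Y)] = [(Z, Y ∩ Z)] + [(X ∖ Z, Y ∩ (X ∖ Z))]` for `Z ⊆ X` closed. -/
def grothRel (C : SpacePair → Prop) : Set (FreeAbelianGroup {P : SpacePair // C P}) :=
  {r | ∃ P Q : {P : SpacePair // C P}, Nonempty (P.1.Iso Q.1) ∧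
    r = FreeAbelianGroup.of P - FreeAbelianGroup.of Q} ∪
  {r | ∃ (P A B : {P : SpacePair // C P}) (Z : Set P.1.amb), IsClosed Z ∧
    A.1 = P.1.restrict Z ∧ B.1 = P.1.restrict Zᶜ ∧
    r = FreeAbelianGroup.of P - (FreeAbelianGroup.of A + FreeAbelianGroup.of B)}

/-- The Grothendieck group of the pairs satisfying `C`. -/
def Groth (C : SpacePair → Prop) : Type 1 :=
  FreeAbelianGroup {P : SpacePair // C P} ⧸ AddSubgroup.closure (grothRel C)

instance (C : SpacePair → Prop) : AddCommGroup (Groth C) :=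
  inferInstanceAs (AddCommGroup (_ ⧸ AddSubgroup.closure (grothRel C)))

/-- The class `[(X, Y)]` of a pair. -/
def Groth.cls {C : SpacePair → Prop} (P : SpacePair) (h : C P) : Groth C :=
  QuotientAddGroup.mk (FreeAbelianGroup.of ⟨P, h⟩)

theorem Groth.cls_iso {C : SpacePair → Prop} {P Q : SpacePair} (hP : C P) (hQ : C Q)
    (e : P.Iso Q) : Groth.cls P hP = Groth.cls Q hQ := by
  refine sub_eq_zero.1 ?_
  exact (QuotientAddGroup.eq_zero_iff _).2
    (AddSubgroup.subset_closure (Or.inl ⟨⟨P, hP⟩, ⟨Q, hQ⟩, ⟨e⟩, rfl⟩))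

theorem Groth.cls_scissor {C : SpacePair → Prop} {P : SpacePair} (hP : C P) {Z : Set P.amb}
    (hZ : IsClosed Z) (hA : C (P.restrict Z)) (hB : C (P.restrict Zᶜ)) :
    Groth.cls P hP = Groth.cls _ hA + Groth.cls _ hB := by
  refine sub_eq_zero.1 ?_
  exact (QuotientAddGroup.eq_zero_iff _).2
    (AddSubgroup.subset_closure (Or.inr ⟨⟨P, hP⟩, ⟨_, hA⟩, ⟨_, hB⟩, Z, hZ, rfl, rfl, rfl⟩))

/-- An isomorphism-invariant function on pairs that is additive for closed subsets extends to the
Grothendieck group. -/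
def Groth.lift {C : SpacePair → Prop} {A : Type*} [AddCommGroup A]
    (f : ∀ P : SpacePair, C P → A)
    (h1 : ∀ P Q hP hQ, Nonempty (P.Iso Q) → f P hP = f Q hQ)
    (h2 : ∀ P hP (Z : Set P.amb) hA hB, IsClosed Z →
      f P hP = f (P.restrict Z) hA + f (P.restrict Zᶜ) hB) : Groth C →+ A :=
  QuotientAddGroup.lift _ (FreeAbelianGroup.lift fun P : {P : SpacePair // C P} => f P.1 P.2) (by
    rw [AddSubgroup.closure_le]
    rintro _ (⟨P, Q, e, rfl⟩ | ⟨P, ⟨_, hA⟩, ⟨_, hB⟩, Z, hZ, rfl, rfl, rfl⟩)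
    · simpa [sub_eq_zero] using h1 P.1 Q.1 P.2 Q.2 e
    · simpa [sub_eq_zero] using h2 P.1 P.2 Z hA hB hZ)

theorem Groth.lift_cls {C : SpacePair → Prop} {A : Type*} [AddCommGroup A]
    (f : ∀ P : SpacePair, C P → A) (h1) (h2) (P : SpacePair) (hP : C P) :
    Groth.lift f h1 h2 (Groth.cls P hP) = f P hP :=
  FreeAbelianGroup.lift_apply_of _ _

theorem Groth.induction {C : SpacePair → Prop} {p : Groth C → Prop}
    (cls : ∀ P hP, p (Groth.cls P hP)) (zero : p 0) (add : ∀ x y, p x → p y → p (x + y))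
    (neg : ∀ x, p x → p (-x)) (x : Groth C) : p x := by
  obtain ⟨x, rfl⟩ := QuotientAddGroup.mk_surjective x
  induction x using FreeAbelianGroup.induction_on with
  | zero => exact zero
  | of P => exact cls P.1 P.2
  | neg P h => exact neg _ h
  | add x y hx hy => exact add _ _ hx hy

/-- The natural map between the Grothendieck groups of two classes of pairs. -/
def Groth.map {C D : SpacePair → Prop} (h : ∀ P, C P → D P) : Groth C →+ Groth D :=
  Groth.lift (fun P hP => Groth.cls P (h P hP))
    (fun _ _ _ _ ⟨e⟩ => Groth.cls_iso _ _ e)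
    (fun _ hP _ hA hB hZ => Groth.cls_scissor (h _ hP) hZ (h _ hA) (h _ hB))

/-- `K_0^pairs(Var_ℂ)`, the Grothendieck ring of pairs of complex quasi-projective varieties. -/
abbrev K0Pairs : Type 1 := Groth IsVarPair

theorem cls_prod_scissor {P Q : SpacePair} (hP : IsVarPair P) (hQ : IsVarPair Q) {Z : Set P.amb}
    (hZ : IsClosed Z) (hA : IsVarPair (P.restrict Z)) (hB : IsVarPair (P.restrict Zᶜ)) :
    (Groth.cls (P.prod Q) (hP.prod hQ) : K0Pairs) =
      Groth.cls ((P.restrict Z).prod Q) (hA.prod hQ) +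
        Groth.cls ((P.restrict Zᶜ).prod Q) (hB.prod hQ) := by
  have hZ' : IsClosed (X := (P.prod Q).amb) ((Prod.fst : P.amb × Q.amb → P.amb) ⁻¹' Z) :=
    hZ.preimage (prod_fst P.amb Q.amb).1
  rw [Groth.cls_scissor (hP.prod hQ) hZ' ((hP.prod hQ).restrict hZ'.isLocallyClosed)
    ((hP.prod hQ).restrict hZ'.isOpen_compl.isLocallyClosed)]
  exact congrArg₂ _ (Groth.cls_iso _ _ (P.restrictProd Q Z))
    (Groth.cls_iso _ _ (P.restrictProd Q Zᶜ))

theorem cls_prod_comm {P Q : SpacePair} (hP : IsVarPair P) (hQ : IsVarPair Q) :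
    (Groth.cls (P.prod Q) (hP.prod hQ) : K0Pairs) = Groth.cls (Q.prod P) (hQ.prod hP) :=
  Groth.cls_iso _ _ (P.prodComm Q)

/-- The biadditive multiplication with `[P] · [Q] = [P × Q]`. -/
def K0Pairs.mulHom : K0Pairs →+ K0Pairs →+ K0Pairs :=
  Groth.lift
    (fun P hP => Groth.lift (fun Q hQ => Groth.cls (P.prod Q) (IsVarPair.prod hP hQ))
      (fun _ _ _ _ ⟨e⟩ => Groth.cls_iso _ _ (SpacePair.prodMapIso P.reflIso e))
      (fun _ hQ _ hA hB hZ => by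
        rw [cls_prod_comm hP hQ, cls_prod_comm hP hA, cls_prod_comm hP hB]
        exact cls_prod_scissor hQ hP hZ hA hB))
    (by
      rintro P Q hP hQ ⟨e⟩
      ext x
      induction x using Groth.induction with
      | cls R hR =>
        rw [Groth.lift_cls, Groth.lift_cls]
        exact Groth.cls_iso _ _ (SpacePair.prodMapIso e R.reflIso)
      | zero => simp
      | add x y hx hy => rw [map_add, map_add, hx, hy]
      | neg x hx => rw [map_neg, map_neg, hx])
    (by
      rintro P hP Z hA hB hZ
      ext x
      induction x using Groth.induction with
      | cls R hR =>
        rw [AddMonoidHom.add_apply, Groth.lift_cls, Groth.lift_cls, Groth.lift_cls]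
        exact cls_prod_scissor hP hR hZ hA hB
      | zero => simp
      | add x y hx hy => rw [map_add, map_add, hx, hy]
      | neg x hx => rw [map_neg, map_neg, hx])

theorem K0Pairs.mulHom_cls {P Q : SpacePair} (hP : IsVarPair P) (hQ : IsVarPair Q) :
    K0Pairs.mulHom (Groth.cls P hP) (Groth.cls Q hQ) = Groth.cls (P.prod Q) (hP.prod hQ) := by
  unfold K0Pairs.mulHom
  rw [Groth.lift_cls, Groth.lift_cls]

theorem K0Pairs.mulHom_comm (x y : K0Pairs) : K0Pairs.mulHom x y = K0Pairs.mulHom y x := by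
  induction x using Groth.induction with
  | cls P hP =>
    induction y using Groth.induction with
    | cls Q hQ => rw [mulHom_cls hP hQ, mulHom_cls hQ hP, cls_prod_comm hP hQ]
    | zero => simp
    | add x y hx hy => simp [hx, hy]
    | neg x hx => simp [hx]
  | zero => simp
  | add x y hx hy => simp [hx, hy]
  | neg x hx => simp [hx]

theorem K0Pairs.mulHom_assoc (x y z : K0Pairs) :
    K0Pairs.mulHom (K0Pairs.mulHom x y) z = K0Pairs.mulHom x (K0Pairs.mulHom y z) := by
  induction x using Groth.induction with
  | cls P hP =>
    induction y using Groth.induction with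
    | cls Q hQ =>
      induction z using Groth.induction with
      | cls R hR =>
        rw [mulHom_cls, mulHom_cls, mulHom_cls, mulHom_cls]
        exact Groth.cls_iso _ _ (P.prodAssoc Q R)
      | zero => simp
      | add x y hx hy => simp [hx, hy]
      | neg x hx => simp [hx]
    | zero => simp
    | add x y hx hy => simp [hx, hy]
    | neg x hx => simp [hx]
  | zero => simp
  | add x y hx hy => simp [hx, hy]
  | neg x hx => simp [hx]

theorem K0Pairs.one_mulHom (x : K0Pairs) :
    K0Pairs.mulHom (Groth.cls SpacePair.point isVarPair_point) x = x := by
  induction x using Groth.induction with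
  | cls P hP =>
    rw [mulHom_cls]
    exact Groth.cls_iso _ _ P.pointProd
  | zero => simp
  | add x y hx hy => simp [hx, hy]
  | neg x hx => simp [hx]

/-- The ring structure: `[P] · [Q] = [P × Q]`, with unit `[(pt, ∅)]`. -/
instance : CommRing K0Pairs :=
  { (inferInstance : AddCommGroup K0Pairs) with
    mul := fun x y => K0Pairs.mulHom x y
    one := Groth.cls SpacePair.point isVarPair_point
    zsmul := (inferInstance : AddCommGroup K0Pairs).zsmul
    mul_assoc := K0Pairs.mulHom_assoc
    mul_comm := K0Pairs.mulHom_comm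
    one_mul := K0Pairs.one_mulHom
    mul_one := fun x => (K0Pairs.mulHom_comm _ _).trans (K0Pairs.one_mulHom x)
    left_distrib := fun x y z => map_add (K0Pairs.mulHom x) y z
    right_distrib := fun x y z => by
      change K0Pairs.mulHom (x + y) z = K0Pairs.mulHom x z + K0Pairs.mulHom y z
      rw [map_add, AddMonoidHom.add_apply]
    zero_mul := fun x => by
      change K0Pairs.mulHom 0 x = 0
      rw [map_zero, AddMonoidHom.zero_apply]
    mul_zero := fun x => map_zero (K0Pairs.mulHom x) }

/-! ### Pre-`λ`-structures and the Kapranov zeta function -/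

/-- A (pre-)`λ`-structure on a ring `R`: series `λ_a(t) = 1 + a t + (higher order terms)` with
`λ_{a+b}(t) = λ_a(t) λ_b(t)`. -/
structure LambdaStructure (R : Type*) [CommRing R] where
  series : R → PowerSeries R
  coeff_zero : ∀ a, PowerSeries.coeff 0 (series a) = 1
  coeff_one : ∀ a, PowerSeries.coeff 1 (series a) = a
  series_add : ∀ a b, series (a + b) = series a * series b

/-- The Kapranov zeta function `ζ_{X,Y}(t) = 1 + ∑_{n ≥ 1} [S^n(X, Y)] t^n` of a pair. -/
def kapranovZeta (hS : ∀ (P : SpacePair) (n : ℕ), IsVarPair P → IsVarPair (P.symPow n))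
    (P : SpacePair) (hP : IsVarPair P) : PowerSeries K0Pairs :=
  1 + PowerSeries.X * PowerSeries.mk fun n => Groth.cls (P.symPow (n + 1)) (hS P (n + 1) hP)

end KPairs

end

/-! The geometric core is a stratification. For `Z` closed in `X`, the function counting the members
of an unordered `n`-tuple that lie in `Z` has closed superlevel sets on `S^n X`, and its level `s`
is isomorphic, as a pair, to `S^s Z × S^(n-s) (X ∖ Z)` (`symPow_restrict_iso`). A tuple meets `Y` if
and only if one of its two parts does, which is exactly the subset of the product of pairs.
Comparing coefficients gives `ζ_P = ζ_Z · ζ_(X∖Z)`. As `ζ` has constant term `1`, it is a unit of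
the power series ring, so it extends to a homomorphism from the Grothendieck group to the group of
units. The linear coefficient is correct because `S^1 P ≅ P`. Uniqueness holds because classes of
pairs generate the group and the series of a negative is the inverse series.

Two facts about quotients carry this. First, taking the union of tuples must be an embedding, not
merely an injection (`joinSym_isEmb`). On a chart the functions of `S^n X` are fractions of
symmetric polynomials. Given a function `d` that vanishes on the first subspace but not at the
points used from the second, symmetrizing against the product of the values of `d` over the last
positions selects the block-preserving permutations, which recovers each part of the tuple from its
union.

Second, `S^n X` must be quasi-projective. For projective space, the polarized elementary symmetric
functions `∑_σ ∏_i x_(g i)(v_(σ i))` give a map `chow` to a projective space. In characteristic zero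
they generate all symmetric polynomials on affine charts (`symmetrization_mem`), so `chow` is an
embedding. Its image is locally closed, because the coordinates of the points are integral over the
invariants: a character of the ring of invariants extends to the integral closure, and the extended
values are coordinates of an actual tuple (`exists_tuple_of_relations`). General quasi-projective
`X` follows because symmetric products preserve embeddings.

For disjoint unions the level sets are also open, which upgrades the stratification to an
isomorphism. For the comparison with locally closed pairs, a constructible subset is locally closed
in every stratum of a suitable stratification; the sum of the classes of strata is independent of
choices by passing to a common refinement, and it inverts the natural map. -/

open Topology Filter

noncomputable section

namespace KPairs

/-! ### Affine charts -/

/-- Precomposition as a homomorphism of algebras of functions. -/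
def precomp {A B : Type} (φ : A → B) : (B → ℂ) →ₐ[ℂ] (A → ℂ) :=
  AlgHom.pi fun a => Pi.evalAlgHom ℂ (fun _ : B => ℂ) (φ a)

@[simp] theorem precomp_apply {A B : Type} (φ : A → B) (f : B → ℂ) : precomp φ f = f ∘ φ := rfl

/-- An open set with an algebra of functions regular on it, whose fractions are all the regular
functions. -/
structure Chart (X : FnSpace) where
  dom : Set X
  isOpen : IsOpen dom
  alg : Subalgebra ℂ (X → ℂ)
  reg : ∀ a ∈ alg, ∀ x ∈ dom, X.RegAt a x
  frac : ∀ x ∈ dom, ∀ f, X.RegAt f x →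
    ∃ a ∈ alg, ∃ b ∈ alg, b x ≠ 0 ∧ ∀ y ∈ dom, f y * b y = a y

/-- The functions of the chart separate its points. -/
def Chart.Separates {X : FnSpace} (c : Chart X) : Prop :=
  ∀ x ∈ c.dom, ∀ y ∈ c.dom, x ≠ y → ∃ a ∈ c.alg, a x ≠ a y

/-- Every finite set of points lies in a separating chart. -/
def HasCharts (X : FnSpace) : Prop :=
  ∀ F : Set X, F.Finite → ∃ c : Chart X, F ⊆ c.dom ∧ c.Separates

/-- The indicator function of `N` is regular at `x`, being constant near it. Its numerator in a
fraction valid on the whole domain is the required function. This translates neighbourhoods into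
algebra. -/
theorem Chart.exists_vanish {X : FnSpace} (c : Chart X) {x : X} (hx : x ∈ c.dom) {N : Set X}
    (hN : N ∈ 𝓝 x) : ∃ a ∈ c.alg, a x ≠ 0 ∧ ∀ y ∈ c.dom, y ∉ N → a y = 0 := by
  classical
  have h1 : X.RegAt (fun y => if y ∈ N then 1 else 0) x := by
    refine X.congr ?_ (X.const 1 x)
    filter_upwards [hN] with y hy
    simp [hy]
  obtain ⟨a, ha, b, hb, h0, h⟩ := c.frac x hx _ h1
  refine ⟨a, ha, ?_, fun y hy hyN => ?_⟩
  · rw [← h x hx]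
    simpa [mem_of_mem_nhds hN] using h0
  · rw [← h y hy]
    simp [hyN]

/-- Regularity of the chart functions along `ψ` already forces continuity: `ψ` stays in a given
neighbourhood wherever the function of `Chart.exists_vanish` is non-zero. -/
theorem isMorphism_of_charts {W X : FnSpace} {ψ : W → X}
    (h : ∀ w, ∃ c : Chart X, (∀ᶠ w' in 𝓝 w, ψ w' ∈ c.dom) ∧
      ∀ a ∈ c.alg, W.RegAt (a ∘ ψ) w) : IsMorphism ψ := by
  constructor
  · refine continuous_iff_continuousAt.2 fun w N hN => ?_
    obtain ⟨c, hc, hreg⟩ := h w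
    obtain ⟨a, ha, h0, hv⟩ := c.exists_vanish hc.self_of_nhds hN
    change ∀ᶠ w' in 𝓝 w, ψ w' ∈ N
    filter_upwards [hc, W.eventually_ne (hreg a ha) h0] with w' h1 h2
    by_contra h3
    exact h2 (hv _ h1 h3)
  · intro f w hf
    obtain ⟨c, hc, hreg⟩ := h w
    obtain ⟨a, ha, b, hb, h0, hv⟩ := c.frac _ hc.self_of_nhds f hf
    refine W.congr ?_ (W.mul (hreg a ha) (W.inv (hreg b hb) h0))
    filter_upwards [hc, W.eventually_ne (hreg b hb) h0] with w' h1 h2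
    have h2' : b (ψ w') ≠ 0 := h2
    simp [← hv _ h1, h2']

/-! ### Charts of initial structures -/

section InitialChart

variable {T ι : Type} {X : ι → FnSpace} (c : ∀ i, Chart (X i)) (p : ∀ i, T → X i)

/-- Polynomials in pulled-back functions of the charts. -/
def chartAlg : Subalgebra ℂ (T → ℂ) :=
  Algebra.adjoin ℂ {g | ∃ i, ∃ a ∈ (c i).alg, g = a ∘ p i}

/-- Clearing denominators commutes with sums and products. The identity holds on all of the domain,
not only near `t`, because it does for each chart. -/
theorem chartAlg_frac {t : T} (ht : ∀ i, p i t ∈ (c i).dom) {f : T → ℂ}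
    (hf : f ∈ pulledBack X p t) : ∃ a ∈ chartAlg c p, ∃ b ∈ chartAlg c p, b t ≠ 0 ∧
      ∀ y, (∀ i, p i y ∈ (c i).dom) → f y * b y = a y := by
  unfold pulledBack at hf
  induction hf using Algebra.adjoin_induction with
  | mem g hg =>
    obtain ⟨i, f, hf, rfl⟩ := hg
    obtain ⟨a, ha, b, hb, h0, h⟩ := (c i).frac _ (ht i) f hf
    exact ⟨_, Algebra.subset_adjoin ⟨i, a, ha, rfl⟩, _, Algebra.subset_adjoin ⟨i, b, hb, rfl⟩, h0,
      fun y hy => h _ (hy i)⟩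
  | algebraMap r =>
    exact ⟨_, Subalgebra.algebraMap_mem _ r, 1, one_mem _, one_ne_zero, fun y _ => mul_one _⟩
  | add x y _ _ hx hy =>
    obtain ⟨a, ha, b, hb, h0, h⟩ := hx
    obtain ⟨a', ha', b', hb', h0', h'⟩ := hy
    refine ⟨a * b' + a' * b, add_mem (mul_mem ha hb') (mul_mem ha' hb), b * b', mul_mem hb hb',
      mul_ne_zero h0 h0', fun z hz => ?_⟩
    have h1 := h z hz
    have h2 := h' z hz
    simp only [Pi.add_apply, Pi.mul_apply]
    linear_combination b' z * h1 + b z * h2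
  | mul x y _ _ hx hy =>
    obtain ⟨a, ha, b, hb, h0, h⟩ := hx
    obtain ⟨a', ha', b', hb', h0', h'⟩ := hy
    refine ⟨a * a', mul_mem ha ha', b * b', mul_mem hb hb',
      mul_ne_zero h0 h0', fun z hz => ?_⟩
    simp only [Pi.mul_apply]
    rw [← h z hz, ← h' z hz]
    ring

/-- Regularity is an open condition, and each of the finitely many functions entering `f`
contributes a factor of `b` vanishing where that function may fail to be regular. -/
theorem chartAlg_domain {t : T} (ht : ∀ i, p i t ∈ (c i).dom) {f : T → ℂ}
    (hf : f ∈ pulledBack X p t) : ∃ b ∈ chartAlg c p, b t ≠ 0 ∧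
      ∀ y, (∀ i, p i y ∈ (c i).dom) → b y ≠ 0 → f ∈ pulledBack X p y := by
  unfold pulledBack at hf
  induction hf using Algebra.adjoin_induction with
  | mem g hg =>
    obtain ⟨i, f, hf, rfl⟩ := hg
    obtain ⟨a, ha, h0, h⟩ := (c i).exists_vanish (ht i) ((X i).eventually_reg hf)
    refine ⟨_, Algebra.subset_adjoin ⟨i, a, ha, rfl⟩, h0, fun y hy h1 => ?_⟩
    refine Algebra.subset_adjoin ⟨i, f, ?_, rfl⟩
    by_contra h2
    exact h1 (h _ (hy i) h2)
  | algebraMap r =>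
    exact ⟨1, one_mem _, one_ne_zero, fun y _ _ => Subalgebra.algebraMap_mem _ r⟩
  | add x y _ _ hx hy =>
    obtain ⟨b, hb, h0, h⟩ := hx
    obtain ⟨b', hb', h0', h'⟩ := hy
    refine ⟨b * b', mul_mem hb hb', mul_ne_zero h0 h0', fun z hz h1 => ?_⟩
    obtain ⟨h2, h3⟩ := mul_ne_zero_iff.1 h1
    exact add_mem (h z hz h2) (h' z hz h3)
  | mul x y _ _ hx hy =>
    obtain ⟨b, hb, h0, h⟩ := hx
    obtain ⟨b', hb', h0', h'⟩ := hy
    refine ⟨b * b', mul_mem hb hb', mul_ne_zero h0 h0', fun z hz h1 => ?_⟩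
    obtain ⟨h2, h3⟩ := mul_ne_zero_iff.1 h1
    exact mul_mem (h z hz h2) (h' z hz h3)

theorem chartAlg_vanish {U : Set T} (hU : @IsOpen _ (initialTop X p) U) :
    ∀ t ∈ U, (∀ i, p i t ∈ (c i).dom) → ∃ b ∈ chartAlg c p, b t ≠ 0 ∧
      ∀ y, (∀ i, p i y ∈ (c i).dom) → y ∉ U → b y = 0 := by
  induction hU with
  | basic S hS =>
    intro t htS ht
    rcases hS with ⟨i, U, hU, rfl⟩ | ⟨b, rfl⟩
    · obtain ⟨a, ha, h0, h⟩ := (c i).exists_vanish (ht i) (hU.mem_nhds htS)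
      exact ⟨_, Algebra.subset_adjoin ⟨i, a, ha, rfl⟩, h0, fun y hy h1 => h _ (hy i) h1⟩
    · obtain ⟨b', hb', h0', h'⟩ := chartAlg_domain c p ht htS.1
      obtain ⟨d, hd, e, he, h0, h⟩ := chartAlg_frac c p ht htS.1
      refine ⟨b' * d, mul_mem hb' hd, mul_ne_zero h0' ?_, fun y hy h1 => ?_⟩
      · rw [← h t ht]
        exact mul_ne_zero htS.2 h0
      · rw [Pi.mul_apply, ← h y hy]
        by_contra h2
        obtain ⟨h3, h4⟩ := mul_ne_zero_iff.1 h2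
        exact h1 ⟨h' y hy h3, (mul_ne_zero_iff.1 h4).1⟩
  | univ => exact fun t _ _ => ⟨1, one_mem _, one_ne_zero, fun y _ h => absurd trivial h⟩
  | inter s t _ _ hs ht =>
    intro x hx hd
    obtain ⟨b, hb, h0, h⟩ := hs x hx.1 hd
    obtain ⟨b', hb', h0', h'⟩ := ht x hx.2 hd
    refine ⟨b * b', mul_mem hb hb', mul_ne_zero h0 h0', fun y hy h1 => ?_⟩
    by_cases h2 : y ∈ s
    · simp [h' y hy fun h3 => h1 ⟨h2, h3⟩]
    · simp [h y hy h2]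
  | sUnion S _ hS =>
    rintro t ⟨s, hs, hts⟩ ht
    obtain ⟨b, hb, h0, h⟩ := hS s hs t hts ht
    exact ⟨b, hb, h0, fun y hy h1 => h y hy fun h2 => h1 ⟨s, hs, h2⟩⟩

/-- The chart of an initial structure defined by charts of its targets. -/
def initialChart [Finite ι] : Chart (initial X p) where
  dom := {t : T | ∀ i, p i t ∈ (c i).dom}
  isOpen := by
    have h : {t : T | ∀ i, p i t ∈ (c i).dom} = ⋂ i, p i ⁻¹' (c i).dom := by ext; simp
    have h' : IsOpen (X := initial X p) (⋂ i, p i ⁻¹' (c i).dom) :=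
      isOpen_iInter_of_finite fun i => (c i).isOpen.preimage (initial_proj X p i).1
    exact h ▸ h'
  alg := chartAlg c p
  reg := by
    intro a ha t ht
    unfold chartAlg at ha
    induction ha using Algebra.adjoin_induction with
    | mem g hg =>
      obtain ⟨i, a, ha, rfl⟩ := hg
      exact (initial_proj X p i).2 _ _ ((c i).reg a ha _ (ht i))
    | algebraMap r => exact FnSpace.const _ r t
    | add x y _ _ hx hy => exact FnSpace.add _ hx hy
    | mul x y _ _ hx hy => exact FnSpace.mul _ hx hy
  frac := by
    rintro t ht f ⟨a, ha, b, hb, h0, h⟩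
    have hN : {s | f s = a s / b s ∧ b s ≠ 0} ∈ @nhds _ (initialTop X p) t :=
      h.and (initialTop_eventually_ne X p hb h0)
    obtain ⟨U, hUN, hU, htU⟩ := (mem_nhds_iff (X := initial X p)).1 hN
    -- Multiplying numerator and denominator by `d` makes both vanish outside `U`, so that an
    -- identity known only on `U` holds on the whole domain.
    obtain ⟨d, hd, hd0, hv⟩ := chartAlg_vanish c p hU t htU ht
    obtain ⟨a1, ha1, a2, ha2, ha0, hav⟩ := chartAlg_frac c p ht ha
    obtain ⟨b1, hb1, b2, hb2, hb0, hbv⟩ := chartAlg_frac c p ht hb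
    refine ⟨d * (a1 * b2), mul_mem hd (mul_mem ha1 hb2), d * (b1 * a2),
      mul_mem hd (mul_mem hb1 ha2), ?_, fun y hy => ?_⟩
    · refine mul_ne_zero hd0 (mul_ne_zero ?_ ha0)
      rw [← hbv t ht]
      exact mul_ne_zero h0 hb0
    · by_cases hyU : y ∈ U
      · obtain ⟨h1, h2⟩ := hUN hyU
        change f y * (d y * (b1 y * a2 y)) = d y * (a1 y * b2 y)
        rw [← hav y hy, ← hbv y hy, h1]
        have h2' : b y ≠ 0 := h2
        field_simp
      · change f y * (d y * (b1 y * a2 y)) = d y * (a1 y * b2 y)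
        rw [hv y hy hyU]
        ring

end InitialChart

/-- The chart of a Cartesian power. -/
def powChart {X : FnSpace} (c : Chart X) (n : ℕ) : Chart (X.pow n) :=
  initialChart (T := Fin n → X) (fun _ : Fin n => c) (fun i v => v i)

/-- Polynomials in functions of the chart composed with the projections of a power. -/
def powAlg {X : Type} (A : Subalgebra ℂ (X → ℂ)) (n : ℕ) : Subalgebra ℂ ((Fin n → X) → ℂ) :=
  Algebra.adjoin ℂ {g | ∃ i, ∃ a ∈ A, g = fun v => a (v i)}

theorem powChart_dom {X : FnSpace} (c : Chart X) (n : ℕ) :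
    (powChart c n).dom = {v : Fin n → X | ∀ i, v i ∈ c.dom} := rfl

/-! ### Charts of embedded spaces -/

/-- The universal property identifies the structure of `X` with the initial one along `φ`. For a
single map, polynomials in pulled-back functions are again pulled-back functions, so every regular
function is locally a restriction. -/
theorem IsEmb.exists_regAt {X Y : FnSpace} {φ : X → Y} (h : IsEmb φ) {f : X → ℂ} {x : X}
    (hf : X.RegAt f x) : ∃ g : Y → ℂ, Y.RegAt g (φ x) ∧ f =ᶠ[𝓝 x] g ∘ φ := by
  have h1 := h.2.2 (initial (fun _ : Unit => Y) (fun _ => φ)) (fun x => x)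
    (initial_proj (fun _ : Unit => Y) (fun _ => φ) ())
  obtain ⟨a, ha, b, hb, h0, hab⟩ := h1.2 f x hf
  have key : ∀ a ∈ pulledBack (fun _ : Unit => Y) (fun _ => φ) x,
      ∃ g : Y → ℂ, Y.RegAt g (φ x) ∧ a = g ∘ φ := by
    intro a ha
    unfold pulledBack at ha
    induction ha using Algebra.adjoin_induction with
    | mem g hg =>
      obtain ⟨i, f, hf, rfl⟩ := hg
      exact ⟨f, hf, rfl⟩
    | algebraMap c => exact ⟨_, Y.const c _, rfl⟩
    | add x y _ _ hx hy =>
      obtain ⟨f, hf, rfl⟩ := hx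
      obtain ⟨g, hg, rfl⟩ := hy
      exact ⟨_, Y.add hf hg, rfl⟩
    | mul x y _ _ hx hy =>
      obtain ⟨f, hf, rfl⟩ := hx
      obtain ⟨g, hg, rfl⟩ := hy
      exact ⟨_, Y.mul hf hg, rfl⟩
  obtain ⟨a, ha', rfl⟩ := key a ha
  obtain ⟨b, hb', rfl⟩ := key b hb
  refine ⟨a * b⁻¹, Y.mul ha' (Y.inv hb' h0), ?_⟩
  have h2 : X.top = initialTop (fun _ : Unit => Y) (fun _ => φ) :=
    h.inducing.eq_induced.trans (initial_inducing φ).eq_induced.symm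
  have h3 : 𝓝 x = @nhds _ (initialTop (fun _ : Unit => Y) (fun _ => φ)) x :=
    congrArg (fun t => @nhds _ t x) h2
  rw [h3]
  filter_upwards [hab] with y hy
  exact hy.trans (div_eq_mul_inv _ _)

/-- The restriction of a chart to an embedded space. -/
def Chart.comapEmb {X Y : FnSpace} (c : Chart Y) {φ : X → Y} (h : IsEmb φ) : Chart X where
  dom := φ ⁻¹' c.dom
  isOpen := c.isOpen.preimage h.2.1.1
  alg := c.alg.map (precomp φ)
  reg := by
    rintro _ ⟨a, ha, rfl⟩ x hx
    exact h.2.1.2 _ _ (c.reg a ha _ hx)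
  frac := by
    intro x hx f hf
    obtain ⟨g, hg, hfg⟩ := h.exists_regAt hf
    rw [EventuallyEq, Filter.Eventually, h.inducing.nhds_eq_comap, Filter.mem_comap] at hfg
    obtain ⟨N, hN, hNf⟩ := hfg
    obtain ⟨d, hd, hd0, hdv⟩ := c.exists_vanish hx hN
    obtain ⟨a, ha, b, hb, h0, hab⟩ := c.frac _ hx g hg
    refine ⟨_, ⟨d * a, mul_mem hd ha, rfl⟩, _, ⟨d * b, mul_mem hd hb, rfl⟩,
      mul_ne_zero hd0 h0, fun y hy => ?_⟩
    change f y * (d (φ y) * b (φ y)) = d (φ y) * a (φ y)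
    by_cases hyN : φ y ∈ N
    · rw [show f y = g (φ y) from hNf hyN, ← hab _ hy]
      ring
    · rw [hdv _ hy hyN]
      ring

theorem HasCharts.of_isEmb {X Y : FnSpace} (hY : HasCharts Y) {φ : X → Y} (h : IsEmb φ) :
    HasCharts X := by
  intro F hF
  obtain ⟨c, hc, hs⟩ := hY (φ '' F) (hF.image φ)
  refine ⟨c.comapEmb h, fun x hx => hc ⟨x, hx, rfl⟩, fun x hx y hy hxy => ?_⟩
  obtain ⟨a, ha, h1⟩ := hs _ hx _ hy (h.1.ne hxy)
  exact ⟨_, ⟨a, ha, rfl⟩, h1⟩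

/-! ### Charts of projective space -/

/-- The value of a linear form on homogeneous coordinates. -/
def linVal {N : ℕ} (l v : Fin (N + 1) → ℂ) : ℂ := ∑ j, l j * v j

/-- Over an infinite field a vector space is not a finite union of proper subspaces. Each `v i` is
used as a functional on the coefficients `l`. This provides a hyperplane missing any finite set of
points of projective space. -/
theorem exists_linVal_ne {N : ℕ} {ι : Type} [Finite ι] (v : ι → Fin (N + 1) → ℂ)
    (hv : ∀ i, v i ≠ 0) : ∃ l, ∀ i, linVal l (v i) ≠ 0 := by
  obtain ⟨l, hl⟩ := Module.Dual.exists_forall_ne_zero_of_forall_exists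
    (K := ℂ) (M := Fin (N + 1) → ℂ)
    (fun i => ∑ j, v i j • (LinearMap.proj j : (Fin (N + 1) → ℂ) →ₗ[ℂ] ℂ)) (fun i => by
      obtain ⟨j, hj⟩ := Function.ne_iff.1 (hv i)
      refine ⟨Pi.single j 1, ?_⟩
      simpa [Pi.single_apply] using hj)
  exact ⟨l, fun i => by simpa [linVal, mul_comm] using hl i⟩

/-- The affine coordinates on the complement of the hyperplane `l = 0`. -/
def affCoord {N : ℕ} (l : Fin (N + 1) → ℂ) (j : Fin (N + 1)) (y : ProjPt N) : ℂ :=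
  y.rep j / linVal l y.rep

/-- The polynomials in the affine coordinates. -/
def affAlg {N : ℕ} (l : Fin (N + 1) → ℂ) : Subalgebra ℂ (ProjPt N → ℂ) :=
  Algebra.adjoin ℂ (Set.range (affCoord l))

theorem eval_linForm {N : ℕ} (l v : Fin (N + 1) → ℂ) :
    MvPolynomial.eval v (∑ j, MvPolynomial.C (l j) * MvPolynomial.X j) = linVal l v := by
  simp [linVal]

theorem isHomogeneous_linForm {N : ℕ} (l : Fin (N + 1) → ℂ) :
    (∑ j, MvPolynomial.C (l j) * MvPolynomial.X j : MvPolynomial (Fin (N + 1)) ℂ).IsHomogeneous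
      1 :=
  MvPolynomial.IsHomogeneous.sum _ _ _ fun j _ => by
    simpa using (MvPolynomial.isHomogeneous_C _ (l j)).mul (MvPolynomial.isHomogeneous_X ℂ j)

/-- By homogeneity, `F(y) / l(y)^d = F(y / l(y))`, a polynomial in the affine coordinates. -/
theorem affAlg_homogeneous {N d : ℕ} (l : Fin (N + 1) → ℂ) {F : MvPolynomial (Fin (N + 1)) ℂ}
    (hF : F.IsHomogeneous d) :
    (fun y : ProjPt N => MvPolynomial.eval y.rep F / linVal l y.rep ^ d) ∈ affAlg l := by
  have h : (fun y : ProjPt N => MvPolynomial.eval y.rep F / linVal l y.rep ^ d) =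
      MvPolynomial.aeval (affCoord l) F := by
    funext y
    have h1 : MvPolynomial.aeval (affCoord l) F y =
        MvPolynomial.eval (fun j => affCoord l j y) F := by
      have h2 := MvPolynomial.comp_aeval_apply (R := ℂ) (f := affCoord l)
        (Pi.evalAlgHom ℂ (fun _ : ProjPt N => ℂ) y) F
      exact h2.trans (by rfl)
    rw [h1]
    have h3 := eval_mul_homogeneous hF (linVal l y.rep)⁻¹ y.rep
    simp only [affCoord, div_eq_inv_mul, inv_pow] at h3 ⊢
    exact h3.symm
  rw [h]
  unfold affAlg
  rw [Algebra.adjoin_range_eq_range_aeval]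
  exact ⟨F, rfl⟩

theorem affAlg_vanish {N : ℕ} (l : Fin (N + 1) → ℂ) {U : Set (ProjPt N)}
    (hU : @IsOpen _ (zariskiTop N) U) : ∀ x ∈ U, linVal l x.rep ≠ 0 →
      ∃ b ∈ affAlg l, b x ≠ 0 ∧ ∀ y, linVal l y.rep ≠ 0 → y ∉ U → b y = 0 := by
  induction hU with
  | basic S hS =>
    obtain ⟨d, F, hF, rfl⟩ := hS
    intro x hx hl
    refine ⟨_, affAlg_homogeneous l hF, div_ne_zero hx (pow_ne_zero _ hl), fun y _ hy => ?_⟩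
    have hy' : MvPolynomial.eval y.rep F = 0 := not_not.1 hy
    simp [hy']
  | univ => exact fun t _ _ => ⟨1, one_mem _, one_ne_zero, fun y _ h => absurd trivial h⟩
  | inter s t _ _ hs ht =>
    intro x hx hd
    obtain ⟨b, hb, h0, h⟩ := hs x hx.1 hd
    obtain ⟨b', hb', h0', h'⟩ := ht x hx.2 hd
    refine ⟨b * b', mul_mem hb hb', mul_ne_zero h0 h0', fun y hy h1 => ?_⟩
    by_cases h2 : y ∈ s
    · simp [h' y hy fun h3 => h1 ⟨h2, h3⟩]
    · simp [h y hy h2]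
  | sUnion S _ hS =>
    rintro t ⟨s, hs, hts⟩ ht
    obtain ⟨b, hb, h0, h⟩ := hS s hs t hts ht
    exact ⟨b, hb, h0, fun y hy h1 => h y hy fun h2 => h1 ⟨s, hs, h2⟩⟩

theorem regAt_affCoord {N : ℕ} {l : Fin (N + 1) → ℂ} {x : ProjPt N} (hx : linVal l x.rep ≠ 0)
    (j : Fin (N + 1)) : (projSpace N).RegAt (affCoord l j) x :=
  ⟨1, MvPolynomial.X j, _, MvPolynomial.isHomogeneous_X _ _, isHomogeneous_linForm l,
    by rwa [eval_linForm], Eventually.of_forall fun y => by simp only [eval_linForm]; simp [affCoord]⟩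

/-- The complement of a hyperplane as a chart. -/
def affChart {N : ℕ} (l : Fin (N + 1) → ℂ) : Chart (projSpace N) where
  dom := {y : ProjPt N | linVal l y.rep ≠ 0}
  isOpen := TopologicalSpace.isOpen_generateFrom_of_mem
    ⟨1, _, isHomogeneous_linForm l, by simp_rw [eval_linForm]; rfl⟩
  alg := affAlg l
  reg := by
    intro a ha x hx
    unfold affAlg at ha
    induction ha using Algebra.adjoin_induction with
    | mem g hg =>
      obtain ⟨j, rfl⟩ := hg
      exact regAt_affCoord hx j
    | algebraMap r => exact FnSpace.const _ r _
    | add x y _ _ hx hy => exact FnSpace.add _ hx hy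
    | mul x y _ _ hx hy => exact FnSpace.mul _ hx hy
  frac := by
    rintro x hx f ⟨d, F, G, hF, hG, h0, h⟩
    have hN : {y | f y = MvPolynomial.eval y.rep F / MvPolynomial.eval y.rep G ∧
        MvPolynomial.eval y.rep G ≠ 0} ∈ @nhds _ (zariskiTop N) x :=
      h.and (zariski_eventually_ne hG h0)
    obtain ⟨U, hUN, hU, hxU⟩ := (mem_nhds_iff (X := projSpace N)).1 hN
    obtain ⟨b, hb, hb0, hv⟩ := affAlg_vanish l hU x hxU hx
    refine ⟨_, mul_mem hb (affAlg_homogeneous l hF), _, mul_mem hb (affAlg_homogeneous l hG),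
      mul_ne_zero hb0 (div_ne_zero h0 (pow_ne_zero _ hx)), fun y hy => ?_⟩
    change f y * (b y * (MvPolynomial.eval (Projectivization.rep y) G / _)) =
      b y * (MvPolynomial.eval (Projectivization.rep y) F / _)
    by_cases hyU : y ∈ U
    · obtain ⟨h1, h2⟩ := hUN hyU
      rw [h1]
      field_simp
    · rw [hv y hy hyU]
      ring

theorem affChart_separates {N : ℕ} (l : Fin (N + 1) → ℂ) : (affChart l).Separates := by
  intro x hx y hy hxy
  by_contra! h
  refine hxy (proj_ext (N := N) (x := x) (y := y)
    (c := linVal l (Projectivization.rep x) / linVal l (Projectivization.rep y)) fun i => ?_)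
  have h1 : affCoord l i x = affCoord l i y := h _ (Algebra.subset_adjoin (A := ProjPt N → ℂ) ⟨i, rfl⟩)
  have hx' : linVal l (Projectivization.rep x) ≠ 0 := hx
  have hy' : linVal l (Projectivization.rep y) ≠ 0 := hy
  unfold affCoord at h1
  field_simp at h1 ⊢
  linear_combination h1

theorem hasCharts_projSpace (N : ℕ) : HasCharts (projSpace N) := by
  intro F hF
  have := hF.to_subtype
  obtain ⟨l, hl⟩ := exists_linVal_ne (fun x : F => Projectivization.rep x.1)
    fun x => Projectivization.rep_nonzero x.1
  exact ⟨affChart l, fun x hx => hl ⟨x, hx⟩, affChart_separates l⟩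

theorem IsQuasiProjective.hasCharts {X : FnSpace} (hX : IsQuasiProjective X) : HasCharts X := by
  obtain ⟨N, φ, hφ, -⟩ := isQuasiProjective_iff.1 hX
  exact (hasCharts_projSpace N).of_isEmb hφ

/-! ### Unordered tuples -/

theorem unordered_surjective {X : Type} {n : ℕ} :
    Function.Surjective (unordered : (Fin n → X) → Sym X n) := by
  rintro ⟨m, hm⟩
  induction m using Quotient.inductionOn with
  | h l =>
    have hl : l.length = n := hm
    subst hl
    refine ⟨l.get, Subtype.ext ?_⟩
    simp [unordered, Fin.univ_def]

theorem unordered_comp_perm {X : Type} {n : ℕ} (v : Fin n → X) (σ : Equiv.Perm (Fin n)) :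
    unordered (v ∘ σ) = unordered v := by
  refine Subtype.ext ?_
  change Multiset.map (v ∘ σ) Finset.univ.val = Multiset.map v Finset.univ.val
  rw [← Multiset.map_map, Multiset.map_univ_val_equiv]

/-- Equal multisets give fibres of equal cardinality over every point; bijections between the fibres
glue to a permutation of the positions. -/
theorem unordered_eq_iff {X : Type} {n : ℕ} {v w : Fin n → X} :
    unordered v = unordered w ↔ ∃ σ : Equiv.Perm (Fin n), w = v ∘ σ := by
  classical
  constructor
  · intro h
    have h1 : Multiset.map v Finset.univ.val = Multiset.map w Finset.univ.val :=
      congrArg Subtype.val h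
    have h2 (x : X) : Fintype.card {i // w i = x} = Fintype.card {i // v i = x} := by
      have := congrArg (Multiset.count x) h1
      simp only [Multiset.count_map, eq_comm (a := x)] at this
      rw [Fintype.card_subtype, Fintype.card_subtype]
      exact this.symm
    let e := (Equiv.sigmaFiberEquiv w).symm.trans
      ((Equiv.sigmaCongrRight fun x => Fintype.equivOfCardEq (h2 x)).trans
        (Equiv.sigmaFiberEquiv v))
    refine ⟨e, funext fun i => ?_⟩
    exact ((Fintype.equivOfCardEq (h2 (w i)) ⟨i, rfl⟩).2).symm
  · rintro ⟨σ, rfl⟩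
    exact (unordered_comp_perm v σ).symm

theorem mem_unordered {X : Type} {n : ℕ} {v : Fin n → X} {x : X} :
    x ∈ unordered v ↔ ∃ i, v i = x := by
  change x ∈ Multiset.map v Finset.univ.val ↔ _
  simp

/-- An ordering of an unordered tuple. -/
def ordering {X : Type} {n : ℕ} (s : Sym X n) : Fin n → X :=
  Function.surjInv unordered_surjective s

theorem unordered_ordering {X : Type} {n : ℕ} (s : Sym X n) : unordered (ordering s) = s :=
  Function.surjInv_eq unordered_surjective s

/-- The sum of the values of a function at all orderings of an unordered tuple. -/
def symmetrize {X : Type} {n : ℕ} (H : (Fin n → X) → ℂ) (s : Sym X n) : ℂ :=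
  ∑ σ : Equiv.Perm (Fin n), H (ordering s ∘ σ)

theorem symmetrize_unordered {X : Type} {n : ℕ} (H : (Fin n → X) → ℂ) (v : Fin n → X) :
    symmetrize H (unordered v) = ∑ σ : Equiv.Perm (Fin n), H (v ∘ σ) := by
  obtain ⟨τ, hτ⟩ := unordered_eq_iff.1 (unordered_ordering (unordered v)).symm
  unfold symmetrize
  rw [hτ]
  exact Fintype.sum_equiv (Equiv.mulLeft τ) _ _ fun σ => rfl

/-! ### Charts of symmetric products -/

theorem powAlg_comp {X : Type} {A : Subalgebra ℂ (X → ℂ)} {n m : ℕ} {H : (Fin n → X) → ℂ}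
    (hH : H ∈ powAlg A n) (e : Fin n → Fin m) : (fun v => H (v ∘ e)) ∈ powAlg A m := by
  have h : powAlg A n ≤ (powAlg A m).comap (precomp fun v : Fin m → X => v ∘ e) := by
    refine Algebra.adjoin_le ?_
    rintro _ ⟨i, a, ha, rfl⟩
    exact Algebra.subset_adjoin ⟨e i, a, ha, rfl⟩
  exact h hH

theorem powAlg_symmetrize {X : Type} {A : Subalgebra ℂ (X → ℂ)} {n : ℕ} {H : (Fin n → X) → ℂ}
    (hH : H ∈ powAlg A n) : symmetrize H ∘ unordered ∈ powAlg A n := by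
  have h : symmetrize H ∘ unordered = ∑ σ : Equiv.Perm (Fin n), fun v => H (v ∘ σ) := by
    funext v
    simp [symmetrize_unordered]
  rw [h]
  exact sum_mem fun σ _ => powAlg_comp hH σ

/-- Interpolation: each `w ≠ v` differs from `v` in some component, where a chart function
distinguishes them; the normalized differences are multiplied over `w`. -/
theorem Chart.Separates.powAlg_bump {X : FnSpace} {c : Chart X} (hc : c.Separates) {n : ℕ}
    {v : Fin n → X} (hv : ∀ i, v i ∈ c.dom) {S : Set (Fin n → X)} (hS : S.Finite)
    (hSd : ∀ w ∈ S, ∀ i, w i ∈ c.dom) :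
    ∃ p ∈ powAlg c.alg n, p v = 1 ∧ ∀ w ∈ S, w ≠ v → p w = 0 := by
  classical
  have h1 (w : Fin n → X) (hw : w ∈ S) (hwv : w ≠ v) : ∃ p ∈ powAlg c.alg n, p v = 1 ∧ p w = 0 := by
    obtain ⟨i, hi⟩ := Function.ne_iff.1 hwv
    obtain ⟨a, ha, h⟩ := hc _ (hv i) _ (hSd w hw i) hi.symm
    have h0 : a (v i) - a (w i) ≠ 0 := sub_ne_zero.2 h
    refine ⟨(a (v i) - a (w i))⁻¹ • ((fun u => a (u i)) - fun _ => a (w i)), ?_, ?_, ?_⟩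
    · have h1 : (fun u : Fin n → X => a (u i)) ∈ powAlg c.alg n :=
        Algebra.subset_adjoin ⟨i, a, ha, rfl⟩
      exact Subalgebra.smul_mem _ (sub_mem h1 (Subalgebra.algebraMap_mem _ (a (w i)))) _
    · simp [h0]
    · simp
  choose! p hp hpv hpw using h1
  refine ⟨∏ w ∈ hS.toFinset.erase v, p w, ?_, ?_, fun w hw hwv => ?_⟩
  · exact prod_mem fun w hw => by
      simp only [Finset.mem_erase, Set.Finite.mem_toFinset] at hw
      exact hp w hw.2 hw.1
  · rw [Finset.prod_apply]
    refine Finset.prod_eq_one fun w hw => ?_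
    simp only [Finset.mem_erase, Set.Finite.mem_toFinset] at hw
    exact hpv w hw.2 hw.1
  · rw [Finset.prod_apply]
    exact Finset.prod_eq_zero (i := w) (by simp [hw, hwv]) (hpw w hw hwv)

/-! ### Universal property of final structures. -/

theorem final_isOpen {T ι : Type} {X : ι → FnSpace} {q : ∀ i, X i → T} {U : Set T}
    (h : ∀ i, IsOpen (q i ⁻¹' U)) : IsOpen (X := final X q) U := by
  change IsOpen[⨆ i, TopologicalSpace.coinduced (q i) (X i).top] U
  rw [isOpen_iSup_iff]
  exact fun i => isOpen_coinduced.2 (h i)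

theorem final_incl {T ι : Type} (X : ι → FnSpace) (q : ∀ i, X i → T) (i : ι) :
    IsMorphism (X := X i) (Y := final X q) (q i) := by
  constructor
  · exact continuous_iff_coinduced_le.2
      (le_iSup (fun i => TopologicalSpace.coinduced (q i) (X i).top) i)
  · rintro g v ⟨U, -, hv, h⟩
    exact h i v hv

theorem final_lift {T ι : Type} {X : ι → FnSpace} {q : ∀ i, X i → T} {W : FnSpace} {φ : T → W}
    (h : ∀ i, IsMorphism (X := X i) (Y := W) fun x => φ (q i x)) :
    IsMorphism (X := final X q) (Y := W) φ := by
  refine ⟨⟨fun U hU => final_isOpen fun i => hU.preimage (h i).1⟩, fun g s hg => ?_⟩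
  obtain ⟨V, hV, hVo, hsV⟩ := eventually_nhds_iff.1 (W.eventually_reg hg)
  exact ⟨φ ⁻¹' V, final_isOpen fun i => hVo.preimage (h i).1, hsV,
    fun i v hv => (h i).2 g v (hV _ hv)⟩

theorem symPow_quotient (X : FnSpace) (n : ℕ) :
    IsMorphism (X := X.pow n) (Y := X.symPow n) (unordered (X := X)) :=
  final_incl (fun _ : Unit => X.pow n) (fun _ v => unordered (X := X) v) ()

theorem symPow_isOpen {X : FnSpace} {n : ℕ} {U : Set (Sym X n)}
    (h : IsOpen (X := X.pow n) (unordered (X := X) ⁻¹' U)) : IsOpen (X := X.symPow n) U :=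
  final_isOpen (X := fun _ : Unit => X.pow n) fun _ => h

theorem isMorphism_of_unordered {X W : FnSpace} {n : ℕ} {φ : Sym X n → W}
    (h : IsMorphism (X := X.pow n) (Y := W) fun v => φ (unordered v)) :
    IsMorphism (X := X.symPow n) (Y := W) φ :=
  final_lift (X := fun _ : Unit => X.pow n) fun _ => h

/-- The chart of a symmetric product: its functions are the symmetric polynomials in functions of
the chart. -/
def symChart {X : FnSpace} (c : Chart X) (hc : c.Separates) (n : ℕ) : Chart (X.symPow n) where
  dom := {s : Sym X n | ∀ x ∈ s, x ∈ c.dom}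
  isOpen := by
    refine symPow_isOpen ?_
    have h : unordered (X := X) (n := n) ⁻¹' {s : Sym X n | ∀ x ∈ s, x ∈ c.dom} =
        (powChart c n).dom := by
      ext v
      simp [powChart_dom, mem_unordered]
    exact h ▸ (powChart c n).isOpen
  alg := (powAlg c.alg n).comap (precomp (unordered (X := X)))
  reg := by
    intro a ha s hs
    refine ⟨{s : Sym X n | ∀ x ∈ s, x ∈ c.dom}, symPow_isOpen ?_, hs, fun _ v hv => ?_⟩
    · have h : unordered (X := X) (n := n) ⁻¹' {s : Sym X n | ∀ x ∈ s, x ∈ c.dom} =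
          (powChart c n).dom := by
        ext v
        simp [powChart_dom, mem_unordered]
      exact h ▸ (powChart c n).isOpen
    · exact (powChart c n).reg _ ha v fun i => hv _ (mem_unordered.2 ⟨i, rfl⟩)
  frac := by
    classical
    intro s hs f hf
    obtain ⟨v, rfl⟩ := unordered_surjective s
    have hv (i : Fin n) : v i ∈ c.dom := hs _ (mem_unordered.2 ⟨i, rfl⟩)
    obtain ⟨a, ha, b, hb, h0, hab⟩ : ∃ a ∈ powAlg c.alg n, ∃ b ∈ powAlg c.alg n, b v ≠ 0 ∧
        ∀ y : Fin n → X, (∀ i, y i ∈ c.dom) → f (unordered y) * b y = a y :=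
      (powChart c n).frac v hv _ ((symPow_quotient X n).2 f v hf)
    -- Symmetrizing `b` directly could produce zero at `v`. The factor `p` discards every reordering
    -- different from `v`, leaving `b v` times the order of the stabilizer of `v`.
    obtain ⟨p, hp, hpv, hp0⟩ := hc.powAlg_bump hv
      (S := Set.range fun σ : Equiv.Perm (Fin n) => v ∘ σ) (Set.finite_range _)
      (by rintro _ ⟨σ, rfl⟩ i; exact hv _)
    refine ⟨symmetrize (p * a), powAlg_symmetrize (mul_mem hp ha), symmetrize (p * b),
      powAlg_symmetrize (mul_mem hp hb), ?_,
      fun t ht => ?_⟩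
    · rw [symmetrize_unordered]
      have h1 (σ : Equiv.Perm (Fin n)) : (p * b) (v ∘ σ) = if v ∘ σ = v then b v else 0 := by
        split_ifs with h
        · rw [h, Pi.mul_apply, hpv, one_mul]
        · rw [Pi.mul_apply, hp0 _ ⟨σ, rfl⟩ h, zero_mul]
      simp only [h1, Finset.sum_ite, Finset.sum_const, mul_zero, add_zero,
        nsmul_eq_mul]
      refine mul_ne_zero (Nat.cast_ne_zero.2 (Finset.card_ne_zero_of_mem (a := 1) ?_)) h0
      simp
    · obtain ⟨w, rfl⟩ := unordered_surjective t
      rw [symmetrize_unordered, symmetrize_unordered, Finset.mul_sum]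
      refine Finset.sum_congr rfl fun σ _ => ?_
      have h2 := hab (w ∘ σ) fun i => ht _ (mem_unordered.2 ⟨σ i, rfl⟩)
      rw [unordered_comp_perm] at h2
      rw [Pi.mul_apply, Pi.mul_apply, ← h2]
      ring

/-! ### Spanning by monomials -/

/-- A monomial in generators evaluated at various components is regrouped as one monomial for each
component. This reduces linear statements about symmetrization to product functions. -/
theorem powAlg_adjoin_le_span {X : Type} (G : Set (X → ℂ)) (n : ℕ) {H : (Fin n → X) → ℂ}
    (hH : H ∈ powAlg (Algebra.adjoin ℂ G) n) :
    H ∈ Submodule.span ℂ {H | ∃ φ : Fin n → X → ℂ, (∀ i, φ i ∈ Submonoid.closure G) ∧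
      H = fun v => ∏ i, φ i (v i)} := by
  classical
  have h1 : powAlg (Algebra.adjoin ℂ G) n ≤
      Algebra.adjoin ℂ {g | ∃ i, ∃ a ∈ G, g = fun v : Fin n → X => a (v i)} := by
    refine Algebra.adjoin_le ?_
    rintro _ ⟨i, a, ha, rfl⟩
    have h2 : Algebra.adjoin ℂ G ≤ (Algebra.adjoin ℂ
        {g | ∃ i, ∃ a ∈ G, g = fun v : Fin n → X => a (v i)}).comap
          (precomp fun v : Fin n → X => v i) :=
      Algebra.adjoin_le fun g hg => Algebra.subset_adjoin ⟨i, g, hg, rfl⟩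
    exact h2 ha
  have h3 : H ∈ Subalgebra.toSubmodule (Algebra.adjoin ℂ
      {g | ∃ i, ∃ a ∈ G, g = fun v : Fin n → X => a (v i)}) := h1 hH
  rw [Algebra.adjoin_eq_span] at h3
  refine Submodule.span_mono ?_ h3
  intro g hg
  induction hg using Submonoid.closure_induction with
  | mem g hg =>
    obtain ⟨i, a, ha, rfl⟩ := hg
    refine ⟨Pi.mulSingle i a, fun j => ?_, ?_⟩
    · by_cases h : j = i
      · subst h
        simpa using Submonoid.subset_closure ha
      · simp [h]
    · funext v
      rw [Finset.prod_eq_single i]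
      · simp
      · intro j _ h
        simp [h]
      · simp
  | one => exact ⟨fun _ => 1, fun _ => one_mem _, by funext v; simp⟩
  | mul x y _ _ hx hy =>
    obtain ⟨φ, hφ, rfl⟩ := hx
    obtain ⟨χ, hχ, rfl⟩ := hy
    refine ⟨φ * χ, fun i => mul_mem (hφ i) (hχ i), ?_⟩
    funext v
    simp [Finset.prod_mul_distrib]

theorem powAlg_le_span {X : Type} (A : Subalgebra ℂ (X → ℂ)) (n : ℕ) {H : (Fin n → X) → ℂ}
    (hH : H ∈ powAlg A n) :
    H ∈ Submodule.span ℂ {H | ∃ φ : Fin n → X → ℂ, (∀ i, φ i ∈ A) ∧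
      H = fun v => ∏ i, φ i (v i)} := by
  have h1 : Algebra.adjoin ℂ (A : Set (X → ℂ)) = A := Algebra.adjoin_eq A
  have h2 : Submonoid.closure (A : Set (X → ℂ)) ≤ A.toSubmonoid :=
    Submonoid.closure_le.2 fun a ha => ha
  rw [← h1] at hH
  refine Submodule.span_mono ?_ (powAlg_adjoin_le_span _ n hH)
  rintro _ ⟨φ, hφ, rfl⟩
  exact ⟨φ, fun i => h2 (hφ i), rfl⟩

/-! ### Joining unordered tuples -/

/-- The unordered tuple formed by the images of two unordered tuples. -/
def joinSym {A B X : Type} {s m n : ℕ} (h : s + m = n) (α : A → X) (β : B → X) (a : Sym A s)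
    (b : Sym B m) : Sym X n :=
  ⟨(a : Multiset A).map α + (b : Multiset B).map β, by simpa using h⟩

theorem mem_joinSym {A B X : Type} {s m n : ℕ} {h : s + m = n} {α : A → X} {β : B → X}
    {a : Sym A s} {b : Sym B m} {x : X} :
    x ∈ joinSym h α β a b ↔ (∃ y ∈ a, α y = x) ∨ ∃ y ∈ b, β y = x := by
  change x ∈ (a : Multiset A).map α + (b : Multiset B).map β ↔ _
  simp

theorem joinSym_unordered {A B X : Type} {s m : ℕ} (α : A → X) (β : B → X) (u : Fin s → A)
    (u' : Fin m → B) : joinSym rfl α β (unordered u) (unordered u') =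
      unordered (Fin.append (α ∘ u) (β ∘ u')) := by
  refine Subtype.ext ?_
  change (Finset.univ.val.map u).map α + (Finset.univ.val.map u').map β =
    Finset.univ.val.map (Fin.append (α ∘ u) (β ∘ u'))
  simp [Fin.univ_val_map, List.ofFn_fin_append]

/-- The part coming from `A` is recovered by keeping the members in the range of `α`; the other part
then follows by cancellation. -/
theorem joinSym_injective {A B X : Type} {s m n : ℕ} {h : s + m = n} {α : A → X} {β : B → X}
    (hα : Function.Injective α) (hβ : Function.Injective β) (hd : ∀ b, β b ∉ Set.range α) :
    Function.Injective fun p : Sym A s × Sym B m => joinSym h α β p.1 p.2 := by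
  classical
  rintro ⟨a, b⟩ ⟨a', b'⟩ hab
  have h1 : (a : Multiset A).map α + (b : Multiset B).map β =
    (a' : Multiset A).map α + (b' : Multiset B).map β := congrArg Subtype.val hab
  have h2 (a : Sym A s) (b : Sym B m) : Multiset.filter (· ∈ Set.range α)
      ((a : Multiset A).map α + (b : Multiset B).map β) = (a : Multiset A).map α := by
    rw [Multiset.filter_add, Multiset.filter_eq_self.2, Multiset.filter_eq_nil.2, add_zero]
    · intro x hx
      obtain ⟨y, -, rfl⟩ := Multiset.mem_map.1 hx
      exact hd y
    · intro x hx
      obtain ⟨y, -, rfl⟩ := Multiset.mem_map.1 hx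
      exact ⟨y, rfl⟩
  have h3 : (a : Multiset A).map α = (a' : Multiset A).map α := by
    rw [← h2 a b, h1, h2 a' b']
  rw [h3, add_right_inj] at h1
  exact Prod.ext (Subtype.ext (Multiset.map_injective hα h3))
    (Subtype.ext (Multiset.map_injective hβ h1))

theorem Chart.Separates.comapEmb {X Y : FnSpace} {c : Chart Y} (hc : c.Separates) {φ : X → Y}
    (h : IsEmb φ) : (c.comapEmb h).Separates := by
  intro x hx y hy hxy
  obtain ⟨a, ha, h1⟩ := hc _ hx _ hy (h.1.ne hxy)
  exact ⟨_, ⟨a, ha, rfl⟩, h1⟩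

theorem powAlg_prod_mem {X : Type} {A : Subalgebra ℂ (X → ℂ)} {n : ℕ} {ι : Type} (t : Finset ι)
    (e : ι → Fin n) {φ : ι → X → ℂ} (hφ : ∀ i, φ i ∈ A) :
    (fun v => ∏ i ∈ t, φ i (v (e i))) ∈ powAlg A n := by
  have h : (fun v : Fin n → X => ∏ i ∈ t, φ i (v (e i))) =
      ∏ i ∈ t, fun v : Fin n → X => φ i (v (e i)) := by
    funext v
    simp
  rw [h]
  exact prod_mem fun i _ => Algebra.subset_adjoin ⟨e i, φ i, hφ i, rfl⟩

theorem Sym.finite_mem {X : Type} {n : ℕ} (s : Sym X n) : {x | x ∈ s}.Finite := by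
  obtain ⟨v, rfl⟩ := unordered_surjective s
  simp_rw [mem_unordered]
  exact Set.finite_range v

theorem HasCharts.exists_symChart {X : FnSpace} (hX : HasCharts X) {n : ℕ} (s : Sym X n) :
    ∃ (c : Chart X) (hc : c.Separates), s ∈ (symChart c hc n).dom := by
  obtain ⟨c, h, hc⟩ := hX _ (Sym.finite_mem s)
  exact ⟨c, hc, h⟩

/-- All reorderings inside the two blocks have the same union, so each of the `s! m!` summands is
the same. Read from right to left, this writes the pull-back of `f` as a symmetrization in each
block separately. -/
theorem symmetrize_joinSym {A B X : Type} {s m : ℕ} (α : A → X) (β : B → X)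
    (f : Sym X (s + m) → ℂ) (a : Sym A s) (b : Sym B m) :
    symmetrize (fun u => symmetrize (fun u' => f (unordered (Fin.append (α ∘ u) (β ∘ u')))) b) a =
      s.factorial * m.factorial * f (joinSym rfl α β a b) := by
  obtain ⟨u, rfl⟩ := unordered_surjective a
  obtain ⟨u', rfl⟩ := unordered_surjective b
  simp [symmetrize_unordered, ← joinSym_unordered, unordered_comp_perm, Fintype.card_perm,
    mul_assoc]

theorem joinSym_isMorphism {A B X : FnSpace} (hX : HasCharts X) {α : A → X} {β : B → X}
    (hα : IsEmb α) (hβ : IsEmb β) {s m n : ℕ} (h : s + m = n) :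
    IsMorphism (X := (A.symPow s).prod (B.symPow m)) (Y := X.symPow n)
      (fun p : Sym A s × Sym B m => joinSym h α β p.1 p.2) := by
  subst h
  refine isMorphism_of_charts fun w => ?_
  obtain ⟨a, b⟩ := w
  obtain ⟨c, hc, hdom⟩ := hX.exists_symChart (joinSym rfl α β a b)
  have ha : a ∈ (symChart _ (hc.comapEmb hα) s).dom := fun x hx =>
    hdom _ (mem_joinSym.2 (Or.inl ⟨x, hx, rfl⟩))
  have hb : b ∈ (symChart _ (hc.comapEmb hβ) m).dom := fun x hx =>
    hdom _ (mem_joinSym.2 (Or.inr ⟨x, hx, rfl⟩))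
  refine ⟨symChart c hc (s + m), ?_, fun f hf => ?_⟩
  · filter_upwards [(prod_fst (A.symPow s) (B.symPow m)).1.continuousAt.eventually
        ((symChart _ (hc.comapEmb hα) s).isOpen.mem_nhds ha),
      (prod_snd (A.symPow s) (B.symPow m)).1.continuousAt.eventually
        ((symChart _ (hc.comapEmb hβ) m).isOpen.mem_nhds hb)] with p h1 h2 x hx
    rcases mem_joinSym.1 hx with ⟨y, hy, rfl⟩ | ⟨y, hy, rfl⟩
    exacts [h1 y hy, h2 y hy]
  -- `Φ` is linear in `H`, and on a product function it splits as a symmetric function of the first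
  -- tuple times one of the second. Thus it is regular for every polynomial `H`, and for symmetric
  -- `H` it is the pull-back up to `s! m!`.
  · let Φ (H : (Fin (s + m) → X) → ℂ) (p : Sym A s × Sym B m) : ℂ :=
      symmetrize (fun u => symmetrize
        (fun u' => H (Fin.append (α ∘ u) (β ∘ u'))) p.2) p.1
    have key (H) (hH : H ∈ powAlg c.alg (s + m)) :
        ((A.symPow s).prod (B.symPow m)).RegAt (Φ H) (a, b) := by
      have hH' := powAlg_le_span _ _ hH
      clear hH
      induction hH' using Submodule.span_induction with
      | mem H h =>
        obtain ⟨φ, hφ, rfl⟩ := h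
        have h1 := (prod_fst (A.symPow s) (B.symPow m)).2
          (symmetrize fun u : Fin s → A => ∏ i, φ (Fin.castAdd m i) (α (u i))) (a, b)
          ((symChart _ (hc.comapEmb hα) s).reg _ (powAlg_symmetrize
              (powAlg_prod_mem (A := (c.comapEmb hα).alg) Finset.univ id
                (φ := fun i => φ (Fin.castAdd m i) ∘ α) fun i => ⟨_, hφ (Fin.castAdd m i), rfl⟩)) a ha)
        have h2 := (prod_snd (A.symPow s) (B.symPow m)).2
          (symmetrize fun u : Fin m → B => ∏ i, φ (Fin.natAdd s i) (β (u i))) (a, b)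
          ((symChart _ (hc.comapEmb hβ) m).reg _ (powAlg_symmetrize
              (powAlg_prod_mem (A := (c.comapEmb hβ).alg) Finset.univ id
                (φ := fun i => φ (Fin.natAdd s i) ∘ β) fun i => ⟨_, hφ (Fin.natAdd s i), rfl⟩)) b hb)
        refine FnSpace.congr _ (Eventually.of_forall fun p => ?_) (FnSpace.mul _ h1 h2)
        simp only [Φ, symmetrize, Fin.prod_univ_add, Fin.append_left, Fin.append_right]
        exact Finset.sum_mul_sum _ _ _ _
      | zero =>
        refine FnSpace.congr _ (Eventually.of_forall fun p => ?_) (FnSpace.const _ 0 _)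
        simp [Φ, symmetrize]
      | add H H' _ _ h h' =>
        refine FnSpace.congr _ (Eventually.of_forall fun p => ?_) (FnSpace.add _ h h')
        change Φ H p + Φ H' p = Φ (H + H') p
        simp [Φ, symmetrize, Finset.sum_add_distrib]
      | smul r H _ h =>
        refine FnSpace.congr _ (Eventually.of_forall fun p => ?_)
          (FnSpace.mul _ (FnSpace.const _ r _) h)
        change r * Φ H p = Φ (r • H) p
        simp [Φ, symmetrize, Finset.mul_sum]
    refine FnSpace.congr _ (Eventually.of_forall fun p => ?_)
      (FnSpace.mul _ (FnSpace.const _ ((s.factorial * m.factorial : ℂ)⁻¹) _) (key _ hf))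
    have h1 : (s.factorial * m.factorial : ℂ) ≠ 0 := by
      exact_mod_cast mul_ne_zero s.factorial_ne_zero m.factorial_ne_zero
    change _⁻¹ * Φ (f ∘ unordered (X := X)) p = _
    exact (congrArg _ (symmetrize_joinSym α β f p.1 p.2)).trans (inv_mul_cancel_left₀ h1 _)

/-! ### The join of tuples in disjoint subspaces is an embedding -/

/-- The chart functions vanishing on `S` form a subspace on which no evaluation at an `x i` is zero,
and a complex vector space is not a finite union of the kernels. -/
theorem Chart.exists_vanish_finite {X : FnSpace} (c : Chart X) {S : Set X} {ι : Type} [Finite ι]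
    {x : ι → X} (hx : ∀ i, x i ∈ c.dom) (hS : ∀ i, x i ∉ closure S) :
    ∃ a ∈ c.alg, (∀ y ∈ c.dom, y ∈ S → a y = 0) ∧ ∀ i, a (x i) ≠ 0 := by
  let p : Submodule ℂ (X → ℂ) :=
    { carrier := {a | a ∈ c.alg ∧ ∀ y ∈ c.dom, y ∈ S → a y = 0}
      add_mem' := fun ha hb => ⟨add_mem ha.1 hb.1, fun y h1 h2 => by
        simp [ha.2 y h1 h2, hb.2 y h1 h2]⟩
      zero_mem' := ⟨zero_mem _, fun _ _ _ => rfl⟩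
      smul_mem' := fun r a ha => ⟨Subalgebra.smul_mem _ ha.1 r, fun y h1 h2 => by
        simp [ha.2 y h1 h2]⟩ }
  obtain ⟨a, ha, h⟩ := Module.Dual.exists_forall_mem_ne_zero_of_forall_exists p
    (fun i => (LinearMap.proj (x i) : (X → ℂ) →ₗ[ℂ] ℂ)) (fun i => by
      obtain ⟨a, ha, h0, hv⟩ := c.exists_vanish (hx i)
        (isClosed_closure.isOpen_compl.mem_nhds (hS i))
      exact ⟨a, ⟨ha, fun y h1 h2 => hv y h1 fun h3 => h3 (subset_closure h2)⟩, h0⟩)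
  exact ⟨a, ha.1, ha.2, h⟩

/-- The last block is mapped into itself injectively, hence onto itself by finiteness, which leaves
only the first block for the images of the first block. -/
theorem perm_preserves_blocks {s m : ℕ} {σ : Equiv.Perm (Fin (s + m))}
    (h : ∀ (j : Fin m) (i : Fin s), σ (Fin.natAdd s j) ≠ Fin.castAdd m i) :
    ∃ (τ : Equiv.Perm (Fin s)) (τ' : Equiv.Perm (Fin m)),
      (∀ i, σ (Fin.castAdd m i) = Fin.castAdd m (τ i)) ∧
      ∀ j, σ (Fin.natAdd s j) = Fin.natAdd s (τ' j) := by
  have h1 (j : Fin m) : ∃ k, σ (Fin.natAdd s j) = Fin.natAdd s k := by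
    generalize hk : σ (Fin.natAdd s j) = k
    induction k using Fin.addCases with
    | left i => exact absurd hk (h j i)
    | right i => exact ⟨i, rfl⟩
  choose f hf using h1
  have hfi : Function.Injective f := fun j k hjk => by
    have h2 : σ (Fin.natAdd s j) = σ (Fin.natAdd s k) := by rw [hf, hf, hjk]
    simpa using σ.injective h2
  have hfs := Finite.surjective_of_injective hfi
  have h2 (i : Fin s) : ∃ k, σ (Fin.castAdd m i) = Fin.castAdd m k := by
    generalize hk : σ (Fin.castAdd m i) = k
    induction k using Fin.addCases with
    | left i => exact ⟨i, rfl⟩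
    | right k =>
      obtain ⟨j, rfl⟩ := hfs k
      rw [← hf] at hk
      have := congrArg Fin.val (σ.injective hk)
      simp at this
      omega
  choose g hg using h2
  have hgi : Function.Injective g := fun j k hjk => by
    have h2 : σ (Fin.castAdd m j) = σ (Fin.castAdd m k) := by rw [hg, hg, hjk]
    simpa using σ.injective h2
  exact ⟨Equiv.ofBijective g ⟨hgi, Finite.surjective_of_injective hgi⟩,
    Equiv.ofBijective f ⟨hfi, hfs⟩, hg, hf⟩

theorem append_comp_blocks {X : Type} {s m : ℕ} {σ : Equiv.Perm (Fin (s + m))}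
    {τ : Equiv.Perm (Fin s)} {τ' : Equiv.Perm (Fin m)}
    (h : ∀ i, σ (Fin.castAdd m i) = Fin.castAdd m (τ i))
    (h' : ∀ j, σ (Fin.natAdd s j) = Fin.natAdd s (τ' j)) (u : Fin s → X) (u' : Fin m → X) :
    Fin.append u u' ∘ σ = Fin.append (u ∘ τ) (u' ∘ τ') := by
  funext k
  induction k using Fin.addCases with
  | left i => simp [h]
  | right i => simp [h']

theorem powAlg_map {A X : Type} {S : Subalgebra ℂ (X → ℂ)} {n : ℕ} (α : A → X)
    {F : (Fin n → A) → ℂ} (hF : F ∈ powAlg (S.map (precomp α)) n) :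
    ∃ G ∈ powAlg S n, ∀ u, F u = G (α ∘ u) := by
  have h : powAlg (S.map (precomp α)) n ≤
      (powAlg S n).map (precomp fun u : Fin n → A => α ∘ u) := by
    refine Algebra.adjoin_le ?_
    rintro _ ⟨i, _, ⟨a, ha, rfl⟩, rfl⟩
    exact ⟨fun v => a (v i), Algebra.subset_adjoin ⟨i, a, ha, rfl⟩, rfl⟩
  obtain ⟨G, hG, rfl⟩ := h hF
  exact ⟨G, hG, fun u => rfl⟩

/-- A function of two unordered tuples that comes from polynomials in functions of a chart is a
fraction of symmetric polynomials in their join. -/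
theorem regAt_of_joinSym {A B X W : FnSpace} {α : A → X} {β : B → X} {s m : ℕ}
    {ψ : W → Sym A s × Sym B m}
    (hψ : IsMorphism (X := W) (Y := X.symPow (s + m))
      fun w => joinSym rfl α β (ψ w).1 (ψ w).2) {c : Chart X} (hc : c.Separates) {w : W}
    (hw : joinSym rfl α β (ψ w).1 (ψ w).2 ∈ (symChart c hc (s + m)).dom) {d : X → ℂ}
    (hd : d ∈ c.alg) (hd0 : ∀ y, α y ∈ c.dom → d (α y) = 0) (hd1 : ∀ y ∈ (ψ w).2, d (β y) ≠ 0)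
    {F : (Fin (s + m) → X) → ℂ} (hF : F ∈ powAlg c.alg (s + m)) {f : Sym A s × Sym B m → ℂ}
    (hf : ∀ u u', F (Fin.append (α ∘ u) (β ∘ u')) = f (unordered u, unordered u')) :
    W.RegAt (fun w' => f (ψ w')) w := by
  classical
  -- `H` vanishes on any reordering that puts a point of `A` among the last `m` positions. The
  -- surviving permutations preserve the blocks, where `F` takes the value `f`; hence `f =
  -- symmetrize (F * H) / symmetrize H`.
  let H : (Fin (s + m) → X) → ℂ := fun x => ∏ j : Fin m, d (x (Fin.natAdd s j))
  have hH : H ∈ powAlg c.alg (s + m) := powAlg_prod_mem _ _ fun _ => hd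
  have hblock {u : Fin s → A} {u' : Fin m → B} (hu : ∀ i, α (u i) ∈ c.dom)
      {σ : Equiv.Perm (Fin (s + m))} (h : H (Fin.append (α ∘ u) (β ∘ u') ∘ σ) ≠ 0) :
      ∃ (τ : Equiv.Perm (Fin s)) (τ' : Equiv.Perm (Fin m)),
        Fin.append (α ∘ u) (β ∘ u') ∘ σ = Fin.append (α ∘ u ∘ τ) (β ∘ u' ∘ τ') := by
    obtain ⟨τ, τ', h1, h2⟩ := perm_preserves_blocks (σ := σ) (fun j i hij => by
      refine Finset.prod_ne_zero_iff.1 h j (Finset.mem_univ _) ?_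
      simp [hij, hd0 _ (hu i)])
    exact ⟨τ, τ', append_comp_blocks h1 h2 _ _⟩
  have hreg (G) (hG : G ∈ powAlg c.alg (s + m)) :
      W.RegAt (fun w' => symmetrize G (joinSym rfl α β (ψ w').1 (ψ w').2)) w :=
    hψ.2 (symmetrize G) w
      ((symChart c hc (s + m)).reg (symmetrize G) (powAlg_symmetrize hG) _ hw)
  have hne : symmetrize H (joinSym rfl α β (ψ w).1 (ψ w).2) ≠ 0 := by
    obtain ⟨u, hu⟩ := unordered_surjective (ψ w).1
    obtain ⟨u', hu'⟩ := unordered_surjective (ψ w).2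
    rw [← hu, ← hu', joinSym_unordered] at hw ⊢
    have hud (i : Fin s) : α (u i) ∈ c.dom := hw _ (mem_unordered.2 ⟨Fin.castAdd m i, by simp⟩)
    -- All surviving terms have the same value, so they cannot cancel, and the identity permutation
    -- survives.
    have hv (σ : Equiv.Perm (Fin (s + m))) (h : H (Fin.append (α ∘ u) (β ∘ u') ∘ σ) ≠ 0) :
        H (Fin.append (α ∘ u) (β ∘ u') ∘ σ) = ∏ j, d (β (u' j)) := by
      obtain ⟨τ, τ', h1⟩ := hblock hud h
      rw [h1]
      simp only [H, Fin.append_right, Function.comp_apply]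
      exact Equiv.prod_comp τ' fun j => d (β (u' j))
    have hP : ∏ j, d (β (u' j)) ≠ 0 :=
      Finset.prod_ne_zero_iff.2 fun j _ => hd1 _ (hu' ▸ mem_unordered.2 ⟨j, rfl⟩)
    rw [symmetrize_unordered, ← Finset.sum_filter_ne_zero, Finset.sum_congr rfl
      (fun σ hσ => hv σ (Finset.mem_filter.1 hσ).2), Finset.sum_const, nsmul_eq_mul]
    refine mul_ne_zero (Nat.cast_ne_zero.2 (Finset.card_ne_zero_of_mem (a := 1) ?_)) hP
    simpa [H] using hP
  refine W.congr ?_ (W.mul (hreg _ (mul_mem hF hH)) (W.inv (hreg _ hH) hne))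
  filter_upwards [hψ.1.continuousAt.eventually ((symChart c hc (s + m)).isOpen.mem_nhds hw),
    W.eventually_ne (hreg _ hH) hne] with w' h1 h2
  simp only [Pi.mul_apply, Pi.inv_apply]
  rw [← div_eq_mul_inv, div_eq_iff h2]
  obtain ⟨u, hu⟩ := unordered_surjective (ψ w').1
  obtain ⟨u', hu'⟩ := unordered_surjective (ψ w').2
  have hp : ψ w' = (unordered u, unordered u') := by rw [hu, hu']
  rw [hp] at h1 ⊢
  simp only [joinSym_unordered, symmetrize_unordered, Finset.mul_sum] at h1 ⊢
  refine Finset.sum_congr rfl fun σ _ => ?_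
  rw [Pi.mul_apply]
  by_cases h3 : H (Fin.append (α ∘ u) (β ∘ u') ∘ σ) = 0
  · simp [h3]
  · have hud (i : Fin s) : α (u i) ∈ c.dom := h1 _ (mem_unordered.2 ⟨Fin.castAdd m i, by simp⟩)
    obtain ⟨τ, τ', h4⟩ := hblock hud h3
    congr 1
    rw [h4, hf, unordered_comp_perm, unordered_comp_perm]

/-- By `regAt_of_joinSym`, symmetric functions of either part of the tuple are regular functions of
the union. The closure in `hd` is what provides a chart function zero on the range of `α` and
non-zero at the finitely many points coming from `B`. -/
theorem joinSym_isEmb {A B X : FnSpace} (hX : HasCharts X) {α : A → X} {β : B → X}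
    (hα : IsEmb α) (hβ : IsEmb β) (hd : ∀ b, β b ∉ closure (Set.range α)) {s m n : ℕ}
    (h : s + m = n) :
    IsEmb (X := (A.symPow s).prod (B.symPow m)) (Y := X.symPow n)
      (fun p : Sym A s × Sym B m => joinSym h α β p.1 p.2) := by
  refine ⟨joinSym_injective hα.1 hβ.1 fun b hb => hd b (subset_closure hb),
    joinSym_isMorphism hX hα hβ h, fun W ψ hψ => ?_⟩
  subst h
  have hchart (p : Sym A s × Sym B m) : ∃ (c : Chart X) (hc : c.Separates) (d : X → ℂ),
      joinSym rfl α β p.1 p.2 ∈ (symChart c hc (s + m)).dom ∧ d ∈ c.alg ∧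
      (∀ y, α y ∈ c.dom → d (α y) = 0) ∧ ∀ y ∈ p.2, d (β y) ≠ 0 := by
    obtain ⟨c, hc, hw⟩ := hX.exists_symChart (joinSym rfl α β p.1 p.2)
    have := (Sym.finite_mem p.2).to_subtype
    obtain ⟨d, hd, h0, h1⟩ := c.exists_vanish_finite (S := Set.range α)
      (x := fun y : {y | y ∈ p.2} => β y.1)
      (fun y => hw _ (mem_joinSym.2 (Or.inr ⟨y.1, y.2, rfl⟩))) (fun y => hd y.1)
    exact ⟨c, hc, d, hw, hd, fun y hy => h0 _ hy ⟨y, rfl⟩, fun y hy => h1 ⟨y, hy⟩⟩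
  refine prod_lift (isMorphism_of_charts fun w => ?_) (isMorphism_of_charts fun w => ?_) <;>
  obtain ⟨c, hc, d, hw, hd, h0, h1⟩ := hchart (ψ w)
  · refine ⟨symChart _ (hc.comapEmb hα) s, ?_, fun a ha => ?_⟩
    · filter_upwards [hψ.1.continuousAt.eventually
        ((symChart c hc (s + m)).isOpen.mem_nhds hw)] with w' hw' x hx
      exact hw' _ (mem_joinSym.2 (Or.inl ⟨x, hx, rfl⟩))
    · obtain ⟨G, hG, hGa⟩ := powAlg_map α ha
      refine regAt_of_joinSym (f := fun p => a p.1) hψ hc hw hd h0 h1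
        (powAlg_comp hG (Fin.castAdd m)) fun u u' => ?_
      have h2 : Fin.append (α ∘ u) (β ∘ u') ∘ Fin.castAdd m = α ∘ u := by funext i; simp
      rw [h2, ← hGa]
      rfl
  · refine ⟨symChart _ (hc.comapEmb hβ) m, ?_, fun a ha => ?_⟩
    · filter_upwards [hψ.1.continuousAt.eventually
        ((symChart c hc (s + m)).isOpen.mem_nhds hw)] with w' hw' x hx
      exact hw' _ (mem_joinSym.2 (Or.inr ⟨x, hx, rfl⟩))
    · obtain ⟨G, hG, hGa⟩ := powAlg_map β ha
      refine regAt_of_joinSym (f := fun p => a p.2) hψ hc hw hd h0 h1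
        (powAlg_comp hG (Fin.natAdd s)) fun u u' => ?_
      have h2 : Fin.append (α ∘ u) (β ∘ u') ∘ Fin.natAdd s = β ∘ u' := by funext i; simp
      rw [h2, ← hGa]
      rfl

/-! ### Generation of symmetric polynomials by polarized elementary ones -/

section SymWord

variable {Y κ : Type} {n : ℕ} (x : κ → Y → ℂ)

/-- The monomial in the functions `x` with given exponents. -/
def monom (m : Multiset κ) : Y → ℂ := (m.map x).prod

theorem monom_zero : monom x 0 = 1 := by simp [monom]

theorem monom_add (m m' : Multiset κ) : monom x (m + m') = monom x m * monom x m' := by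
  simp [monom]

theorem monom_singleton (j : κ) : monom x {j} = x j := by simp [monom]

/-- The symmetrization of a product of monomials in the components of a tuple. -/
def symWord (φ : Fin n → Multiset κ) (v : Fin n → Y) : ℂ :=
  ∑ σ : Equiv.Perm (Fin n), ∏ i, monom x (φ i) (v (σ i))

theorem symWord_comp_perm (φ : Fin n → Multiset κ) (τ : Equiv.Perm (Fin n)) :
    symWord x (φ ∘ τ) = symWord x φ := by
  funext v
  refine Fintype.sum_equiv (Equiv.mulRight τ⁻¹) _ _ fun σ => ?_
  refine Fintype.prod_equiv τ _ _ fun i => ?_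
  simp

theorem symWord_zero : symWord x (0 : Fin n → Multiset κ) = fun _ => (n.factorial : ℂ) := by
  funext v
  simp [symWord, monom_zero, Fintype.card_perm]

/-- Multiplying by a power sum attaches the monomial `χ` to one position at a time. -/
theorem powerSum_mul_symWord (χ : Multiset κ) (φ : Fin n → Multiset κ) :
    (fun v : Fin n → Y => ∑ j, monom x χ (v j)) * symWord x φ =
      ∑ k, symWord x (φ + Pi.single k χ) := by
  funext v
  simp only [Pi.mul_apply, Finset.sum_apply, symWord]
  rw [Finset.mul_sum, Finset.sum_comm]
  refine Finset.sum_congr rfl fun σ _ => ?_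
  rw [← Equiv.sum_comp σ, Finset.sum_mul]
  refine Finset.sum_congr rfl fun k _ => ?_
  simp only [Pi.add_apply, monom_add, Pi.mul_apply, Finset.prod_mul_distrib]
  rw [Finset.prod_eq_single (s := Finset.univ) (f := fun i =>
    monom x ((Pi.single k χ : Fin n → Multiset κ) i) (v (σ i))) k]
  · simp [mul_comm]
  · intro i _ hi
    simp [hi, monom_zero]
  · simp

variable {x} {B : Subalgebra ℂ ((Fin n → Y) → ℂ)}

/-- The power sum itself lies in `B`: the case `φ = 0` of the product formula exhibits it as `1 /
n!` times a sum of words with a single factor. -/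
theorem sum_symWord_mem {χ : Multiset κ} {φ : Fin n → Multiset κ}
    (hχ : ∀ k, symWord x (Pi.single k χ : Fin n → Multiset κ) ∈ B) (hφ : symWord x φ ∈ B) :
    ∑ k, symWord x (φ + Pi.single k χ) ∈ B := by
  have h1 := powerSum_mul_symWord x χ (0 : Fin n → Multiset κ)
  have h2 : (fun v : Fin n → Y => ∑ j, monom x χ (v j)) ∈ B := by
    have h3 : (fun v : Fin n → Y => ∑ j, monom x χ (v j)) = (n.factorial : ℂ)⁻¹ •
        ∑ k, symWord x (Pi.single k χ : Fin n → Multiset κ) := by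
      simp only [zero_add] at h1
      rw [← h1, symWord_zero]
      funext v
      have : (n.factorial : ℂ) ≠ 0 := by exact_mod_cast n.factorial_ne_zero
      simp only [Pi.smul_apply, Pi.mul_apply, smul_eq_mul]
      field_simp
    rw [h3]
    exact Subalgebra.smul_mem _ (sum_mem fun k _ => hχ k) _
  rw [← powerSum_mul_symWord]
  exact mul_mem h2 hφ

/-- The indices with a nontrivial monomial. -/
def wordSupport (φ : Fin n → Multiset κ) : Finset (Fin n) :=
  open Classical in Finset.univ.filter fun i => φ i ≠ 0

theorem mem_wordSupport {φ : Fin n → Multiset κ} {i : Fin n} : i ∈ wordSupport φ ↔ φ i ≠ 0 := by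
  classical simp [wordSupport]

theorem wordSupport_add_single {φ : Fin n → Multiset κ} {i : Fin n} (h : i ∈ wordSupport φ)
    (χ : Multiset κ) : wordSupport (φ + Pi.single i χ) = wordSupport φ := by
  ext j
  by_cases hj : j = i
  · subst hj
    have := mem_wordSupport.1 h
    simp [mem_wordSupport, this]
  · simp [mem_wordSupport, hj]

theorem add_single_comp_swap {φ : Fin n → Multiset κ} {i j : Fin n} (hi : φ i = 0) (hj : φ j = 0)
    (χ : Multiset κ) : (φ + Pi.single j χ) ∘ Equiv.swap i j = φ + Pi.single i χ := by
  funext k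
  by_cases h1 : k = i
  · subst h1
    simp [hi, hj]
  by_cases h2 : k = j
  · subst h2
    simp [hi, hj, h1, Ne.symm h1]
  · simp [Equiv.swap_apply_of_ne_of_ne h1 h2, h1, h2]

/-- Multiply the word `φ` by the power sum of `χ`; both have degree below that of `m`, so the
product is in `B`. In `k` of the terms `χ` merges with an existing factor, each giving `c • P`
modulo `B`; in the others it occupies a new position. -/
theorem powerSum_relation {m : Multiset κ} {P : (Fin n → Y) → ℂ}
    (IH : ∀ φ : Fin n → Multiset κ, (∑ i, φ i).card < m.card → symWord x φ ∈ B) {k : ℕ}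
    (hk : 1 ≤ k) {c : ℂ} (h : ∀ φ : Fin n → Multiset κ, ∑ i, φ i = m →
      (wordSupport φ).card = k → symWord x φ - c • P ∈ B) {φ : Fin n → Multiset κ}
    (hφ : (wordSupport φ).card = k) {χ : Multiset κ} (hχ : χ ≠ 0) (hm : ∑ i, φ i + χ = m) :
    (k * c) • P + ∑ i ∈ (wordSupport φ)ᶜ, symWord x (φ + Pi.single i χ) ∈ B := by
  classical
  obtain ⟨j, hj⟩ := Finset.card_pos.1 (by omega : 0 < (wordSupport φ).card)
  have hcard : (∑ i, φ i).card + χ.card = m.card := by rw [← hm, Multiset.card_add]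
  have hφ0 : 0 < (∑ i, φ i).card := by
    rw [Multiset.card_sum]
    exact (Multiset.card_pos.2 (mem_wordSupport.1 hj)).trans_le
      (Finset.single_le_sum (f := fun i => (φ i).card) (fun _ _ => Nat.zero_le _)
        (Finset.mem_univ j))
  have hχ0 := Multiset.card_pos.2 hχ
  have h1 := sum_symWord_mem (B := B) (x := x) (χ := χ) (φ := φ)
    (fun i => IH _ (by rw [Finset.sum_pi_single']; simp; omega)) (IH _ (by omega))
  have h2 : ∑ i ∈ wordSupport φ, (symWord x (φ + Pi.single i χ) - c • P) ∈ B :=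
    sum_mem fun i hi => h _ (by
      simp only [Pi.add_apply, Finset.sum_add_distrib, Finset.sum_pi_single', Finset.mem_univ,
        if_true, hm]) (by rw [wordSupport_add_single hi, hφ])
  rw [← Finset.sum_add_sum_compl (wordSupport φ)] at h1
  rw [Finset.sum_sub_distrib, Finset.sum_const, hφ, ← Nat.cast_smul_eq_nsmul ℂ, smul_smul] at h2
  convert sub_mem h1 h2 using 1
  abel

/-- Modulo symmetrizations of lower degree, a symmetrized product with `k` nontrivial factors is a
non-zero multiple of a power sum. -/
theorem symWord_congr_powerSum {m : Multiset κ} (i₀ : Fin n)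
    (IH : ∀ φ : Fin n → Multiset κ, (∑ i, φ i).card < m.card → symWord x φ ∈ B) (k : ℕ)
    (hk : 1 ≤ k) (hkn : k ≤ n) : ∃ c : ℂ, c ≠ 0 ∧ ∀ φ : Fin n → Multiset κ, ∑ i, φ i = m →
      (wordSupport φ).card = k → symWord x φ - c • symWord x (Pi.single i₀ m) ∈ B := by
  induction k, hk using Nat.le_induction with
  | base =>
    refine ⟨1, one_ne_zero, fun φ hm hφ => ?_⟩
    obtain ⟨i, hi⟩ := Finset.card_eq_one.1 hφ
    have h0 (j : Fin n) (hj : j ≠ i) : φ j = 0 := by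
      by_contra h
      have := mem_wordSupport.2 h
      simp [hi, hj] at this
    have h1 : φ = 0 + Pi.single i m := by
      funext j
      by_cases hj : j = i
      · subst hj
        rw [← hm, Finset.sum_eq_single j (fun k _ hk => h0 k hk) (by simp)]
        simp
      · simp [h0 j hj, hj]
    -- With a single factor, its position is irrelevant after symmetrization, so the constant is
    -- `1`.
    rw [h1, ← add_single_comp_swap (i := i) (j := i₀) rfl rfl, symWord_comp_perm, zero_add,
      one_smul, sub_self]
    exact zero_mem _
  | succ k hk ih =>
    obtain ⟨c, hc, h⟩ := ih (by omega)
    have hnk : (n : ℂ) - k ≠ 0 := by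
      rw [sub_ne_zero]
      exact_mod_cast (by omega : n ≠ k)
    have hk0 : (k : ℂ) ≠ 0 := by exact_mod_cast (by omega : k ≠ 0)
    -- The relation for `k` factors reads `k c P + (n - k) W ∈ B`, where `W` is the word with `k +
    -- 1` factors; solving for `W` gives the constant. It needs `k < n`.
    refine ⟨-(k * c) / (n - k), div_ne_zero (neg_ne_zero.2 (mul_ne_zero hk0 hc)) hnk,
      fun φ hm hφ => ?_⟩
    obtain ⟨j, hj⟩ := Finset.card_pos.1 (by omega : 0 < (wordSupport φ).card)
    -- One factor of `φ` is removed, to be multiplied back as the power sum in `powerSum_relation`.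
    set ψ := Function.update φ j 0 with hψ
    have hadd : ψ + Pi.single j (φ j) = φ := by
      funext i
      by_cases hi : i = j
      · subst hi
        simp [hψ]
      · simp [hψ, hi]
    have hsupp : wordSupport ψ = (wordSupport φ).erase j := by
      ext i
      by_cases hi : i = j <;> simp [mem_wordSupport, hψ, hi]
    have hcard : (wordSupport ψ).card = k := by
      rw [hsupp, Finset.card_erase_of_mem hj, hφ]
      rfl
    have hsum : ∑ i, ψ i + φ j = m := by
      rw [← hm]
      conv_rhs => rw [← hadd]
      simp [Finset.sum_add_distrib, Finset.sum_pi_single']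
    have h1 := powerSum_relation IH hk h hcard (mem_wordSupport.1 hj) hsum
    -- Putting the removed factor at any free position gives a permutation of `φ`, so the remaining
    -- `n - k` terms coincide.
    have h2 (i) (hi : i ∈ (wordSupport ψ)ᶜ) :
        symWord x (ψ + Pi.single i (φ j)) = symWord x φ := by
      have hi0 : ψ i = 0 := by
        by_contra h3
        exact Finset.mem_compl.1 hi (mem_wordSupport.2 h3)
      rw [← add_single_comp_swap hi0 (j := j) (by simp [hψ]), symWord_comp_perm, hadd]
    rw [Finset.sum_congr rfl h2, Finset.sum_const, Finset.card_compl, hcard, Fintype.card_fin,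
      ← Nat.cast_smul_eq_nsmul ℂ, Nat.cast_sub (by omega)] at h1
    convert Subalgebra.smul_mem _ h1 ((n : ℂ) - k)⁻¹ using 1
    rw [smul_add, smul_smul, smul_smul, inv_mul_cancel₀ hnk, one_smul, sub_eq_add_neg, add_comm,
      ← neg_smul]
    congr 2
    field_simp

/-- Letters are dealt out one to a position, so a remainder `χ` is left only when all `n` positions
are occupied. -/
theorem exists_split_multiset (n : ℕ) (m : Multiset κ) :
    ∃ (φ : Fin n → Multiset κ) (χ : Multiset κ), (∀ i, (φ i).card ≤ 1) ∧ ∑ i, φ i + χ = m ∧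
      (χ = 0 ∨ (wordSupport φ).card = n) := by
  classical
  induction n with
  | zero => exact ⟨0, m, by simp, by simp,
      Or.inr (Finset.card_eq_zero.2 (Finset.eq_empty_of_isEmpty _))⟩
  | succ n ih =>
    obtain ⟨φ, χ, h1, hm, h⟩ := ih
    by_cases hχ : χ = 0
    · refine ⟨Fin.cons 0 φ, 0, ?_, ?_, Or.inl rfl⟩
      · exact Fin.cases (by simp) (by simpa using h1)
      · simpa [Fin.sum_univ_succ, hχ] using hm
    · obtain ⟨j, hj⟩ := Multiset.exists_mem_of_ne_zero hχ
      obtain ⟨χ', rfl⟩ := Multiset.exists_cons_of_mem hj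
      refine ⟨Fin.cons {j} φ, χ', ?_, ?_, Or.inr ?_⟩
      · exact Fin.cases (by simp) (by simpa using h1)
      · rw [← hm, Fin.sum_univ_succ]
        simp [add_comm, ← Multiset.singleton_add, add_left_comm]
      · have h3 : wordSupport φ = Finset.univ := by
          refine (Finset.card_eq_iff_eq_univ _).1 ?_
          simpa using h.resolve_left hχ
        have h4 : wordSupport (Fin.cons {j} φ : Fin (n + 1) → Multiset κ) = Finset.univ := by
          refine Finset.eq_univ_of_forall fun i => mem_wordSupport.2 ?_
          refine Fin.cases (by simp) (fun i => ?_) i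
          have : i ∈ wordSupport φ := h3 ▸ Finset.mem_univ i
          simpa using mem_wordSupport.1 this
        rw [h4]
        simp

/-- Strong induction on the total degree, in the spirit of Newton's identities. Modulo words of
lower degree, all nonempty words of content `m` are multiples of one power sum, so it suffices to
place that power sum in `B`. -/
theorem symWord_mem (hB : ∀ φ : Fin n → Multiset κ, (∀ i, (φ i).card ≤ 1) → symWord x φ ∈ B)
    (φ : Fin n → Multiset κ) : symWord x φ ∈ B := by
  classical
  rcases n.eq_zero_or_pos with rfl | hn
  · exact hB φ fun i => i.elim0
  induction hd : (∑ i, φ i).card using Nat.strong_induction_on generalizing φ with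
  | _ d ih =>
    set m := ∑ i, φ i with hm
    have IH (φ : Fin n → Multiset κ) (h : (∑ i, φ i).card < m.card) : symWord x φ ∈ B :=
      ih _ (hd ▸ h) φ rfl
    let i₀ : Fin n := ⟨0, hn⟩
    have key (φ : Fin n → Multiset κ) (h : ∑ i, φ i = m) (hφ : wordSupport φ ≠ ∅) :=
      symWord_congr_powerSum (B := B) i₀ IH _ (Finset.card_pos.2 (Finset.nonempty_iff_ne_empty.2 hφ))
        ((Finset.card_le_univ _).trans_eq (Fintype.card_fin n))
    have hzero (φ : Fin n → Multiset κ) (h : wordSupport φ = ∅) : φ = 0 := by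
      funext i
      by_contra h1
      have := mem_wordSupport.2 h1
      simp [h] at this
    -- If the letters fit one to a position, the power sum is a multiple of a word from `hB`, modulo
    -- `B`. Otherwise all `n` positions are occupied, no new one is available in
    -- `powerSum_relation`, and it states `n c P ∈ B`.
    have hP : symWord x (Pi.single i₀ m : Fin n → Multiset κ) ∈ B := by
      obtain ⟨φ', χ, h1, h2, h3⟩ := exists_split_multiset n m
      by_cases hχ : χ = 0
      · rw [hχ, add_zero] at h2
        by_cases h0 : wordSupport φ' = ∅
        · have hm0 : m = 0 := by rw [← h2, hzero φ' h0]; simp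
          exact hB _ fun i => by simp [hm0]
        · obtain ⟨c, hc, h⟩ := key φ' h2 h0
          have h4 := sub_mem (hB φ' h1) (h φ' h2 rfl)
          rw [sub_sub_cancel] at h4
          simpa [smul_smul, inv_mul_cancel₀ hc] using Subalgebra.smul_mem _ h4 c⁻¹
      · have h3 := h3.resolve_left hχ
        obtain ⟨c, hc, h⟩ := symWord_congr_powerSum (B := B) i₀ IH n hn le_rfl
        have h4 := powerSum_relation IH hn h h3 hχ h2
        have h5 : (wordSupport φ')ᶜ = ∅ := by
          rw [← Finset.card_eq_zero, Finset.card_compl, h3]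
          simp
        rw [h5, Finset.sum_empty, add_zero] at h4
        have hnc : (n : ℂ) * c ≠ 0 := mul_ne_zero (by exact_mod_cast hn.ne') hc
        simpa only [smul_smul, inv_mul_cancel₀ hnc, one_smul] using
          Subalgebra.smul_mem _ h4 ((n : ℂ) * c)⁻¹
    by_cases h0 : wordSupport φ = ∅
    · rw [hzero φ h0]
      exact hB _ fun i => by simp
    · obtain ⟨c, -, h⟩ := key φ hm.symm h0
      simpa using add_mem (h φ hm.symm rfl) (Subalgebra.smul_mem _ hP c)

/-- If `1` is a linear combination of the functions `x`, then the symmetrized products with exactly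
one factor in each component generate all of them. -/
theorem symWord_mem_of_singleton [Fintype κ] {l : κ → ℂ} (hl : ∀ y, ∑ j, l j * x j y = 1)
    (hB : ∀ g : Fin n → κ, symWord x (fun i => {g i}) ∈ B) (φ : Fin n → Multiset κ) :
    symWord x φ ∈ B := by
  classical
  refine symWord_mem (fun φ hφ => ?_) φ
  induction hk : (wordSupport φ)ᶜ.card generalizing φ with
  | zero =>
    have h1 (i : Fin n) : ∃ j, φ i = {j} := by
      refine Multiset.card_eq_one.1 (le_antisymm (hφ i) (Multiset.card_pos.2 ?_))
      rw [Finset.card_eq_zero, Finset.compl_eq_empty_iff] at hk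
      exact mem_wordSupport.1 (hk ▸ Finset.mem_univ i)
    choose g hg using h1
    rw [funext hg]
    exact hB g
  | succ k ih =>
    obtain ⟨i, hi⟩ := Finset.card_pos.1 (by omega : 0 < (wordSupport φ)ᶜ.card)
    have hi0 : φ i = 0 := by
      by_contra h
      exact Finset.mem_compl.1 hi (mem_wordSupport.2 h)
    -- An empty position is filled by inserting `1 = ∑ j, l j * x j` there; the number of empty
    -- positions drops by one in each summand.
    have h1 : symWord x φ = ∑ j, l j • symWord x (φ + Pi.single i {j}) := by
      funext v
      simp only [symWord, Finset.sum_apply, Pi.smul_apply, smul_eq_mul, Finset.mul_sum]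
      rw [Finset.sum_comm]
      refine Finset.sum_congr rfl fun σ _ => ?_
      have h2 (j : κ) : ∏ k, monom x ((φ + Pi.single i {j} : Fin n → Multiset κ) k) (v (σ k)) =
          (∏ k, monom x (φ k) (v (σ k))) * x j (v (σ i)) := by
        simp only [Pi.add_apply, monom_add, Pi.mul_apply, Finset.prod_mul_distrib]
        congr 1
        rw [Finset.prod_eq_single i]
        · simp [monom_singleton]
        · intro k _ hk
          simp [hk, monom_zero]
        · simp
      simp only [h2, mul_left_comm (l _), ← Finset.mul_sum, hl, mul_one]
    rw [h1]
    refine sum_mem fun j _ => Subalgebra.smul_mem _ (ih _ (fun k => ?_) ?_) _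
    · by_cases hk : k = i
      · subst hk
        simp [hi0]
      · simpa [hk] using hφ k
    · have h3 : (wordSupport (φ + Pi.single i {j} : Fin n → Multiset κ))ᶜ =
          (wordSupport φ)ᶜ.erase i := by
        ext k
        by_cases hk : k = i <;> simp [mem_wordSupport, hk]
      rw [h3, Finset.card_erase_of_mem hi, hk]
      rfl

theorem symmetrization_mem [Fintype κ] {l : κ → ℂ} (hl : ∀ y, ∑ j, l j * x j y = 1)
    (hB : ∀ g : Fin n → κ, symWord x (fun i => {g i}) ∈ B) {H : (Fin n → Y) → ℂ}
    (hH : H ∈ powAlg (Algebra.adjoin ℂ (Set.range x)) n) :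
    (fun v => ∑ σ : Equiv.Perm (Fin n), H (v ∘ σ)) ∈ B := by
  have hH' := powAlg_adjoin_le_span _ _ hH
  clear hH
  induction hH' using Submodule.span_induction with
  | mem H h =>
    obtain ⟨φ, hφ, rfl⟩ := h
    have h1 (i : Fin n) : ∃ m : Multiset κ, φ i = monom x m := by
      have h2 := hφ i
      generalize φ i = f at h2
      induction h2 using Submonoid.closure_induction with
      | mem f hf =>
        obtain ⟨j, rfl⟩ := hf
        exact ⟨{j}, (monom_singleton x j).symm⟩
      | one => exact ⟨0, (monom_zero x).symm⟩
      | mul f g _ _ hf hg =>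
        obtain ⟨m, rfl⟩ := hf
        obtain ⟨m', rfl⟩ := hg
        exact ⟨m + m', (monom_add x m m').symm⟩
    choose m hm using h1
    have h3 := symWord_mem_of_singleton hl hB m
    simp only [hm]
    exact h3
  | zero => 
    convert zero_mem B using 1
    funext v
    simp
  | add H H' _ _ h h' =>
    convert add_mem h h' using 1
    funext v
    simp [Finset.sum_add_distrib]
  | smul r H _ h =>
    convert Subalgebra.smul_mem _ h r using 1
    funext v
    simp [Finset.mul_sum]

end SymWord

/-! ### Points of the quotient and characters -/

section Integral

open Polynomial in
theorem isIntegral_of_coeff_mem {R : Type} [CommRing R] [Algebra ℂ R] {B : Subalgebra ℂ R}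
    {p : R[X]} (hp : p.Monic) (hB : ∀ k, p.coeff k ∈ B) {a : R} (ha : p.eval a = 0) :
    IsIntegral B a := by
  have h1 : p ∈ Polynomial.lifts (algebraMap B R) := by
    rw [Polynomial.lifts_iff_coeff_lifts]
    exact fun k => ⟨⟨_, hB k⟩, rfl⟩
  obtain ⟨q, hq, -, hqm⟩ := Polynomial.lifts_and_natDegree_eq_and_monic h1 hp
  refine ⟨q, hqm, ?_⟩
  rw [Polynomial.eval₂_eq_eval_map, hq, ha]

/-- A character of a subalgebra extends to the integral elements. -/
theorem exists_character_extension {R : Type} [CommRing R] [Algebra ℂ R] {B : Subalgebra ℂ R}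
    (ev : B →ₐ[ℂ] ℂ) :
    ∃ θ : integralClosure B R →+* ℂ, ∀ b, θ (algebraMap B _ b) = ev b := by
  let m : Ideal B := RingHom.ker ev
  have hm : m.IsMaximal := RingHom.ker_isMaximal_of_surjective ev fun c =>
    ⟨algebraMap ℂ B c, by simp⟩
  have hinj : Function.Injective (algebraMap B (integralClosure B R)) := fun a b h =>
    Subtype.ext (congrArg (fun s : integralClosure B R => (s : R)) h)
  -- Lying over: the residue field at `Q` is integral over `ℂ`, hence equal to `ℂ`, and the residue
  -- map at `Q` is the extended character.
  obtain ⟨Q, hQ, hQm⟩ := Ideal.exists_ideal_over_maximal_of_isIntegral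
    (S := integralClosure B R) m (by
      rw [(RingHom.injective_iff_ker_eq_bot _).1 hinj]
      exact bot_le)
  let K := integralClosure B R ⧸ Q
  let q : integralClosure B R →+* K := Ideal.Quotient.mk Q
  let _ : Field K := Ideal.Quotient.field Q
  -- The map from `ℂ` is defined through `B`; `hcomp` says that on `B` the residue map at `Q` agrees
  -- with `ev`.
  let i : ℂ →+* K := q.comp ((algebraMap B _).comp (algebraMap ℂ B))
  have hcomp : i.comp (ev : B →+* ℂ) = q.comp (algebraMap B _) := by
    ext b
    refine (Ideal.Quotient.eq.2 ?_)
    have h1 : algebraMap ℂ B (ev b) - b ∈ m := by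
      change ev _ = 0
      simp
    rw [← hQm, Ideal.mem_comap, map_sub] at h1
    exact h1
  let _ : Algebra ℂ K := i.toAlgebra
  have hint : Algebra.IsIntegral ℂ K := ⟨fun k => by
    obtain ⟨s, rfl⟩ := Ideal.Quotient.mk_surjective k
    obtain ⟨p, hp, h⟩ := Algebra.IsIntegral.isIntegral (R := B) s
    refine ⟨p.map (ev : B →+* ℂ), hp.map _, ?_⟩
    rw [Polynomial.eval₂_map]
    change Polynomial.eval₂ (i.comp (ev : B →+* ℂ)) (q s) p = 0
    rw [hcomp, ← Polynomial.hom_eval₂, h, map_zero]⟩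
  have hb := IsAlgClosed.algebraMap_bijective_of_isIntegral (k := ℂ) (K := K)
  let e := RingEquiv.ofBijective (algebraMap ℂ K) hb
  refine ⟨(e.symm : K →+* ℂ).comp q, fun b => ?_⟩
  change e.symm (q.comp (algebraMap B _) b) = _
  rw [← hcomp]
  exact e.symm_apply_apply (ev b)

variable {Y κ : Type} [Fintype κ] {n : ℕ} {x : κ → Y → ℂ} {l : κ → ℂ}

open Polynomial in
-- The function is a root of `∏ k, (T - x j (v k))`, whose coefficients are symmetric polynomials.
-- Being symmetric, each is `1 / n!` times its own symmetrization and so lies in `B`.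
theorem isIntegral_component {B : Subalgebra ℂ ((Fin n → Y) → ℂ)}
    (hl : ∀ y, ∑ j, l j * x j y = 1)
    (hB : ∀ g : Fin n → κ, symWord x (fun i => {g i}) ∈ B) (i : Fin n) (j : κ) :
    IsIntegral B (fun v : Fin n → Y => x j (v i)) := by
  let R := (Fin n → Y) → ℂ
  let X' (i : Fin n) : R := fun v => x j (v i)
  let p : R[X] := ∏ i, (X - C (X' i))
  have hp : p.Monic := monic_prod_X_sub_C X' _
  refine isIntegral_of_coeff_mem hp (fun k => ?_) (a := X' i) ?_
  · have h1 : p.coeff k ∈ powAlg (Algebra.adjoin ℂ (Set.range x)) n := by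
      have h2 (i : Fin n) : X' i ∈ powAlg (Algebra.adjoin ℂ (Set.range x)) n :=
        Algebra.subset_adjoin ⟨i, x j, Algebra.subset_adjoin ⟨j, rfl⟩, rfl⟩
      let q : (powAlg (Algebra.adjoin ℂ (Set.range x)) n)[X] := ∏ i, (X - C ⟨X' i, h2 i⟩)
      have h3 : p = q.map (algebraMap _ R) := by
        simp only [p, q, Polynomial.map_prod, Polynomial.map_sub, map_X, map_C]
        rfl
      rw [h3, coeff_map]
      exact (q.coeff k).2
    have h2 := symmetrization_mem (B := B) hl hB h1
    have h3 (σ : Equiv.Perm (Fin n)) (v : Fin n → Y) : p.coeff k (v ∘ σ) = p.coeff k v := by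
      have h4 (v : Fin n → Y) : p.coeff k v = (∏ i, (X - C (x j (v i)))).coeff k := by
        have h5 : p.map (Pi.evalRingHom (fun _ : Fin n → Y => ℂ) v) =
            ∏ i, (X - C (x j (v i))) := by
          simp only [p, Polynomial.map_prod, Polynomial.map_sub, map_X, map_C]
          rfl
        rw [← h5, coeff_map]
        rfl
      rw [h4, h4]
      congr 1
      exact Equiv.prod_comp σ fun i => X - C (x j (v i))
    simp only [h3, Finset.sum_const, Finset.card_univ, Fintype.card_perm, Fintype.card_fin] at h2
    convert Subalgebra.smul_mem _ h2 (n.factorial : ℂ)⁻¹ using 1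
    funext v
    have : (n.factorial : ℂ) ≠ 0 := by exact_mod_cast n.factorial_ne_zero
    simp [this]
  · rw [eval_prod]
    exact Finset.prod_eq_zero (Finset.mem_univ i) (by simp)

/-- A point at which all relations between the polarized elementary symmetric functions hold comes
from a tuple. -/
theorem exists_tuple_of_relations (hl : ∀ y, ∑ j, l j * x j y = 1)
    (hx : ∀ c : κ → ℂ, ∑ j, l j * c j = 1 → ∃ y, ∀ j, x j y = c j) {z : (Fin n → κ) → ℂ}
    (hz : ∀ Q : MvPolynomial (Fin n → κ) ℂ,
      (∀ v : Fin n → Y, MvPolynomial.eval (fun g => symWord x (fun i => {g i}) v) Q = 0) →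
      MvPolynomial.eval z Q = 0) :
    ∃ v : Fin n → Y, ∀ g : Fin n → κ, symWord x (fun i => {g i}) v = z g := by
  let e : (Fin n → κ) → (Fin n → Y) → ℂ := fun g => symWord x fun i => {g i}
  let f : MvPolynomial (Fin n → κ) ℂ →ₐ[ℂ] ((Fin n → Y) → ℂ) := MvPolynomial.aeval e
  have hker : ∀ Q ∈ RingHom.ker f, MvPolynomial.aeval z Q = 0 := fun Q hQ => hz Q fun v => by
    have h1 : f Q v = 0 := congrFun ((RingHom.mem_ker).1 hQ) v
    have h2 := MvPolynomial.comp_aeval_apply (R := ℂ) (f := e)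
      (Pi.evalAlgHom ℂ (fun _ : Fin n → Y => ℂ) v) Q
    exact (h2.symm.trans (by rfl)).trans h1
  -- By `hz`, evaluation at `z` kills all relations, so it descends to a character of the algebra
  -- generated by the functions `e g`.
  let ev : f.range →ₐ[ℂ] ℂ := (Ideal.Quotient.liftₐ (RingHom.ker f) (MvPolynomial.aeval z)
    hker).comp (Ideal.quotientKerEquivRange f).symm.toAlgHom
  have hmem (g : Fin n → κ) : e g ∈ f.range := ⟨MvPolynomial.X g, MvPolynomial.aeval_X _ _⟩
  have hev (g : Fin n → κ) : ev ⟨e g, hmem g⟩ = z g := by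
    have h1 : (Ideal.quotientKerEquivRange f).symm ⟨e g, hmem g⟩ =
        Ideal.Quotient.mk (RingHom.ker f) (MvPolynomial.X g) := by
      rw [AlgEquiv.symm_apply_eq]
      refine Subtype.ext ?_
      exact (MvPolynomial.aeval_X e g).symm
    change Ideal.Quotient.liftₐ (RingHom.ker f) (MvPolynomial.aeval z) hker
      ((Ideal.quotientKerEquivRange f).symm ⟨e g, hmem g⟩) = z g
    rw [h1]
    exact MvPolynomial.aeval_X z g
  obtain ⟨θ, hθ⟩ := exists_character_extension ev
  have hθc (c : ℂ) : θ (algebraMap f.range _ (algebraMap ℂ f.range c)) = c := by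
    rw [hθ]
    exact ev.commutes c
  let S := integralClosure f.range ((Fin n → Y) → ℂ)
  let X' (i : Fin n) (j : κ) : S := ⟨fun v => x j (v i), isIntegral_component hl hmem i j⟩
  -- The values of `θ` on the coordinates of the `i`-th component satisfy the affine equation, so
  -- `hx` realizes them as the coordinates of a point.
  have h1 (i : Fin n) : ∑ j, l j * θ (X' i j) = 1 := by
    have h2 : ∑ j, algebraMap f.range S (algebraMap ℂ f.range (l j)) * X' i j = 1 := by
      refine Subtype.ext ?_
      funext v
      simpa [X', Finset.sum_apply] using hl (v i)
    have h3 := congrArg θ h2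
    rw [map_sum, map_one] at h3
    refine (Finset.sum_congr rfl fun j _ => ?_).trans h3
    rw [map_mul]
    exact congrArg (· * _) (hθc _).symm
  choose v hv using fun i => hx _ (h1 i)
  refine ⟨v, fun g => ?_⟩
  have h2 : algebraMap f.range S ⟨e g, hmem g⟩ =
      ∑ σ : Equiv.Perm (Fin n), ∏ i, X' (σ i) (g i) := by
    refine Subtype.ext ?_
    funext w
    simp [e, X', symWord, monom_singleton]
  have h3 := congrArg θ h2
  rw [hθ, hev] at h3
  rw [h3]
  simp [symWord, monom_singleton, hv]

end Integral

/-! ### The symmetric product of a projective space is quasi-projective -/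

/-- The polarized elementary symmetric functions of points of projective space. -/
def permCoord {N n : ℕ} (v : Fin n → ProjPt N) (g : Fin n → Fin (N + 1)) : ℂ :=
  ∑ σ : Equiv.Perm (Fin n), ∏ i, (v (σ i)).rep (g i)

theorem permCoord_comp_perm {N n : ℕ} (v : Fin n → ProjPt N) (τ : Equiv.Perm (Fin n)) :
    permCoord (v ∘ τ) = permCoord v := by
  funext g
  exact Fintype.sum_equiv (Equiv.mulLeft τ) _ _ fun σ => rfl

theorem sum_permCoord {N n : ℕ} (l : Fin (N + 1) → ℂ) (v : Fin n → ProjPt N) :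
    ∑ g : Fin n → Fin (N + 1), (∏ i, l (g i)) * permCoord v g =
      n.factorial * ∏ i, linVal l (v i).rep := by
  simp only [permCoord, Finset.mul_sum]
  rw [Finset.sum_comm]
  have h (σ : Equiv.Perm (Fin n)) : ∑ g : Fin n → Fin (N + 1),
      (∏ i, l (g i)) * ∏ i, (v (σ i)).rep (g i) = ∏ i, linVal l (v i).rep := by
    rw [← Equiv.prod_comp σ]
    simp only [linVal, Finset.prod_univ_sum, Fintype.piFinset_univ, Finset.prod_mul_distrib]
  simp [h, Fintype.card_perm]

/-- The dimension of the projective space containing the `n`-th symmetric product. -/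
def chowDim (N n : ℕ) : ℕ := (N + 1) ^ n - 1

/-- Numbering of the polarized elementary symmetric functions. -/
def chowIdx (N n : ℕ) : (Fin n → Fin (N + 1)) ≃ Fin (chowDim N n + 1) :=
  Fintype.equivFinOfCardEq (by
    rw [chowDim, Nat.sub_add_cancel (Nat.one_le_pow _ _ (Nat.succ_pos N))]
    simp)

/-- For a linear form `l` non-zero at all the points, a combination of these coordinates equals `n!`
times the product of the values of `l`. -/
theorem permCoord_ne_zero {N n : ℕ} (v : Fin n → ProjPt N) :
    (fun k => permCoord v ((chowIdx N n).symm k)) ≠ 0 := by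
  intro h
  obtain ⟨l, hl⟩ := exists_linVal_ne (fun i => (v i).rep) fun i => (v i).rep_nonzero
  have h1 (g) : permCoord v g = 0 := by simpa using congrFun h (chowIdx N n g)
  have h2 := sum_permCoord l v
  simp only [h1, mul_zero, Finset.sum_const_zero] at h2
  refine mul_ne_zero ?_ (Finset.prod_ne_zero_iff.2 fun i _ => hl i) h2.symm
  exact_mod_cast n.factorial_ne_zero

/-- The map from the symmetric product of a projective space to a projective space given by the
polarized elementary symmetric functions. -/
def chow {N n : ℕ} (s : Sym (ProjPt N) n) : ProjPt (chowDim N n) :=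
  Projectivization.mk ℂ _ (permCoord_ne_zero (ordering s))

theorem chow_rep {N n : ℕ} (v : Fin n → ProjPt N) :
    ∃ c : ℂ, c ≠ 0 ∧ ∀ g, (chow (unordered v)).rep (chowIdx N n g) = c * permCoord v g := by
  obtain ⟨a, ha⟩ := Projectivization.exists_smul_eq_mk_rep ℂ _
    (permCoord_ne_zero (ordering (unordered v)))
  refine ⟨a, a.ne_zero, fun g => ?_⟩
  obtain ⟨τ, hτ⟩ := unordered_eq_iff.1 (unordered_ordering (unordered v)).symm
  unfold chow
  rw [← ha, hτ, permCoord_comp_perm]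
  simp [Units.smul_def]

/-- The linear form on the target of `chow` whose non-vanishing means that all points are outside
the hyperplane `l = 0`. -/
def chowForm {N : ℕ} (n : ℕ) (l : Fin (N + 1) → ℂ) (k : Fin (chowDim N n + 1)) : ℂ :=
  ∏ i, l ((chowIdx N n).symm k i)

theorem linVal_chowForm {N n : ℕ} (l : Fin (N + 1) → ℂ) {z : ProjPt (chowDim N n)} {c : ℂ}
    {v : Fin n → ProjPt N} (h : ∀ g, z.rep (chowIdx N n g) = c * permCoord v g) :
    linVal (chowForm n l) z.rep = c * (n.factorial * ∏ i, linVal l (v i).rep) := by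
  unfold linVal
  rw [← Equiv.sum_comp (chowIdx N n)]
  simp only [h, chowForm, Equiv.symm_apply_apply, mul_left_comm _ c, ← Finset.mul_sum,
    sum_permCoord]
  rfl

/-- Thus the preimage under `chow` of an affine chart of the target is the chart of the symmetric
product made of tuples avoiding the hyperplane `l = 0`. -/
theorem linVal_chowForm_ne_iff {N n : ℕ} (l : Fin (N + 1) → ℂ) (v : Fin n → ProjPt N) :
    linVal (chowForm n l) (chow (unordered v)).rep ≠ 0 ↔ ∀ i, linVal l (v i).rep ≠ 0 := by
  obtain ⟨c, hc, h⟩ := chow_rep v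
  rw [linVal_chowForm l h]
  have : (n.factorial : ℂ) ≠ 0 := by exact_mod_cast n.factorial_ne_zero
  simp [hc, this, Finset.prod_eq_zero_iff]

/-- The affine coordinates on the complement of a hyperplane. -/
def affX {N : ℕ} (l : Fin (N + 1) → ℂ) (j : Fin (N + 1)) (y : {y : ProjPt N // linVal l y.rep ≠ 0}) :
    ℂ := affCoord l j y.1

theorem sum_affX {N : ℕ} (l : Fin (N + 1) → ℂ) (y : {y : ProjPt N // linVal l y.rep ≠ 0}) :
    ∑ j, l j * affX l j y = 1 := by
  simp only [affX, affCoord, mul_div_assoc', ← Finset.sum_div]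
  exact div_self y.2

/-- The chart is the whole affine hyperplane `∑ j, l j * c j = 1`; this surjectivity is the
hypothesis `hx` of `exists_tuple_of_relations`. -/
theorem exists_affX {N : ℕ} (l c : Fin (N + 1) → ℂ) (h : ∑ j, l j * c j = 1) :
    ∃ y, ∀ j, affX l j y = c j := by
  have hc : c ≠ 0 := by
    rintro rfl
    simp at h
  obtain ⟨a, ha⟩ := Projectivization.exists_smul_eq_mk_rep ℂ c hc
  have h1 : linVal l (Projectivization.mk ℂ c hc).rep = a := by
    rw [← ha]
    simp only [linVal, Pi.smul_apply, Units.smul_def, smul_eq_mul, mul_left_comm _ (a : ℂ),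
      ← Finset.mul_sum, h, mul_one]
  refine ⟨⟨Projectivization.mk ℂ c hc, by rw [h1]; exact a.ne_zero⟩, fun j => ?_⟩
  simp only [affX, affCoord, h1]
  rw [← ha]
  simp [Units.smul_def]

/-- Dividing each representative by the value of `l` divides the polarized function by `∏ i, l(v
i)`. The factor `n!` compensates the one in `linVal_chowForm`. -/
theorem symWord_affX {N n : ℕ} (l : Fin (N + 1) → ℂ)
    (v : Fin n → {y : ProjPt N // linVal l y.rep ≠ 0}) (g : Fin n → Fin (N + 1)) :
    symWord (affX l) (fun i => {g i}) v =
      n.factorial * affCoord (chowForm n l) (chowIdx N n g) (chow (unordered fun i => (v i).1)) := by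
  obtain ⟨c, hc, h⟩ := chow_rep fun i => (v i).1
  have h1 : ∏ i, linVal l (v i).1.rep ≠ 0 := Finset.prod_ne_zero_iff.2 fun i _ => (v i).2
  have h2 : (n.factorial : ℂ) ≠ 0 := by exact_mod_cast n.factorial_ne_zero
  have h3 : symWord (affX l) (fun i => {g i}) v =
      permCoord (fun i => (v i).1) g / ∏ i, linVal l (v i).1.rep := by
    simp only [symWord, monom_singleton, affX, affCoord, Finset.prod_div_distrib, permCoord,
      Finset.sum_div]
    exact Finset.sum_congr rfl fun σ _ => by
      rw [Equiv.prod_comp σ fun i => linVal l (v i).1.rep]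
  rw [h3, affCoord, linVal_chowForm l h, h]
  field_simp

theorem powAlg_restrict {N n : ℕ} {l : Fin (N + 1) → ℂ} {H : (Fin n → ProjPt N) → ℂ}
    (hH : H ∈ powAlg (affAlg l) n) :
    (fun v : Fin n → {y : ProjPt N // linVal l y.rep ≠ 0} => H fun i => (v i).1) ∈
      powAlg (Algebra.adjoin ℂ (Set.range (affX l))) n := by
  have h1 : affAlg l ≤ (Algebra.adjoin ℂ (Set.range (affX l))).comap (precomp Subtype.val) := by
    refine Algebra.adjoin_le ?_
    rintro _ ⟨j, rfl⟩
    exact Algebra.subset_adjoin ⟨j, rfl⟩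
  have h2 : powAlg (affAlg l) n ≤ (powAlg (Algebra.adjoin ℂ (Set.range (affX l))) n).comap
      (precomp fun v i => (v i).1) := by
    refine Algebra.adjoin_le ?_
    rintro _ ⟨i, a, ha, rfl⟩
    exact Algebra.subset_adjoin ⟨i, _, h1 ha, rfl⟩
  exact h2 hH

theorem affine_symmetrization_mem {N n : ℕ} {l : Fin (N + 1) → ℂ}
    {B : Subalgebra ℂ ((Fin n → {y : ProjPt N // linVal l y.rep ≠ 0}) → ℂ)}
    (hB : ∀ g : Fin n → Fin (N + 1), symWord (affX l) (fun i => {g i}) ∈ B)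
    {H : (Fin n → ProjPt N) → ℂ} (hH : H ∈ powAlg (affAlg l) n) :
    (fun v => ∑ σ : Equiv.Perm (Fin n), H fun i => (v (σ i)).1) ∈ B :=
  symmetrization_mem (sum_affX l) hB (powAlg_restrict hH)

/-- Normalizing the `i`-th representative by a coordinate `j i` that is non-zero near `v` turns the
homogeneous coordinates of the image into regular functions, up to a common factor. -/
theorem chow_isMorphism (N n : ℕ) :
    IsMorphism (X := (projSpace N).symPow n) (Y := projSpace (chowDim N n)) chow := by
  refine isMorphism_of_unordered (X := projSpace N) (φ := chow) (isMorphism_of_coord fun v => ?_)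
  choose j hj using fun i => exists_coord_ne (v i : ProjPt N)
  have hpr (i : Fin n) : IsMorphism (X := (projSpace N).pow n) (Y := projSpace N)
      fun w : Fin n → ProjPt N => w i :=
    initial_proj (T := Fin n → ProjPt N) (fun _ : Fin n => projSpace N) (fun i v => v i) i
  have hreg := fun k => regAt_eval (T := (projSpace N).pow n) (t := v)
    (f := fun (p : Fin n × Fin (N + 1)) (w : Fin n → ProjPt N) =>
      (w p.1).rep p.2 / (w p.1).rep (j p.1))
    (fun p => (hpr p.1).2 _ v (regAt_coord p.2 (hj p.1)))
    (∑ σ : Equiv.Perm (Fin n), ∏ i, MvPolynomial.X (σ i, (chowIdx N n).symm k i))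
  refine ⟨_, hreg, ?_⟩
  have hev : ∀ᶠ w in @nhds _ ((projSpace N).pow n).top v, ∀ i,
      Projectivization.rep ((w : Fin n → ProjPt N) i) (j i) ≠ 0 :=
    eventually_all.2 fun i => (hpr i).1.continuousAt.eventually (coord_eventually_ne (hj i))
  filter_upwards [hev] with w hw
  obtain ⟨c, hc, h⟩ := chow_rep (w : Fin n → ProjPt N)
  refine ⟨c * ∏ i, Projectivization.rep ((w : Fin n → ProjPt N) i) (j i), fun k => ?_⟩
  obtain ⟨g, rfl⟩ := (chowIdx N n).surjective k
  refine (h g).trans ?_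
  have hP : ∏ i, Projectivization.rep ((w : Fin n → ProjPt N) i) (j i) ≠ 0 :=
    Finset.prod_ne_zero_iff.2 fun i _ => hw i
  simp only [map_sum, map_prod, MvPolynomial.eval_X, Equiv.symm_apply_apply,
    Finset.prod_div_distrib, mul_assoc]
  refine congrArg (c * ·) ?_
  unfold permCoord
  rw [Finset.mul_sum]
  refine Finset.sum_congr rfl fun σ _ => ?_
  rw [Equiv.prod_comp σ fun i => Projectivization.rep ((w : Fin n → ProjPt N) i) (j i)]
  field_simp

theorem chow_injective {N n : ℕ} : Function.Injective (chow : Sym (ProjPt N) n → _) := by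
  classical
  intro s t hst
  obtain ⟨v, rfl⟩ := unordered_surjective s
  obtain ⟨w, rfl⟩ := unordered_surjective t
  obtain ⟨l, hl⟩ := exists_linVal_ne (fun i => (Sum.elim v w i).rep)
    fun i => (Sum.elim v w i).rep_nonzero
  have hv (i : Fin n) : linVal l (v i).rep ≠ 0 := hl (Sum.inl i)
  have hw (i : Fin n) : linVal l (w i).rep ≠ 0 := hl (Sum.inr i)
  by_contra hne
  let S : Set (Fin n → ProjPt N) := (Set.range fun σ : Equiv.Perm (Fin n) => v ∘ σ) ∪
    Set.range fun σ : Equiv.Perm (Fin n) => w ∘ σ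
  obtain ⟨p, hp, hpv, hp0⟩ : ∃ p ∈ powAlg (affAlg l) n, p v = 1 ∧ ∀ w ∈ S, w ≠ v → p w = 0 :=
    (affChart_separates l).powAlg_bump (n := n) (v := v) hv (S := S)
    ((Set.finite_range _).union (Set.finite_range _)) (by
      rintro _ (⟨σ, rfl⟩ | ⟨σ, rfl⟩) i
      exacts [hv _, hw _])
  let v' : Fin n → {y : ProjPt N // linVal l y.rep ≠ 0} := fun i => ⟨v i, hv i⟩
  let w' : Fin n → {y : ProjPt N // linVal l y.rep ≠ 0} := fun i => ⟨w i, hw i⟩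
  -- Functions taking equal values at `v'` and `w'`. Equality of the images puts the generators in
  -- `B`, hence all symmetrizations, while the symmetrization of the bump `p` is zero at `w'` and
  -- positive at `v'`.
  let B : Subalgebra ℂ ((Fin n → {y : ProjPt N // linVal l y.rep ≠ 0}) → ℂ) :=
    AlgHom.equalizer (Pi.evalAlgHom ℂ (fun _ => ℂ) v') (Pi.evalAlgHom ℂ (fun _ => ℂ) w')
  have h1 := affine_symmetrization_mem (B := B) (fun g => by
    change symWord _ _ v' = symWord _ _ w'
    rw [symWord_affX, symWord_affX]
    exact congrArg (fun z => _ * affCoord _ _ z) hst) hp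
  have h2 : ∑ σ : Equiv.Perm (Fin n), p (v ∘ σ) = ∑ σ : Equiv.Perm (Fin n), p (w ∘ σ) := h1
  have h3 (σ : Equiv.Perm (Fin n)) : p (w ∘ σ) = 0 :=
    hp0 _ (Or.inr ⟨σ, rfl⟩) fun h => hne (by rw [← h, unordered_comp_perm])
  have h4 (σ : Equiv.Perm (Fin n)) : p (v ∘ σ) = if v ∘ σ = v then 1 else 0 := by
    split_ifs with h
    · rw [h, hpv]
    · exact hp0 _ (Or.inl ⟨σ, rfl⟩) h
  simp only [h3, h4, Finset.sum_const_zero, Finset.sum_boole, Nat.cast_eq_zero,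
    Finset.card_eq_zero, Finset.filter_eq_empty_iff] at h2
  exact h2 (Finset.mem_univ 1) rfl

theorem chow_isEmb (N n : ℕ) :
    IsEmb (X := (projSpace N).symPow n) (Y := projSpace (chowDim N n)) chow := by
  refine ⟨chow_injective, chow_isMorphism N n, fun W ψ hψ => isMorphism_of_charts fun w => ?_⟩
  obtain ⟨l, hl⟩ := exists_linVal_ne (fun i => (ordering (X := ProjPt N) (ψ w) i).rep)
    fun i => (ordering (X := ProjPt N) (ψ w) i).rep_nonzero
  have hdom (w' : W) : linVal (chowForm n l) (chow (ψ w')).rep ≠ 0 ↔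
      ψ w' ∈ (symChart (affChart l) (affChart_separates l) n).dom := by
    obtain ⟨v, hv⟩ := unordered_surjective (X := ProjPt N) (n := n) (ψ w')
    rw [← hv, linVal_chowForm_ne_iff]
    change _ ↔ ∀ x ∈ (unordered v : Sym (ProjPt N) n), linVal l (Projectivization.rep x) ≠ 0
    simp [mem_unordered]
  have hw : linVal (chowForm n l) (chow (ψ w)).rep ≠ 0 := by
    have h := unordered_ordering (X := ProjPt N) (n := n) (ψ w)
    rw [← h, linVal_chowForm_ne_iff]
    exact hl
  have hev : ∀ᶠ w' in 𝓝 w, linVal (chowForm n l) (chow (ψ w')).rep ≠ 0 :=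
    hψ.1.continuousAt.eventually ((affChart (chowForm n l)).isOpen.mem_nhds hw)
  refine ⟨symChart (affChart l) (affChart_separates l) n, ?_, fun a ha => ?_⟩
  · filter_upwards [hev] with w' h using (hdom w').1 h
  -- Functions of ordered tuples whose value at an ordering of `ψ` is the value of a function
  -- regular at `w`. The generators belong to `B` as affine coordinates of `chow ∘ ψ`, hence so do
  -- all symmetrizations.
  let B : Subalgebra ℂ ((Fin n → {y : ProjPt N // linVal l y.rep ≠ 0}) → ℂ) :=
    { carrier := {F | ∃ h : W → ℂ, W.RegAt h w ∧ ∀ w' v, ψ w' = unordered (fun i => (v i).1) →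
        h w' = F v}
      add_mem' := by
        rintro _ _ ⟨h, hr, he⟩ ⟨h', hr', he'⟩
        exact ⟨_, W.add hr hr', fun w' v hv => congrArg₂ (· + ·) (he w' v hv) (he' w' v hv)⟩
      mul_mem' := by
        rintro _ _ ⟨h, hr, he⟩ ⟨h', hr', he'⟩
        exact ⟨_, W.mul hr hr', fun w' v hv => congrArg₂ (· * ·) (he w' v hv) (he' w' v hv)⟩
      algebraMap_mem' := fun r => ⟨_, W.const r w, fun _ _ _ => rfl⟩ }
  obtain ⟨h, hr, he⟩ := affine_symmetrization_mem (B := B) (fun g => by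
    refine ⟨_, W.mul (W.const n.factorial w)
      (hψ.2 _ w (regAt_affCoord hw (chowIdx N n g))), fun w' v hv => ?_⟩
    rw [symWord_affX]
    change _ * affCoord _ _ (chow (ψ w')) = _
    rw [hv]
    rfl) (H := a ∘ unordered (X := ProjPt N)) ha
  have hn : (n.factorial : ℂ) ≠ 0 := by exact_mod_cast n.factorial_ne_zero
  refine W.congr ?_ (W.mul (W.const (n.factorial : ℂ)⁻¹ w) hr)
  filter_upwards [hev] with w' hw'
  obtain ⟨v, hv⟩ := unordered_surjective (X := ProjPt N) (n := n) (ψ w')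
  have hvd : ∀ i, linVal l (v i).rep ≠ 0 := by
    rw [← hv, linVal_chowForm_ne_iff] at hw'
    exact hw'
  change _ * h w' = a (ψ w')
  rw [he w' (fun i => ⟨v i, hvd i⟩) hv.symm]
  have h5 (σ : Equiv.Perm (Fin n)) : (a ∘ unordered (X := ProjPt N)) (fun i => v (σ i)) =
      a (ψ w') := by
    rw [← hv]
    exact congrArg a (unordered_comp_perm v σ)
  simp only [h5, Finset.sum_const, Finset.card_univ, Fintype.card_perm, Fintype.card_fin,
    nsmul_eq_mul]
  rw [inv_mul_cancel_left₀ hn]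

/-- The range is closed in the union of the charts `chowForm n l ≠ 0`: there, a point of its closure
satisfies every polynomial relation between the generators and so comes from a tuple. -/
theorem chow_range_isLocallyClosed (N n : ℕ) :
    IsLocallyClosed (X := projSpace (chowDim N n)) (Set.range (chow (N := N) (n := n))) := by
  let R : Set (projSpace (chowDim N n)) := Set.range (chow (N := N) (n := n))
  refine ⟨⋃ l : Fin (N + 1) → ℂ, (affChart (chowForm n l)).dom, closure R,
    isOpen_iUnion fun l => (affChart _).isOpen, isClosed_closure, subset_antisymm ?_ ?_⟩
  · rintro _ ⟨s, rfl⟩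
    refine ⟨?_, subset_closure ⟨s, rfl⟩⟩
    obtain ⟨v, rfl⟩ := unordered_surjective s
    obtain ⟨l, hl⟩ := exists_linVal_ne (fun i => (v i).rep) fun i => (v i).rep_nonzero
    exact Set.mem_iUnion.2 ⟨l, (linVal_chowForm_ne_iff l v).2 hl⟩
  · rintro z ⟨hzU, hz⟩
    obtain ⟨l, hl⟩ := Set.mem_iUnion.1 hzU
    have hl' : linVal (chowForm n l) (Projectivization.rep z) ≠ 0 := hl
    obtain ⟨v, hv⟩ := exists_tuple_of_relations (n := n) (sum_affX l) (exists_affX l)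
      (z := fun g => n.factorial * affCoord (chowForm n l) (chowIdx N n g) z) (fun Q hQ => by
        -- If a relation failed at `z`, it would fail on a neighbourhood, which meets the range; but
        -- relations hold on the range.
        by_contra h0
        have hreg := regAt_eval (T := projSpace (chowDim N n)) (t := z)
          (f := fun g y => n.factorial * affCoord (chowForm n l) (chowIdx N n g) y)
          (fun g => FnSpace.mul _ (FnSpace.const _ _ _) (regAt_affCoord hl' _)) Q
        have hne := (FnSpace.eventually_ne _ hreg h0).and ((affChart _).isOpen.mem_nhds hl)
        obtain ⟨_, ⟨h1, h2⟩, s, rfl⟩ := mem_closure_iff_nhds.1 hz _ hne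
        obtain ⟨v, rfl⟩ := unordered_surjective s
        have hvd := (linVal_chowForm_ne_iff l v).1 h2
        refine h1 ?_
        have h3 := hQ fun i => ⟨v i, hvd i⟩
        simp only [symWord_affX] at h3
        exact h3)
    refine ⟨unordered fun i => (v i).1, ?_⟩
    have hn : (n.factorial : ℂ) ≠ 0 := by exact_mod_cast n.factorial_ne_zero
    have hv' : linVal (chowForm n l) (chow (unordered fun i => (v i).1)).rep ≠ 0 :=
      (linVal_chowForm_ne_iff l _).2 fun i => (v i).2
    refine proj_ext (c := linVal (chowForm n l) (chow (unordered fun i => (v i).1)).rep /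
      linVal (chowForm n l) (Projectivization.rep z)) fun k => ?_
    obtain ⟨g, rfl⟩ := (chowIdx N n).surjective k
    have h1 := hv g
    rw [symWord_affX] at h1
    have h2 := mul_left_cancel₀ hn h1
    unfold affCoord at h2
    rw [div_eq_div_iff hv' hl'] at h2
    rw [div_mul_eq_mul_div, eq_div_iff hl', h2]
    ring

/-! ### Symmetric products of embedded spaces -/

theorem isMorphism_const {X Y : FnSpace} (y : Y) : IsMorphism (X := X) (Y := Y) fun _ => y :=
  ⟨continuous_const, fun g x _ => X.const (g y) x⟩

/-- The unordered tuple of the images of the members of an unordered tuple. -/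
def symMap {X Y : Type} {n : ℕ} (φ : X → Y) (s : Sym X n) : Sym Y n :=
  ⟨(s : Multiset X).map φ, by simp⟩

theorem symMap_unordered {X Y : Type} {n : ℕ} (φ : X → Y) (v : Fin n → X) :
    symMap φ (unordered v) = unordered (φ ∘ v) := by
  refine Subtype.ext ?_
  change (Finset.univ.val.map v).map φ = Finset.univ.val.map (φ ∘ v)
  rw [Multiset.map_map]

/-- This is the join with an empty second tuple: the second subspace is empty, so the separation
condition is vacuous and its `0`-th symmetric product is a point. -/
theorem symMap_isEmb {X Y : FnSpace} (hY : HasCharts Y) {φ : X → Y} (h : IsEmb φ) (n : ℕ) :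
    IsEmb (X := X.symPow n) (Y := Y.symPow n) (symMap φ) := by
  have h0 : IsEmb (X := X.sub (∅ : Set X)) (Y := Y) (fun b : (∅ : Set X) => φ b.1) :=
    h.comp (isEmb_val (∅ : Set X))
  let b₀ : Sym (∅ : Set X) 0 := unordered Fin.elim0
  have h1 := joinSym_isEmb hY h h0 (fun b => b.2.elim) (add_zero n)
  have h2 : (symMap φ : Sym X n → Sym Y n) =
      fun s => joinSym (add_zero n) φ (fun b : (∅ : Set X) => φ b.1) s b₀ := by
    funext s
    refine Subtype.ext ?_
    change (s : Multiset X).map φ = (s : Multiset X).map φ +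
      ((Finset.univ.val : Multiset (Fin 0)).map (Fin.elim0 : Fin 0 → (∅ : Set X))).map _
    simp
  have h3 : IsMorphism (X := X.symPow n) (Y := (X.symPow n).prod ((X.sub (∅ : Set X)).symPow 0))
      fun s => (s, b₀) := prod_lift (IsMorphism.id _) (isMorphism_const _)
  refine ⟨fun s t hst => ?_, ?_, fun W ψ hψ => ?_⟩
  · rw [h2] at hst
    exact congrArg Prod.fst (h1.1 (a₁ := (s, b₀)) (a₂ := (t, b₀)) hst)
  · rw [h2]
    exact h1.2.1.comp h3
  · rw [h2] at hψ
    exact (prod_fst _ _).comp (h1.2.2 W (fun w => (ψ w, b₀)) hψ)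

theorem range_symMap {X Y : Type} (φ : X → Y) (n : ℕ) :
    Set.range (symMap φ : Sym X n → Sym Y n) = {t | ∀ y ∈ t, y ∈ Set.range φ} := by
  ext t
  obtain ⟨v, rfl⟩ := unordered_surjective t
  constructor
  · rintro ⟨s, hs⟩ y hy
    obtain ⟨u, rfl⟩ := unordered_surjective s
    rw [← hs, symMap_unordered, mem_unordered] at hy
    obtain ⟨i, rfl⟩ := hy
    exact ⟨_, rfl⟩
  · intro h
    choose u hu using fun i => h (v i) (mem_unordered.2 ⟨i, rfl⟩)
    exact ⟨unordered u, by rw [symMap_unordered]; exact congrArg _ (funext hu)⟩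

theorem pow_proj (X : FnSpace) (n : ℕ) (i : Fin n) :
    IsMorphism (X := X.pow n) (Y := X) fun v : Fin n → X => v i :=
  initial_proj (T := Fin n → X) (fun _ : Fin n => X) (fun i v => v i) i

theorem symPow_isClosed {X : FnSpace} {n : ℕ} {Z : Set (Sym X n)}
    (h : IsClosed (X := X.pow n) (unordered (X := X) ⁻¹' Z)) : IsClosed (X := X.symPow n) Z :=
  ⟨symPow_isOpen h.isOpen_compl⟩

theorem isLocallyClosed_forall_mem {X : FnSpace} {S : Set X} (hS : IsLocallyClosed S) (n : ℕ) :
    IsLocallyClosed (X := X.symPow n) {s : Sym X n | ∀ x ∈ s, x ∈ S} := by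
  obtain ⟨U, Z, hU, hZ, rfl⟩ := hS
  have h (T : Set X) : unordered (X := X) ⁻¹' {s : Sym X n | ∀ x ∈ s, x ∈ T} =
      ⋂ i, (fun v : Fin n → X => v i) ⁻¹' T := by
    ext v
    simp [mem_unordered]
  refine ⟨{s : Sym X n | ∀ x ∈ s, x ∈ U}, {s : Sym X n | ∀ x ∈ s, x ∈ Z},
    symPow_isOpen ((congrArg (fun T => IsOpen (X := X.pow n) T) (h U)).mpr ?_),
    symPow_isClosed ((congrArg (fun T => IsClosed (X := X.pow n) T) (h Z)).mpr ?_), ?_⟩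
  · exact isOpen_iInter_of_finite fun i => hU.preimage (pow_proj X n i).1
  · exact isClosed_iInter fun i => hZ.preimage (pow_proj X n i).1
  · ext s
    exact ⟨fun h => ⟨fun x hx => (h x hx).1, fun x hx => (h x hx).2⟩,
      fun h x hx => ⟨h.1 x hx, h.2 x hx⟩⟩

theorem IsQuasiProjective.symPow {X : FnSpace} (hX : IsQuasiProjective X) (n : ℕ) :
    IsQuasiProjective (X.symPow n) := by
  obtain ⟨N, φ, hφ, hr⟩ := isQuasiProjective_iff.1 hX
  have h1 := (chow_isEmb N n).comp (symMap_isEmb (hasCharts_projSpace N) hφ n)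
  refine isQuasiProjective_iff.2 ⟨_, _, h1, ?_⟩
  have h2 : Set.range (fun s : Sym X n => chow (symMap φ s)) =
      chow '' {t : Sym (projSpace N) n | ∀ y ∈ t, y ∈ Set.range φ} := by
    refine (Set.range_comp (chow (N := N) (n := n)) (symMap φ)).trans ?_
    exact congrArg _ (range_symMap (Y := projSpace N) φ n)
  exact h2 ▸ (isLocallyClosed_forall_mem hr n).image (chow_isEmb N n).inducing
    (chow_range_isLocallyClosed N n)

/-! ### Counting members of unordered tuples in a subset -/

/-- The number of members of an unordered tuple in a subset. -/
def countIn {X : Type} {n : ℕ} (S : Set X) (s : Sym X n) : ℕ :=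
  open Classical in (s : Multiset X).countP (· ∈ S)

theorem countIn_unordered {X : Type} {n : ℕ} (S : Set X) (v : Fin n → X) :
    countIn S (unordered v) = {i | v i ∈ S}.ncard := by
  classical
  change (Finset.univ.val.map v).countP _ = _
  rw [Multiset.countP_map, Set.ncard_eq_toFinset_card']
  simp
  rfl

theorem countIn_le {X : Type} {n : ℕ} (S : Set X) (s : Sym X n) : countIn S s ≤ n := by
  classical
  exact (Multiset.countP_le_card _ _).trans_eq s.2

theorem countIn_pos {X : Type} {n : ℕ} {S : Set X} {s : Sym X n} :
    0 < countIn S s ↔ ∃ x ∈ s, x ∈ S := by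
  classical exact Multiset.countP_pos

/-- On ordered tuples the set is a finite union, over `k`-element sets of positions, of the closed
conditions that those positions lie in `Z`. -/
theorem isClosed_le_countIn {X : FnSpace} {Z : Set X} (hZ : IsClosed Z) (n k : ℕ) :
    IsClosed (X := X.symPow n) {s : Sym X n | k ≤ countIn Z s} := by
  refine symPow_isClosed ?_
  have h : unordered (X := X) ⁻¹' {s : Sym X n | k ≤ countIn Z s} =
      ⋃ I : {I : Finset (Fin n) // I.card = k}, ⋂ i ∈ I.1, (fun v : Fin n → X => v i) ⁻¹' Z := by
    classical
    ext v
    simp only [Set.mem_preimage, Set.mem_ofPred_eq, countIn_unordered, Set.mem_iUnion,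
      Set.mem_iInter, Subtype.exists, exists_prop]
    constructor
    · intro h
      rw [Set.ncard_eq_toFinset_card'] at h
      obtain ⟨I, hI, hk⟩ := Finset.exists_subset_card_eq h
      exact ⟨I, hk, fun i hi => by simpa using hI hi⟩
    · rintro ⟨I, rfl, hI⟩
      rw [← Set.ncard_coe_finset]
      exact Set.ncard_le_ncard (fun i hi => hI i hi) (Set.toFinite _)
  refine (congrArg (fun T => IsClosed (X := X.pow n) T) h).mpr ?_
  exact isClosed_iUnion_of_finite fun I => isClosed_iInter fun i => isClosed_iInter fun _ =>
    hZ.preimage (pow_proj X n i).1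

/-! ### Constructibility of the set of tuples meeting a subset. -/

theorem IsConstructibleSet.of_isLocallyClosed {X : Type} [TopologicalSpace X] {S : Set X}
    (h : IsLocallyClosed S) : IsConstructibleSet S :=
  ⟨{S}, Set.finite_singleton _, by simpa using h, by simp⟩

theorem isConstructibleSet_iUnion {X ι : Type} [TopologicalSpace X] [Finite ι] {S : ι → Set X}
    (h : ∀ i, IsConstructibleSet (S i)) : IsConstructibleSet (⋃ i, S i) := by
  choose F hF hl hS using h
  refine ⟨⋃ i, F i, Set.finite_iUnion hF, fun T hT => ?_, ?_⟩
  · obtain ⟨i, hi⟩ := Set.mem_iUnion.1 hT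
    exact hl i T hi
  · rw [Set.sUnion_iUnion]
    exact Set.iUnion_congr hS

theorem isConstructibleSet_exists_mem {X : FnSpace} {Y : Set X} (hY : IsConstructibleSet Y)
    (n : ℕ) : IsConstructibleSet (X := X.symPow n) {s : Sym X n | ∃ x ∈ s, x ∈ Y} := by
  classical
  obtain ⟨F, hF, hl, rfl⟩ := hY
  have := hF.to_subtype
  have h1 : {s : Sym X n | ∃ x ∈ s, x ∈ ⋃₀ F} = ⋃ T : F, {s : Sym X n | ∃ x ∈ s, x ∈ T.1} := by
    ext s
    simp only [Set.mem_sUnion, Set.mem_ofPred_eq, Set.mem_iUnion, Subtype.exists, exists_prop]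
    exact ⟨fun ⟨x, hx, T, hT, hxT⟩ => ⟨T, hT, x, hx, hxT⟩,
      fun ⟨T, hT, x, hx, hxT⟩ => ⟨x, hx, T, hT, hxT⟩⟩
  refine (congrArg (fun S => IsConstructibleSet (X := X.symPow n) S) h1).mpr ?_
  refine isConstructibleSet_iUnion (X := X.symPow n) fun ⟨T, hT⟩ => ?_
  obtain ⟨U, Z, hU, hZ, rfl⟩ := hl T hT
  -- A tuple meets `U ∩ Z` exactly when it has more members in `Z` than in `Z \ U`. Both sets are
  -- closed, and `k` is a threshold between the two counts.
  have h2 : {s : Sym X n | ∃ x ∈ s, x ∈ U ∩ Z} = ⋃ k : Fin n,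
      {s : Sym X n | (k : ℕ) + 1 ≤ countIn Z s} ∩ {s : Sym X n | (k : ℕ) + 1 ≤ countIn (Z \ U) s}ᶜ := by
    ext s
    have h3 : countIn Z s = countIn (Z \ U) s + countIn (U ∩ Z) s := by
      obtain ⟨v, rfl⟩ := unordered_surjective s
      rw [countIn_unordered, countIn_unordered, countIn_unordered, ← Set.ncard_union_eq]
      · congr 1
        ext i
        simp only [Set.mem_ofPred_eq, Set.mem_union, Set.mem_sdiff, Set.mem_inter_iff]
        tauto
      · rw [Set.disjoint_left]
        exact fun i h h' => h.2 h'.1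
    have h4 : (∃ x ∈ s, x ∈ U ∩ Z) ↔ 0 < countIn (U ∩ Z) s := countIn_pos.symm
    have h5 := countIn_le Z s
    rw [Set.mem_ofPred_eq, h4, Set.mem_iUnion]
    constructor
    · intro h
      refine ⟨⟨countIn (Z \ U) s, by omega⟩, ?_, ?_⟩
      · exact (by omega : countIn (Z \ U) s + 1 ≤ countIn Z s)
      · exact Nat.not_succ_le_self _
    · rintro ⟨k, h, h'⟩
      change (k : ℕ) + 1 ≤ countIn Z s at h
      change ¬(k : ℕ) + 1 ≤ countIn (Z \ U) s at h'
      omega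
  refine (congrArg (fun S => IsConstructibleSet (X := X.symPow n) S) h2).mpr ?_
  refine isConstructibleSet_iUnion (X := X.symPow n) fun k => .of_isLocallyClosed ?_
  exact (isClosed_le_countIn hZ n _).isLocallyClosed.inter
    (isClosed_le_countIn (hZ.sdiff hU) n _).isOpen_compl.isLocallyClosed

theorem IsVarPair.symPow (P : SpacePair) (n : ℕ) (h : IsVarPair P) : IsVarPair (P.symPow n) :=
  ⟨h.1.symPow n, isConstructibleSet_exists_mem h.2 n⟩

/-! ### Disjoint unions -/

theorem eventually_of_sub {X : FnSpace} {U : Set X} (hU : IsOpen U) {x : X} (hx : x ∈ U)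
    {p : X → Prop} (hp : ∀ᶠ u in @nhds _ (X.sub U).top (⟨x, hx⟩ : U), p u.1) :
    ∀ᶠ y in 𝓝 x, p y := by
  have h : {u : U | p u.1} ∈ Filter.comap Subtype.val (𝓝 x) :=
    ((isEmb_val U).inducing.nhds_eq_comap (⟨x, hx⟩ : U)) ▸ hp
  obtain ⟨N, hN, hNp⟩ := Filter.mem_comap.1 h
  filter_upwards [hN, hU.mem_nhds hx] with y h1 h2
  exact @hNp (⟨y, h2⟩ : U) h1

theorem isMorphism_of_local {X Y : FnSpace} {φ : X → Y}
    (h : ∀ x, ∃ U : Set X, IsOpen U ∧ x ∈ U ∧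
      IsMorphism (X := X.sub U) (Y := Y) fun u : U => φ u.1) : IsMorphism φ := by
  refine ⟨continuous_iff_continuousAt.2 fun x => ?_, fun g x hg => ?_⟩
  · obtain ⟨U, hU, hx, h1, -⟩ := h x
    intro N hN
    exact eventually_of_sub hU hx
      ((h1.continuousAt (X := X.sub U) (x := (⟨x, hx⟩ : U))).eventually hN)
  · obtain ⟨U, hU, hx, -, h1⟩ := h x
    obtain ⟨f, hf, hgf⟩ := (isEmb_val U).exists_regAt (h1 g (⟨x, hx⟩ : U) hg)
    have h2 : ∀ᶠ y in 𝓝 x, f y = (g ∘ φ) y :=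
      eventually_of_sub hU hx (hgf.mono fun u hu => hu.symm)
    exact X.congr h2 hf

theorem isMorphism_inl (X Y : FnSpace) : IsMorphism (X := X) (Y := X.sum Y) Sum.inl :=
  final_incl (T := X ⊕ Y) (fun b : Bool => match b with | false => X | true => Y)
    (fun b => match b with | false => Sum.inl | true => Sum.inr) false

theorem isMorphism_inr (X Y : FnSpace) : IsMorphism (X := Y) (Y := X.sum Y) Sum.inr :=
  final_incl (T := X ⊕ Y) (fun b : Bool => match b with | false => X | true => Y)
    (fun b => match b with | false => Sum.inl | true => Sum.inr) true

theorem sum_lift {X Y W : FnSpace} {φ : X ⊕ Y → W}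
    (h1 : IsMorphism (X := X) (Y := W) fun x => φ (Sum.inl x))
    (h2 : IsMorphism (X := Y) (Y := W) fun y => φ (Sum.inr y)) :
    IsMorphism (X := X.sum Y) (Y := W) φ :=
  final_lift (T := X ⊕ Y) (X := fun b : Bool => match b with | false => X | true => Y)
    (q := fun b => match b with | false => Sum.inl | true => Sum.inr)
    (fun b => match b with | false => h1 | true => h2)

theorem sum_isOpen {X Y : FnSpace} {U : Set (X ⊕ Y)} (h1 : IsOpen (Sum.inl ⁻¹' U))
    (h2 : IsOpen (Sum.inr ⁻¹' U)) : IsOpen (X := X.sum Y) U :=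
  final_isOpen (T := X ⊕ Y) (X := fun b : Bool => match b with | false => X | true => Y)
    (q := fun b => match b with | false => Sum.inl | true => Sum.inr)
    (fun b => match b with | false => h1 | true => h2)

/-! ### Quasi-projectivity of disjoint unions. -/

theorem isClosed_singleton_proj {N : ℕ} (p : ProjPt N) :
    IsClosed (X := projSpace N) {p} := by
  have h : ({p} : Set (ProjPt N)) = ⋂ i, ⋂ j, {z | z.rep i * p.rep j - z.rep j * p.rep i = 0} := by
    ext z
    simp only [Set.mem_singleton_iff, Set.mem_iInter, Set.mem_ofPred_eq]
    constructor
    · rintro rfl i j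
      ring
    · intro h
      obtain ⟨j, hj⟩ := exists_coord_ne p
      refine proj_ext (c := z.rep j / p.rep j) fun i => ?_
      have := h i j
      field_simp
      linear_combination this
  refine (congrArg (fun S => IsClosed (X := projSpace N) S) h).mpr ?_
  refine isClosed_iInter fun i => isClosed_iInter fun j => ⟨?_⟩
  refine TopologicalSpace.isOpen_generateFrom_of_mem ⟨1,
    MvPolynomial.X i * MvPolynomial.C (p.rep j) - MvPolynomial.X j * MvPolynomial.C (p.rep i),
    ?_, ?_⟩
  · exact ((MvPolynomial.isHomogeneous_X _ _).mul (MvPolynomial.isHomogeneous_C _ _)).sub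
      ((MvPolynomial.isHomogeneous_X _ _).mul (MvPolynomial.isHomogeneous_C _ _))
  · ext z
    simp only [map_sub, map_mul, MvPolynomial.eval_X, MvPolynomial.eval_C]
    rfl

/-- A point of projective space. -/
def basePoint (N : ℕ) : ProjPt N :=
  Projectivization.mk ℂ (fun _ => 1) (Function.ne_iff.2 ⟨0, one_ne_zero⟩)

theorem exists_ne_projLine : ∃ p q : ProjPt 1, p ≠ q := by
  refine ⟨basePoint 1, Projectivization.mk ℂ ![1, 0] (Function.ne_iff.2 ⟨0, by simp⟩), ?_⟩
  rw [Ne, basePoint, Projectivization.mk_eq_mk_iff']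
  rintro ⟨a, ha⟩
  simpa using congrFun ha 1

theorem IsLocallyClosed.union_of_disjoint {X : Type} [TopologicalSpace X] {S T C D : Set X}
    (hS : IsLocallyClosed S) (hT : IsLocallyClosed T) (hC : IsClosed C) (hD : IsClosed D)
    (hSC : S ⊆ C) (hTD : T ⊆ D) (hCD : Disjoint C D) : IsLocallyClosed (S ∪ T) := by
  obtain ⟨U, Z, hU, hZ, rfl⟩ := hS
  obtain ⟨U', Z', hU', hZ', rfl⟩ := hT
  refine ⟨(U ∩ Dᶜ) ∪ (U' ∩ Cᶜ), (Z ∩ C) ∪ (Z' ∩ D),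
    (hU.inter hD.isOpen_compl).union (hU'.inter hC.isOpen_compl),
    (hZ.inter hC).union (hZ'.inter hD), ?_⟩
  ext x
  have h1 := @hSC x
  have h2 := @hTD x
  have h3 : x ∈ C → x ∉ D := fun h h' => Set.disjoint_left.1 hCD h h'
  simp only [Set.mem_union, Set.mem_inter_iff, Set.mem_compl_iff] at *
  tauto

theorem IsMorphism.congr {X Y : FnSpace} {φ ψ : X → Y} (hφ : IsMorphism φ)
    (h : ∀ x, φ x = ψ x) : IsMorphism ψ :=
  (funext h : φ = ψ) ▸ hφ

/-- A map into the disjoint union is tested on the preimages of `U` and `V`, where it factors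
through a single summand. -/
theorem IsEmb.sumElim {X Y T : FnSpace} {φ : X → T} {χ : Y → T} (hφ : IsEmb φ) (hχ : IsEmb χ)
    {U V : Set T} (hU : IsOpen U) (hV : IsOpen V) (h1 : ∀ x, φ x ∈ U) (h2 : ∀ y, χ y ∉ U)
    (h3 : ∀ x, φ x ∉ V) (h4 : ∀ y, χ y ∈ V) :
    IsEmb (X := X.sum Y) (Y := T) (Sum.elim φ χ : X ⊕ Y → T) := by
  have hm : IsMorphism (X := X.sum Y) (Y := T) (Sum.elim φ χ : X ⊕ Y → T) :=
    sum_lift hφ.2.1 hχ.2.1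
  refine ⟨Function.Injective.sumElim hφ.1 hχ.1 fun x y h => h2 y (h ▸ h1 x), hm, fun W ψ hψ => ?_⟩
  refine isMorphism_of_local fun w => ?_
  obtain ⟨x, hx⟩ | ⟨y, hy⟩ : (∃ x : X, (ψ w : X ⊕ Y) = Sum.inl x) ∨
      ∃ y : Y, (ψ w : X ⊕ Y) = Sum.inr y := by
    rcases (ψ w : X ⊕ Y) with x | y
    exacts [Or.inl ⟨x, rfl⟩, Or.inr ⟨y, rfl⟩]
  · refine ⟨_, hU.preimage hψ.1, ?_, ?_⟩
    · change Sum.elim φ χ (ψ w) ∈ U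
      exact (congrArg (fun z => Sum.elim φ χ z ∈ U) hx).mpr (h1 x)
    · have h5 : ∀ v : (fun w => (Sum.elim φ χ : X ⊕ Y → T) (ψ w)) ⁻¹' U,
          ∃ x : X, (ψ v.1 : X ⊕ Y) = Sum.inl x := by
        rintro ⟨v, hv⟩
        change Sum.elim φ χ (ψ v) ∈ U at hv
        revert hv
        change _ → ∃ x : X, (ψ v : X ⊕ Y) = Sum.inl x
        rcases (ψ v : X ⊕ Y) with x | y
        exacts [fun _ => ⟨x, rfl⟩, fun h => absurd h (h2 y)]
      choose θ hθ using h5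
      have h6 : IsMorphism (X := W.sub _) (Y := X) θ := by
        refine hφ.2.2 _ _ ?_
        exact (hψ.comp (sub_val _)).congr fun v => congrArg (Sum.elim φ χ) (hθ v)
      exact ((isMorphism_inl X Y).comp h6).congr fun v => (hθ v).symm
  · refine ⟨_, hV.preimage hψ.1, ?_, ?_⟩
    · change Sum.elim φ χ (ψ w) ∈ V
      exact (congrArg (fun z => Sum.elim φ χ z ∈ V) hy).mpr (h4 y)
    · have h5 : ∀ v : (fun w => (Sum.elim φ χ : X ⊕ Y → T) (ψ w)) ⁻¹' V,
          ∃ y : Y, (ψ v.1 : X ⊕ Y) = Sum.inr y := by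
        rintro ⟨v, hv⟩
        change Sum.elim φ χ (ψ v) ∈ V at hv
        revert hv
        change _ → ∃ y : Y, (ψ v : X ⊕ Y) = Sum.inr y
        rcases (ψ v : X ⊕ Y) with x | y
        exacts [fun h => absurd h (h3 x), fun _ => ⟨y, rfl⟩]
      choose θ hθ using h5
      have h6 : IsMorphism (X := W.sub _) (Y := Y) θ := by
        refine hχ.2.2 _ _ ?_
        exact (hψ.comp (sub_val _)).congr fun v => congrArg (Sum.elim φ χ) (hθ v)
      exact ((isMorphism_inr X Y).comp h6).congr fun v => (hθ v).symm

theorem IsEmb.prodMk_const {X Y : FnSpace} {φ : X → Y} (h : IsEmb φ) {Z : FnSpace} (z : Z) :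
    IsEmb (X := X) (Y := Y.prod Z) fun x => (φ x, z) :=
  ⟨fun _ _ hxy => h.1 (congrArg Prod.fst hxy), prod_lift h.2.1 (isMorphism_const z),
    fun W _ hψ => h.2.2 W _ ((prod_fst Y Z).comp hψ)⟩

theorem IsEmb.const_prodMk {X Y : FnSpace} {φ : X → Y} (h : IsEmb φ) {Z : FnSpace} (z : Z) :
    IsEmb (X := X) (Y := Z.prod Y) fun x => (z, φ x) :=
  ⟨fun _ _ hxy => h.1 (congrArg Prod.snd hxy), prod_lift (isMorphism_const z) h.2.1,
    fun W _ hψ => h.2.2 W _ ((prod_snd Z Y).comp hψ)⟩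

theorem isQuasiProjective_projSpace (N : ℕ) : IsQuasiProjective (projSpace N) :=
  isQuasiProjective_iff.2 ⟨N, fun x => x, ⟨fun _ _ h => h, IsMorphism.id _, fun _ _ h => h⟩,
    (congrArg (fun S => IsLocallyClosed (X := projSpace N) S) Set.range_id).mpr
      isOpen_univ.isLocallyClosed⟩

theorem IsQuasiProjective.of_isEmb {X T : FnSpace} (hT : IsQuasiProjective T) {φ : X → T}
    (h : IsEmb φ) (hr : IsLocallyClosed (Set.range φ)) : IsQuasiProjective X := by
  obtain ⟨e⟩ := h.iso_range
  obtain ⟨N, W, hW, ⟨f⟩⟩ := hT.sub hr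
  exact ⟨N, W, hW, ⟨e.trans f⟩⟩

theorem isLocallyClosed_prod {X Y : FnSpace} {S : Set X} {T : Set Y} (hS : IsLocallyClosed S)
    (hT : IsLocallyClosed T) : IsLocallyClosed (X := X.prod Y) (S ×ˢ T) :=
  (hS.preimage (prod_fst X Y).1).inter (hT.preimage (prod_snd X Y).1)

/-- The two varieties are placed over two distinct points `p`, `q` of a projective line, inside
disjoint closed fibres of a product of three projective spaces. -/
theorem IsQuasiProjective.sum {X Y : FnSpace} (hX : IsQuasiProjective X)
    (hY : IsQuasiProjective Y) : IsQuasiProjective (X.sum Y) := by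
  obtain ⟨N, φ, hφ, hr⟩ := isQuasiProjective_iff.1 hX
  obtain ⟨M, χ, hχ, hs⟩ := isQuasiProjective_iff.1 hY
  obtain ⟨p, q, hpq⟩ := exists_ne_projLine
  let T := ((projSpace N).prod (projSpace M)).prod (projSpace 1)
  have hT : IsQuasiProjective T := ((isQuasiProjective_projSpace N).prod
    (isQuasiProjective_projSpace M)).prod (isQuasiProjective_projSpace 1)
  have hc (z : ProjPt 1) : IsClosed (X := T) {t : (ProjPt N × ProjPt M) × ProjPt 1 | t.2 = z} :=
    (isClosed_singleton_proj z).preimage (prod_snd ((projSpace N).prod (projSpace M)) _).1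
  have h1 : IsEmb (X := X) (Y := T) fun x => ((φ x, basePoint M), p) :=
    (hφ.prodMk_const (Z := projSpace M) (basePoint M)).prodMk_const (Z := projSpace 1) p
  have h2 : IsEmb (X := Y) (Y := T) fun y => ((basePoint N, χ y), q) :=
    (hχ.const_prodMk (Z := projSpace N) (basePoint N)).prodMk_const (Z := projSpace 1) q
  have h3 := h1.sumElim h2 (hc q).isOpen_compl (hc p).isOpen_compl (fun _ => hpq)
    (fun _ h => h rfl) (fun _ h => h rfl) (fun _ => hpq.symm)
  refine hT.of_isEmb h3 ?_
  have h4 : Set.range (Sum.elim (fun x => ((φ x, basePoint M), p))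
      (fun y => ((basePoint N, χ y), q)) : X ⊕ Y → (ProjPt N × ProjPt M) × ProjPt 1) =
      ((Set.range φ ×ˢ {basePoint M}) ×ˢ {p}) ∪ (({basePoint N} ×ˢ Set.range χ) ×ˢ {q}) := by
    rw [Set.Sum.elim_range]
    congr 1
    · ext t
      constructor
      · rintro ⟨x, rfl⟩
        exact ⟨⟨⟨x, rfl⟩, rfl⟩, rfl⟩
      · obtain ⟨⟨a, b⟩, c⟩ := t
        rintro ⟨⟨⟨x, rfl⟩, rfl⟩, rfl⟩
        exact ⟨x, rfl⟩
    · ext t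
      constructor
      · rintro ⟨y, rfl⟩
        exact ⟨⟨rfl, ⟨y, rfl⟩⟩, rfl⟩
      · obtain ⟨⟨a, b⟩, c⟩ := t
        rintro ⟨⟨rfl, ⟨y, rfl⟩⟩, rfl⟩
        exact ⟨y, rfl⟩
  refine (congrArg (fun S => IsLocallyClosed (X := T) S) h4).mpr ?_
  refine IsLocallyClosed.union_of_disjoint (X := T) ?_ ?_ (hc p) (hc q) ?_ ?_ ?_
  · exact isLocallyClosed_prod (isLocallyClosed_prod hr
      (isClosed_singleton_proj _).isLocallyClosed) (isClosed_singleton_proj _).isLocallyClosed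
  · exact isLocallyClosed_prod (isLocallyClosed_prod
      (isClosed_singleton_proj _).isLocallyClosed hs) (isClosed_singleton_proj _).isLocallyClosed
  · exact fun t ht => ht.2
  · exact fun t ht => ht.2
  · exact Set.disjoint_left.2 fun t (h : t.2 = p) (h' : t.2 = q) => hpq (h.symm.trans h')

theorem IsConstructibleSet.image_of_isOpenMap {X Y : Type} [TopologicalSpace X]
    [TopologicalSpace Y] {f : X → Y} (hf : IsOpenMap f) (hi : Function.Injective f) {S : Set X}
    (hS : IsConstructibleSet S) : IsConstructibleSet (f '' S) := by
  obtain ⟨F, hF, hl, rfl⟩ := hS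
  refine ⟨Set.image f '' F, hF.image _, ?_, ?_⟩
  · rintro _ ⟨T, hT, rfl⟩
    obtain ⟨U, Z, hU, hZ, rfl⟩ := hl T hT
    -- The image of `Z` need not be closed, but by injectivity `f '' (U ∩ Z)` is `f '' U` minus the
    -- open set `f '' Zᶜ`.
    refine ⟨f '' U, (f '' Zᶜ)ᶜ, hf _ hU, (hf _ hZ.isOpen_compl).isClosed_compl, ?_⟩
    ext y
    constructor
    · rintro ⟨x, ⟨h1, h2⟩, rfl⟩
      exact ⟨⟨x, h1, rfl⟩, fun ⟨x', h3, h4⟩ => h3 (hi h4 ▸ h2)⟩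
    · rintro ⟨⟨x, h1, rfl⟩, h2⟩
      exact ⟨x, ⟨h1, by_contra fun h => h2 ⟨x, h, rfl⟩⟩, rfl⟩
  · rw [Set.image_sUnion]

theorem isOpenMap_inl (X Y : FnSpace) : IsOpenMap (X := X) (Y := X.sum Y) Sum.inl := by
  refine fun U hU => sum_isOpen ?_ ?_
  · exact (congrArg (fun S => IsOpen (X := X) S)
      (Set.preimage_image_eq U (Sum.inl_injective (β := Y)))).mpr hU
  · refine (congrArg (fun S => IsOpen (X := Y) S) (?_ : _ = ∅)).mpr isOpen_empty
    exact Set.preimage_inr_image_inl U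

theorem isOpenMap_inr (X Y : FnSpace) : IsOpenMap (X := Y) (Y := X.sum Y) Sum.inr := by
  refine fun U hU => sum_isOpen ?_ ?_
  · refine (congrArg (fun S => IsOpen (X := X) S) (?_ : _ = ∅)).mpr isOpen_empty
    exact Set.preimage_inl_image_inr U
  · exact (congrArg (fun S => IsOpen (X := Y) S)
      (Set.preimage_image_eq U (Sum.inr_injective (α := X)))).mpr hU

theorem IsVarPair.sum (P Q : SpacePair) (hP : IsVarPair P) (hQ : IsVarPair Q) :
    IsVarPair (P.sum Q) :=
  ⟨hP.1.sum hQ.1, (hP.2.image_of_isOpenMap (isOpenMap_inl _ _) Sum.inl_injective).union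
    (hQ.2.image_of_isOpenMap (isOpenMap_inr _ _) Sum.inr_injective)⟩
/-! ### Isomorphisms of pairs -/

theorem SpacePair.iso_of_isEmb {A P : SpacePair} {φ : A.amb → P.amb} (h : IsEmb φ)
    (hs : Function.Surjective φ) (hm : ∀ a, φ a ∈ P.subv ↔ a ∈ A.subv) : Nonempty (A.Iso P) := by
  refine ⟨⟨⟨Equiv.ofBijective φ ⟨h.1, hs⟩, h.2.1, h.2.2 P.amb _ ?_⟩, hm⟩⟩
  exact (IsMorphism.id P.amb).congr fun x =>
    ((Equiv.ofBijective φ ⟨h.1, hs⟩).apply_symm_apply x).symm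

theorem SpacePair.iso_restrict_of_isEmb {A P : SpacePair} {φ : A.amb → P.amb} (h : IsEmb φ)
    (hm : ∀ a, φ a ∈ P.subv ↔ a ∈ A.subv) {S : Set P.amb} (hS : Set.range φ = S) :
    Nonempty (A.Iso (P.restrict S)) := by
  have hφ (a : A.amb) : φ a ∈ S := hS ▸ Set.mem_range_self a
  refine iso_of_isEmb (P := P.restrict S) (φ := fun a => (⟨φ a, hφ a⟩ : S)) ⟨?_, ?_, ?_⟩ ?_ hm
  · exact fun a b hab => h.1 (congrArg Subtype.val hab)
  · exact sub_lift h.2.1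
  · exact fun W ψ hψ => h.2.2 W ψ ((sub_val S).comp hψ)
  · rintro ⟨x, hx⟩
    obtain ⟨a, rfl⟩ : x ∈ Set.range φ := hS ▸ hx
    exact ⟨a, rfl⟩

theorem SpacePair.restrict_univ_iso (P : SpacePair) : Nonempty ((P.restrict Set.univ).Iso P) :=
  iso_of_isEmb (isEmb_val (X := P.amb) Set.univ) (fun x => ⟨(⟨x, trivial⟩ : Set.univ), rfl⟩)
    fun _ => Iff.rfl

theorem SpacePair.restrict_restrict_iso (P : SpacePair) (S T : Set P.amb) {R : Set P.amb}
    (h : S ∩ T = R) : Nonempty (((P.restrict S).restrict ((Subtype.val : S → P.amb) ⁻¹' T)).Iso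
      (P.restrict R)) := by
  refine iso_restrict_of_isEmb (A := (P.restrict S).restrict ((Subtype.val : S → P.amb) ⁻¹' T))
    (φ := fun x : ((Subtype.val : S → P.amb) ⁻¹' T) => x.1.1)
    ((isEmb_val S).comp (isEmb_val (X := P.amb.sub S) _)) (fun _ => Iff.rfl) ?_
  rw [← h]
  ext x
  constructor
  · rintro ⟨y, rfl⟩
    exact ⟨y.1.2, y.2⟩
  · rintro ⟨h1, h2⟩
    exact ⟨(⟨⟨x, h1⟩, h2⟩ : ((Subtype.val : S → P.amb) ⁻¹' T)), rfl⟩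

theorem SpacePair.restrict_iso {P Q : SpacePair} (e : P.Iso Q) {S : Set P.amb} {T : Set Q.amb}
    (h : e.toEquiv '' S = T) : Nonempty ((P.restrict S).Iso (Q.restrict T)) := by
  refine iso_restrict_of_isEmb (A := P.restrict S) (φ := fun x : S => e.toEquiv x.1)
    (e.toIso.isEmb.comp (isEmb_val S)) (fun x => e.mem_iff x.1) ?_
  rw [← h]
  ext y
  simp only [Set.mem_image]
  exact ⟨fun ⟨x, hx⟩ => ⟨x.1, x.2, hx⟩, fun ⟨x, hx, h⟩ => ⟨(⟨x, hx⟩ : S), h⟩⟩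

/-! ### Decomposition of the class of a pair into level sets -/

/-- Both pieces of a decomposition of an empty pair are isomorphic to it, so `[P] = [P] + [P]`. -/
theorem Groth.cls_eq_zero {C : SpacePair → Prop} {P : SpacePair} (hP : C P) (h : IsEmpty P.amb)
    (hA : C (P.restrict ∅)) (hB : C (P.restrict ∅ᶜ)) : (Groth.cls P hP : Groth C) = 0 := by
  have h1 (S : Set P.amb) : Nonempty ((P.restrict S).Iso P) :=
    SpacePair.iso_of_isEmb (isEmb_val (X := P.amb) S) (fun x => h.elim x) fun _ => Iff.rfl
  have h2 := Groth.cls_scissor hP isClosed_empty hA hB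
  rwa [Groth.cls_iso hA hP (h1 _).some, Groth.cls_iso hB hP (h1 _).some, left_eq_add] at h2

theorem isLocallyClosed_level {X : Type} [TopologicalSpace X] {f : X → ℕ}
    (hf : ∀ k, IsClosed {x | k ≤ f x}) (s : ℕ) : IsLocallyClosed {x | f x = s} := by
  have h : {x | f x = s} = {x | s ≤ f x} ∩ {x | s + 1 ≤ f x}ᶜ := by
    ext x
    simp only [Set.mem_ofPred_eq, Set.mem_inter_iff, Set.mem_compl_iff]
    omega
  exact h ▸ (hf s).isLocallyClosed.inter (hf (s + 1)).isOpen_compl.isLocallyClosed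

/-- The closed superlevel sets are peeled off one at a time. Stating it for any class stable under
locally closed restriction serves both Grothendieck groups. -/
theorem cls_eq_sum_levels {C : SpacePair → Prop}
    (hC : ∀ {P : SpacePair}, C P → ∀ {S : Set P.amb}, IsLocallyClosed S → C (P.restrict S))
    {P : SpacePair} (hP : C P) {f : P.amb → ℕ}
    (hf : ∀ k, IsClosed {x | k ≤ f x}) {n : ℕ} (hn : ∀ x, f x ≤ n) :
    (Groth.cls P hP : Groth C) = ∑ s ∈ Finset.range (n + 1),
      Groth.cls (P.restrict {x | f x = s}) (hC hP (isLocallyClosed_level hf s)) := by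
  have key (k : ℕ) : (Groth.cls P hP : Groth C) = ∑ s ∈ Finset.range k,
      Groth.cls (P.restrict {x | f x = s}) (hC hP (isLocallyClosed_level hf s)) +
        Groth.cls (P.restrict {x | k ≤ f x}) (hC hP (hf k).isLocallyClosed) := by
    induction k with
    | zero =>
      rw [Finset.sum_range_zero, zero_add]
      refine (Groth.cls_iso _ _ ?_).symm
      have h : {x | 0 ≤ f x} = Set.univ := Set.eq_univ_of_forall fun x => Nat.zero_le _
      rw [h]
      exact P.restrict_univ_iso.some
    | succ k ih =>
      rw [ih, Finset.sum_range_succ, add_assoc]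
      congr 1
      have hZ := (hf (k + 1)).preimage (sub_val {x | k ≤ f x}).1
      rw [Groth.cls_scissor _ hZ (hC (hC hP (hf k).isLocallyClosed) hZ.isLocallyClosed)
        (hC (hC hP (hf k).isLocallyClosed) hZ.isOpen_compl.isLocallyClosed), add_comm]
      congr 1
      · refine Groth.cls_iso _ _ (P.restrict_restrict_iso _ {x | k + 1 ≤ f x}ᶜ ?_).some
        ext x
        simp only [Set.mem_ofPred_eq, Set.mem_inter_iff, Set.mem_compl_iff]
        omega
      · refine Groth.cls_iso _ _ (P.restrict_restrict_iso _ {x | k + 1 ≤ f x} ?_).some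
        ext x
        simp only [Set.mem_ofPred_eq, Set.mem_inter_iff]
        omega
  rw [key (n + 1), add_eq_left]
  refine Groth.cls_eq_zero _ ⟨fun x : {x | n + 1 ≤ f x} => ?_⟩
    (hC (hC hP (hf _).isLocallyClosed) isClosed_empty.isLocallyClosed)
    (hC (hC hP (hf _).isLocallyClosed) isClosed_empty.isOpen_compl.isLocallyClosed)
  have h1 : n + 1 ≤ f x.1 := x.2
  have := hn x.1
  omega

/-! ### The level sets of symmetric products -/

theorem countIn_joinSym {A B X : Type} {s m n : ℕ} (h : s + m = n) {α : A → X} {β : B → X}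
    (hd : ∀ b, β b ∉ Set.range α) (a : Sym A s) (b : Sym B m) :
    countIn (Set.range α) (joinSym h α β a b) = s := by
  classical
  change Multiset.countP (· ∈ Set.range α) ((a : Multiset A).map α + (b : Multiset B).map β) = s
  rw [Multiset.countP_add, Multiset.countP_eq_card.2, Multiset.countP_eq_zero.2, add_zero,
    Multiset.card_map]
  · exact a.2
  · intro x hx
    obtain ⟨y, -, rfl⟩ := Multiset.mem_map.1 hx
    exact hd y
  · intro x hx
    obtain ⟨y, -, rfl⟩ := Multiset.mem_map.1 hx
    exact ⟨y, rfl⟩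

theorem range_joinSym {A B X : Type} {s m n : ℕ} (h : s + m = n) {α : A → X} {β : B → X}
    (hd : Set.range β = (Set.range α)ᶜ) :
    Set.range (fun p : Sym A s × Sym B m => joinSym h α β p.1 p.2) =
      {t | countIn (Set.range α) t = s} := by
  classical
  ext t
  constructor
  · rintro ⟨p, rfl⟩
    exact countIn_joinSym h (fun b hb => (hd ▸ Set.mem_range_self b : β b ∈ (Set.range α)ᶜ) hb) _ _
  · intro ht
    have h1 : ((t : Multiset X).filter (· ∈ Set.range α)).card = s :=
      (Multiset.countP_eq_card_filter _ _).symm.trans ht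
    have h2 := Multiset.filter_add_not (· ∈ Set.range α) (t : Multiset X)
    have h3 : ((t : Multiset X).filter (· ∉ Set.range α)).card = m := by
      have := congrArg Multiset.card h2
      rw [Multiset.card_add, h1] at this
      have h4 : (t : Multiset X).card = n := t.2
      omega
    obtain ⟨a, ha⟩ : ⟨_, h1⟩ ∈ Set.range (symMap α : Sym A s → Sym X s) := by
      rw [range_symMap]
      exact fun y hy => (Multiset.mem_filter.1 hy).2
    obtain ⟨b, hb⟩ : ⟨_, h3⟩ ∈ Set.range (symMap β : Sym B m → Sym X m) := by
      rw [range_symMap]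
      exact fun y hy => hd ▸ (Multiset.mem_filter.1 hy).2
    refine ⟨(a, b), Subtype.ext ?_⟩
    exact (congrArg₂ (· + ·) (congrArg Subtype.val ha) (congrArg Subtype.val hb)).trans h2

/-- The embedding `joinSym_isEmb` applies since `Z` is its own closure, and its range is the stratum
of tuples with exactly `s` members in `Z`. -/
theorem symPow_restrict_iso {P : SpacePair} (hP : IsVarPair P) {Z : Set P.amb} (hZ : IsClosed Z)
    {s m n : ℕ} (h : s + m = n) : Nonempty ((((P.restrict Z).symPow s).prod
      ((P.restrict Zᶜ).symPow m)).Iso ((P.symPow n).restrict {t : Sym P.amb n | countIn Z t = s})) := by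
  have hr (S : Set P.amb) : Set.range (Subtype.val : S → P.amb) = S := Subtype.range_coe
  refine SpacePair.iso_restrict_of_isEmb (joinSym_isEmb hP.1.hasCharts (isEmb_val Z)
    (isEmb_val Zᶜ) (fun b => ?_) h) (fun p => ?_) ?_
  · exact (congrArg (fun S => b.1 ∉ closure S) (hr Z)).mpr (hZ.closure_eq.symm ▸ b.2)
  · change (∃ x ∈ joinSym h (Subtype.val : Z → P.amb) (Subtype.val : ↥Zᶜ → P.amb) p.1 p.2,
      x ∈ P.subv) ↔ (∃ x : Z, x ∈ (id p.1 : Sym Z s) ∧ x.1 ∈ P.subv) ∨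
        ∃ x : ↥Zᶜ, x ∈ (id p.2 : Sym ↥Zᶜ m) ∧ x.1 ∈ P.subv
    constructor
    · rintro ⟨x, hx, hxP⟩
      rcases mem_joinSym.1 hx with ⟨y, hy, rfl⟩ | ⟨y, hy, rfl⟩
      exacts [Or.inl ⟨y, hy, hxP⟩, Or.inr ⟨y, hy, hxP⟩]
    · rintro (⟨y, hy, h⟩ | ⟨y, hy, h⟩)
      exacts [⟨_, mem_joinSym.2 (Or.inl ⟨y, hy, rfl⟩), h⟩,
        ⟨_, mem_joinSym.2 (Or.inr ⟨y, hy, rfl⟩), h⟩]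
  · have h1 := range_joinSym h (α := (Subtype.val : Z → P.amb)) (β := (Subtype.val : ↥Zᶜ → P.amb))
      ((hr _).trans (congrArg _ (hr Z).symm))
    exact h1.trans (congrArg (fun S => {t : Sym P.amb n | countIn S t = s}) (hr Z))

theorem K0Pairs.cls_mul_cls {P Q : SpacePair} (hP : IsVarPair P) (hQ : IsVarPair Q) :
    (Groth.cls P hP * Groth.cls Q hQ : K0Pairs) = Groth.cls (P.prod Q) (hP.prod hQ) :=
  K0Pairs.mulHom_cls hP hQ

theorem cls_symPow_eq_sum {P : SpacePair} (hP : IsVarPair P) {Z : Set P.amb} (hZ : IsClosed Z)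
    (hA : IsVarPair (P.restrict Z)) (hB : IsVarPair (P.restrict Zᶜ)) (n : ℕ) :
    (Groth.cls (P.symPow n) (IsVarPair.symPow P n hP) : K0Pairs) = ∑ s ∈ Finset.range (n + 1),
      Groth.cls ((P.restrict Z).symPow s) (IsVarPair.symPow _ s hA) *
        Groth.cls ((P.restrict Zᶜ).symPow (n - s)) (IsVarPair.symPow _ (n - s) hB) := by
  rw [cls_eq_sum_levels IsVarPair.restrict (IsVarPair.symPow P n hP) (f := fun t : Sym P.amb n => countIn Z t)
    (isClosed_le_countIn hZ n) (countIn_le Z)]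
  refine Finset.sum_congr rfl fun s hs => ?_
  rw [K0Pairs.cls_mul_cls]
  have h : s + (n - s) = n := by
    have := Finset.mem_range.1 hs
    omega
  exact (Groth.cls_iso _ _ (symPow_restrict_iso hP hZ h).some).symm

/-! ### The Kapranov zeta function -/

theorem symPow_zero_iso (P : SpacePair) : Nonempty ((P.symPow 0).Iso SpacePair.point) := by
  refine ⟨⟨⟨⟨fun _ => (), fun _ => (unordered Fin.elim0 : Sym P.amb 0), fun s => ?_,
    fun _ => rfl⟩, initial_lift fun i => i.elim, isMorphism_const _⟩, fun s => ?_⟩⟩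
  · exact Subsingleton.elim (α := Sym P.amb 0) _ _
  · refine ⟨fun h => h.elim, ?_⟩
    rintro ⟨x, hx, -⟩
    obtain ⟨v, rfl⟩ := unordered_surjective (s : Sym P.amb 0)
    obtain ⟨i, -⟩ := mem_unordered.1 hx
    exact i.elim0

theorem symPow_one_iso (P : SpacePair) : Nonempty (P.Iso (P.symPow 1)) := by
  have h1 (v : Fin 1 → P.amb) : ordering (unordered v) 0 = v 0 := by
    obtain ⟨σ, hσ⟩ := unordered_eq_iff.1 (unordered_ordering (unordered v)).symm
    rw [hσ, Function.comp_apply, Subsingleton.elim (σ 0) 0]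
  have h2 : IsMorphism (X := P.amb.symPow 1) (Y := P.amb) fun s : Sym P.amb 1 => ordering s 0 :=
    isMorphism_of_unordered ((pow_proj P.amb 1 0).congr fun v => (h1 v).symm)
  refine SpacePair.iso_of_isEmb (φ := fun x => (unordered fun _ : Fin 1 => x : Sym P.amb 1))
    ⟨fun x y hxy => ?_, ?_, fun W ψ hψ => ?_⟩ (fun s => ?_) fun x => ?_
  · exact (h1 _).symm.trans ((congrArg (fun s : Sym P.amb 1 => ordering s 0) hxy).trans (h1 _))
  · exact (symPow_quotient P.amb 1).comp (initial_lift fun _ => IsMorphism.id P.amb)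
  · exact (h2.comp hψ).congr fun w => h1 _
  · obtain ⟨v, rfl⟩ := unordered_surjective (s : Sym P.amb 1)
    exact ⟨v 0, congrArg unordered (funext fun i => congrArg v (Subsingleton.elim 0 i))⟩
  · change (∃ y ∈ (unordered fun _ : Fin 1 => x : Sym P.amb 1), y ∈ P.subv) ↔ _
    simp [mem_unordered]

theorem symPow_iso {P Q : SpacePair} (hQ : IsVarPair Q) (e : P.Iso Q) (n : ℕ) :
    Nonempty ((P.symPow n).Iso (Q.symPow n)) := by
  refine SpacePair.iso_of_isEmb (symMap_isEmb hQ.1.hasCharts e.toIso.isEmb n) ?_ ?_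
  · refine Set.range_eq_univ.1 ((range_symMap (Y := Q.amb) e.toEquiv n).trans ?_)
    exact Set.eq_univ_of_forall fun t y _ => e.toEquiv.surjective y
  · intro (s : Sym P.amb n)
    change (∃ y ∈ symMap e.toEquiv s, y ∈ Q.subv) ↔ ∃ x ∈ s, x ∈ P.subv
    constructor
    · rintro ⟨y, hy, hyQ⟩
      obtain ⟨x, hx, rfl⟩ := Multiset.mem_map.1 hy
      exact ⟨x, hx, (e.mem_iff x).1 hyQ⟩
    · rintro ⟨x, hx, h⟩
      exact ⟨_, Multiset.mem_map_of_mem _ hx, (e.mem_iff x).2 h⟩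

theorem coeff_kapranovZeta {P : SpacePair} (hP : IsVarPair P) (n : ℕ) :
    PowerSeries.coeff n (kapranovZeta IsVarPair.symPow P hP) =
      Groth.cls (P.symPow n) (IsVarPair.symPow P n hP) := by
  unfold kapranovZeta
  cases n with
  | zero =>
    rw [Groth.cls_iso _ isVarPair_point (symPow_zero_iso P).some]
    simp
    rfl
  | succ n => simp [PowerSeries.coeff_one, PowerSeries.coeff_succ_X_mul]

theorem kapranovZeta_iso {P Q : SpacePair} (hP : IsVarPair P) (hQ : IsVarPair Q) (e : P.Iso Q) :
    kapranovZeta IsVarPair.symPow P hP = kapranovZeta IsVarPair.symPow Q hQ := by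
  ext n
  rw [coeff_kapranovZeta, coeff_kapranovZeta]
  exact Groth.cls_iso _ _ (symPow_iso hQ e n).some

theorem kapranovZeta_scissor {P : SpacePair} (hP : IsVarPair P) {Z : Set P.amb} (hZ : IsClosed Z)
    (hA : IsVarPair (P.restrict Z)) (hB : IsVarPair (P.restrict Zᶜ)) :
    kapranovZeta IsVarPair.symPow P hP = kapranovZeta IsVarPair.symPow _ hA *
      kapranovZeta IsVarPair.symPow _ hB := by
  ext n
  rw [coeff_kapranovZeta, PowerSeries.coeff_mul, cls_symPow_eq_sum hP hZ hA hB,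
    Finset.Nat.sum_antidiagonal_eq_sum_range_succ fun i j =>
      PowerSeries.coeff i (kapranovZeta IsVarPair.symPow _ hA) *
        PowerSeries.coeff j (kapranovZeta IsVarPair.symPow _ hB)]
  refine Finset.sum_congr rfl fun s _ => ?_
  rw [coeff_kapranovZeta, coeff_kapranovZeta]

/-! ### Summands of a disjoint union as closed subspaces. -/

theorem isEmb_inl (X Y : FnSpace) : IsEmb (X := X) (Y := X.sum Y) Sum.inl := by
  refine ⟨Sum.inl_injective, isMorphism_inl X Y, fun W ψ hψ => ?_⟩
  -- A retraction onto the summand must send the other summand to some point, which is available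
  -- only if `W` is nonempty.
  rcases isEmpty_or_nonempty W with hW | ⟨⟨w⟩⟩
  · exact ⟨continuous_of_const fun w => hW.elim w, fun _ w => hW.elim w⟩
  · have h : IsMorphism (X := X.sum Y) (Y := X) (Sum.elim (fun x => x) (fun _ => ψ w) : X ⊕ Y → X) :=
      sum_lift (IsMorphism.id X) (isMorphism_const _)
    exact h.comp hψ

theorem isEmb_inr (X Y : FnSpace) : IsEmb (X := Y) (Y := X.sum Y) Sum.inr := by
  refine ⟨Sum.inr_injective, isMorphism_inr X Y, fun W ψ hψ => ?_⟩
  rcases isEmpty_or_nonempty W with hW | ⟨⟨w⟩⟩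
  · exact ⟨continuous_of_const fun w => hW.elim w, fun _ w => hW.elim w⟩
  · have h : IsMorphism (X := X.sum Y) (Y := Y) (Sum.elim (fun _ => ψ w) (fun y => y) : X ⊕ Y → Y) :=
      sum_lift (isMorphism_const _) (IsMorphism.id Y)
    exact h.comp hψ

theorem isClosed_range_inl (X Y : FnSpace) :
    IsClosed (X := X.sum Y) (Set.range (Sum.inl : X → X ⊕ Y)) := by
  refine ⟨(congrArg (fun S => IsOpen (X := X.sum Y) S) (?_ : _ = Sum.inr '' (Set.univ : Set Y))).mpr
    (isOpenMap_inr X Y _ isOpen_univ)⟩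
  exact Set.compl_range_inl.trans Set.image_univ.symm

theorem isClosed_range_inr (X Y : FnSpace) :
    IsClosed (X := X.sum Y) (Set.range (Sum.inr : Y → X ⊕ Y)) := by
  refine ⟨(congrArg (fun S => IsOpen (X := X.sum Y) S) (?_ : _ = Sum.inl '' (Set.univ : Set X))).mpr
    (isOpenMap_inl X Y _ isOpen_univ)⟩
  exact Set.compl_range_inr.trans Set.image_univ.symm

theorem inl_mem_sum {P Q : SpacePair} {x : P.amb} :
    (Sum.inl x : P.amb ⊕ Q.amb) ∈ (P.sum Q).subv ↔ x ∈ P.subv := by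
  change Sum.inl x ∈ Sum.inl '' P.subv ∪ Sum.inr '' Q.subv ↔ _
  simp

theorem inr_mem_sum {P Q : SpacePair} {y : Q.amb} :
    (Sum.inr y : P.amb ⊕ Q.amb) ∈ (P.sum Q).subv ↔ y ∈ Q.subv := by
  change Sum.inr y ∈ Sum.inl '' P.subv ∪ Sum.inr '' Q.subv ↔ _
  simp

theorem kapranovZeta_sum (P Q : SpacePair) (hP : IsVarPair P) (hQ : IsVarPair Q) :
    kapranovZeta IsVarPair.symPow (P.sum Q) (IsVarPair.sum P Q hP hQ) =
      kapranovZeta IsVarPair.symPow P hP * kapranovZeta IsVarPair.symPow Q hQ := by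
  have hZ := isClosed_range_inl P.amb Q.amb
  have hA := (IsVarPair.sum P Q hP hQ).restrict hZ.isLocallyClosed
  have hB := (IsVarPair.sum P Q hP hQ).restrict hZ.isOpen_compl.isLocallyClosed
  obtain ⟨e⟩ := SpacePair.iso_restrict_of_isEmb (P := P.sum Q) (isEmb_inl P.amb Q.amb)
    (fun _ => inl_mem_sum) rfl
  obtain ⟨f⟩ := SpacePair.iso_restrict_of_isEmb (P := P.sum Q) (isEmb_inr P.amb Q.amb)
    (fun _ => inr_mem_sum) Set.compl_range_inl.symm
  exact (kapranovZeta_scissor (IsVarPair.sum P Q hP hQ) hZ hA hB).trans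
    (congrArg₂ _ (kapranovZeta_iso hP hA e) (kapranovZeta_iso hQ hB f)).symm

/-! ### The `λ`-structure -/

/-- Additive lifting to a group with negatives requires the zeta functions to be invertible. -/
theorem isUnit_kapranovZeta {P : SpacePair} (hP : IsVarPair P) :
    IsUnit (kapranovZeta IsVarPair.symPow P hP) := by
  rw [PowerSeries.isUnit_iff_constantCoeff]
  simp [kapranovZeta]

/-- The group homomorphism extending the Kapranov zeta function. -/
def zetaHom : K0Pairs →+ Additive (PowerSeries K0Pairs)ˣ :=
  Groth.lift (fun _ hP => Additive.ofMul (isUnit_kapranovZeta hP).unit)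
    (fun _ _ hP hQ ⟨e⟩ => congrArg Additive.ofMul (Units.ext (kapranovZeta_iso hP hQ e)))
    (fun _ hP _ hA hB hZ => congrArg Additive.ofMul (Units.ext (kapranovZeta_scissor hP hZ hA hB)))

theorem zetaHom_cls {P : SpacePair} (hP : IsVarPair P) :
    ((zetaHom (Groth.cls P hP)).toMul : PowerSeries K0Pairs) =
      kapranovZeta IsVarPair.symPow P hP := by
  unfold zetaHom
  rw [Groth.lift_cls]
  rfl

theorem coeff_one_mul_of_coeff_zero {R : Type*} [CommRing R] {a b : PowerSeries R}
    (ha : PowerSeries.coeff 0 a = 1) (hb : PowerSeries.coeff 0 b = 1) :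
    PowerSeries.coeff 0 (a * b) = 1 ∧
      PowerSeries.coeff 1 (a * b) = PowerSeries.coeff 1 a + PowerSeries.coeff 1 b := by
  constructor
  · simp only [PowerSeries.coeff_zero_eq_constantCoeff, map_mul] at *
    rw [ha, hb, one_mul]
  · rw [PowerSeries.coeff_mul, Finset.Nat.sum_antidiagonal_eq_sum_range_succ fun i j =>
      PowerSeries.coeff i a * PowerSeries.coeff j b]
    simp [Finset.sum_range_succ, ha, hb, add_comm]

theorem coeff_zetaHom (a : K0Pairs) :
    PowerSeries.coeff 0 ((zetaHom a).toMul : PowerSeries K0Pairs) = 1 ∧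
      PowerSeries.coeff 1 ((zetaHom a).toMul : PowerSeries K0Pairs) = a := by
  induction a using Groth.induction with
  | cls P hP =>
    rw [zetaHom_cls]
    refine ⟨by simp [kapranovZeta], ?_⟩
    rw [coeff_kapranovZeta]
    exact (Groth.cls_iso _ _ (symPow_one_iso P).some).symm
  | zero => simp
  | add x y hx hy =>
    rw [map_add]
    have := coeff_one_mul_of_coeff_zero hx.1 hy.1
    rwa [hx.2, hy.2] at this
  | neg x hx =>
    have h : ((zetaHom (-x)).toMul : PowerSeries K0Pairs) * (zetaHom x).toMul = 1 := by
      rw [map_neg]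
      exact Units.inv_mul _
    have h0 : PowerSeries.coeff 0 ((zetaHom (-x)).toMul : PowerSeries K0Pairs) = 1 := by
      have := congrArg (PowerSeries.coeff 0) h
      rw [PowerSeries.coeff_zero_eq_constantCoeff, map_mul, map_one] at this
      rwa [← PowerSeries.coeff_zero_eq_constantCoeff, hx.1, mul_one] at this
    refine ⟨h0, ?_⟩
    have := (coeff_one_mul_of_coeff_zero h0 hx.1).2
    rw [h, hx.2, PowerSeries.coeff_one, if_neg one_ne_zero] at this
    exact eq_neg_of_add_eq_zero_left this.symm

/-- The pre-`λ`-structure given by the Kapranov zeta function. -/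
def kapranovLambda : LambdaStructure K0Pairs where
  series a := (zetaHom a).toMul
  coeff_zero a := (coeff_zetaHom a).1
  coeff_one a := (coeff_zetaHom a).2
  series_add a b := by rw [map_add]; rfl

theorem LambdaStructure.ext_series {R : Type*} [CommRing R] {L M : LambdaStructure R}
    (h : ∀ a, L.series a = M.series a) : L = M := by
  obtain ⟨f, _, _, _⟩ := L
  obtain ⟨g, _, _, _⟩ := M
  obtain rfl : f = g := funext h
  rfl

/-- The series of `0` is idempotent and, having constant term `1`, invertible. -/
theorem LambdaStructure.series_zero {R : Type*} [CommRing R] (L : LambdaStructure R) :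
    L.series 0 = 1 := by
  have hu : IsUnit (L.series 0) := by
    rw [PowerSeries.isUnit_iff_constantCoeff, ← PowerSeries.coeff_zero_eq_constantCoeff_apply,
      L.coeff_zero]
    exact isUnit_one
  have h := L.series_add 0 0
  rw [add_zero] at h
  exact hu.mul_left_cancel (by rw [← h, mul_one])

theorem existsUnique_lambdaStructure : ∃! L : LambdaStructure K0Pairs,
    ∀ (P : SpacePair) (hP : IsVarPair P),
      L.series (Groth.cls P hP) = kapranovZeta IsVarPair.symPow P hP := by
  refine ⟨kapranovLambda, fun P hP => zetaHom_cls hP, fun L hL => ?_⟩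
  refine LambdaStructure.ext_series fun a => ?_
  induction a using Groth.induction with
  | cls P hP => exact (hL P hP).trans (zetaHom_cls hP).symm
  | zero => rw [LambdaStructure.series_zero, LambdaStructure.series_zero]
  | add x y hx hy => rw [LambdaStructure.series_add, LambdaStructure.series_add, hx, hy]
  | neg x hx =>
    have h (M : LambdaStructure K0Pairs) : M.series x * M.series (-x) = 1 := by
      rw [← M.series_add, add_neg_cancel, M.series_zero]
    have h1 := h L
    rw [hx] at h1
    have hu : IsUnit (kapranovLambda.series x) := IsUnit.of_mul_eq_one _ h1
    exact hu.mul_left_cancel (h1.trans (h kapranovLambda).symm)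

/-! ### Symmetric products of disjoint unions -/

theorem joinTuples_eq_joinSym {X Y : Type} {n : ℕ} (s : Fin (n + 1)) (a : Sym X s)
    (b : Sym Y (n - s)) : joinTuples s a b =
      joinSym (Nat.add_sub_cancel' (Nat.lt_succ_iff.1 s.2)) Sum.inl Sum.inr a b :=
  rfl

theorem joinTuples_bijective (X Y : Type) (n : ℕ) : Function.Bijective
    fun p : Σ s : Fin (n + 1), Sym X s × Sym Y (n - s) => joinTuples p.1 p.2.1 p.2.2 := by
  have hd : Set.range (Sum.inr : Y → X ⊕ Y) = (Set.range Sum.inl)ᶜ := Set.compl_range_inl.symm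
  have hd' (y : Y) : (Sum.inr y : X ⊕ Y) ∉ Set.range (Sum.inl : X → X ⊕ Y) := by simp
  constructor
  · rintro ⟨s, a⟩ ⟨t, b⟩ h
    have h1 := congrArg (countIn (Set.range (Sum.inl : X → X ⊕ Y))) h
    simp only [joinTuples_eq_joinSym, countIn_joinSym _ hd'] at h1
    obtain rfl : s = t := Fin.ext h1
    exact congrArg _ (joinSym_injective (h := Nat.add_sub_cancel' (Nat.lt_succ_iff.1 s.2)) Sum.inl_injective Sum.inr_injective hd' h)
  · intro t
    have hs := Nat.lt_succ_iff.2 (countIn_le (Set.range (Sum.inl : X → X ⊕ Y)) t)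
    have h1 : t ∈ {t' | countIn (Set.range (Sum.inl : X → X ⊕ Y)) t' =
      countIn (Set.range (Sum.inl : X → X ⊕ Y)) t} := rfl
    rw [← range_joinSym (Nat.add_sub_cancel' (Nat.lt_succ_iff.1 hs)) hd] at h1
    obtain ⟨p, hp⟩ := h1
    exact ⟨⟨⟨_, hs⟩, p⟩, hp⟩

/-- The counts in the two summands add up to `n` and both have closed superlevel sets, so fixing the
first excludes just two closed sets. -/
theorem isOpen_countIn_inl (X Y : FnSpace) (n s : ℕ) (hs : s ≤ n) :
    IsOpen (X := (X.sum Y).symPow n)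
      {t : Sym (X ⊕ Y) n | countIn (Set.range (Sum.inl : X → X ⊕ Y)) t = s} := by
  have hd : Set.range (Sum.inr : Y → X ⊕ Y) = (Set.range Sum.inl)ᶜ := Set.compl_range_inl.symm
  have h (t : Sym (X ⊕ Y) n) : countIn (Set.range (Sum.inl : X → X ⊕ Y)) t +
      countIn (Set.range (Sum.inr : Y → X ⊕ Y)) t = n := by
    classical
    rw [hd]
    refine Eq.trans ?_ ((Multiset.card_eq_countP_add_countP
      (· ∈ Set.range (Sum.inl : X → X ⊕ Y)) (t : Multiset (X ⊕ Y))).symm.trans t.2)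
    unfold countIn
    congr!
  have h1 : {t : Sym (X ⊕ Y) n | countIn (Set.range (Sum.inl : X → X ⊕ Y)) t = s} =
      ({t | s + 1 ≤ countIn (Set.range (Sum.inl : X → X ⊕ Y)) t} ∪
        {t | n - s + 1 ≤ countIn (Set.range (Sum.inr : Y → X ⊕ Y)) t})ᶜ := by
    ext t
    have := h t
    simp only [Set.mem_ofPred_eq, Set.mem_compl_iff, Set.mem_union]
    omega
  refine (congrArg (fun S => IsOpen (X := (X.sum Y).symPow n) S) h1).mpr ?_
  exact ((isClosed_le_countIn (isClosed_range_inl X Y) n _).union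
    (isClosed_le_countIn (isClosed_range_inr X Y) n _)).isOpen_compl

theorem sum_symPow_iso (P Q : SpacePair) (n : ℕ) (hP : IsVarPair P) (hQ : IsVarPair Q) :
    ∃ e : (SpacePair.sigma fun s : Fin (n + 1) =>
        (P.symPow s).prod (Q.symPow (n - s))).Iso ((P.sum Q).symPow n),
      ∀ (s : Fin (n + 1)) (a : Sym P.amb s) (b : Sym Q.amb (n - s)),
        e.toEquiv ⟨s, (a, b)⟩ = joinTuples s a b := by
  have hX := (hP.1.sum hQ.1).hasCharts
  let X (s : Fin (n + 1)) : FnSpace := (P.amb.symPow s).prod (Q.amb.symPow (n - s))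
  let Y : FnSpace := (P.amb.sum Q.amb).symPow n
  let f (p : Σ s : Fin (n + 1), Sym P.amb s × Sym Q.amb (n - s)) : Sym (P.amb ⊕ Q.amb) n :=
    joinTuples p.1 p.2.1 p.2.2
  let E : (Σ s : Fin (n + 1), Sym P.amb s × Sym Q.amb (n - s)) ≃ Sym (P.amb ⊕ Q.amb) n :=
    Equiv.ofBijective f (joinTuples_bijective P.amb Q.amb n)
  have hE (s : Fin (n + 1)) : IsEmb (X := X s) (Y := Y)
      fun p : Sym P.amb s × Sym Q.amb (n - s) => f ⟨s, p⟩ := by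
    refine joinSym_isEmb hX (isEmb_inl P.amb Q.amb) (isEmb_inr P.amb Q.amb) (fun b => ?_)
      (Nat.add_sub_cancel' (Nat.lt_succ_iff.1 s.2))
    have h : (Sum.inr b : P.amb ⊕ Q.amb) ∉ Set.range (Sum.inl : P.amb → P.amb ⊕ Q.amb) := by simp
    exact (isClosed_range_inl P.amb Q.amb).closure_eq.symm ▸ h
  have h1 : IsMorphism (X := FnSpace.sigma X) (Y := Y) f := final_lift fun s => (hE s).2.1
  have h2 : IsMorphism (X := Y) (Y := FnSpace.sigma X) E.symm := by
    refine isMorphism_of_local fun t => ?_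
    -- Near a tuple with `s` members in the first summand, the inverse factors through the single
    -- piece of index `s`, which is embedded.
    obtain ⟨⟨s, p⟩, rfl⟩ := E.surjective t
    let U : Set (Sym (P.amb ⊕ Q.amb) n) :=
      {t | countIn (Set.range (Sum.inl : P.amb → P.amb ⊕ Q.amb)) t = s}
    have hd (y : Q.amb) : (Sum.inr y : P.amb ⊕ Q.amb) ∉
      Set.range (Sum.inl : P.amb → P.amb ⊕ Q.amb) := by simp
    have hU (t : U) : ∃ p : Sym P.amb s × Sym Q.amb (n - s), E ⟨s, p⟩ = t.1 := by
      have h3 := range_joinSym (Nat.add_sub_cancel' (Nat.lt_succ_iff.1 s.2))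
        (Set.compl_range_inl (α := P.amb) (β := Q.amb)).symm
      exact (Set.ext_iff.1 h3 t.1).2 t.2
    choose θ hθ using hU
    refine ⟨U, isOpen_countIn_inl P.amb Q.amb n s (Nat.lt_succ_iff.1 s.2),
      countIn_joinSym (Nat.add_sub_cancel' (Nat.lt_succ_iff.1 s.2)) hd p.1 p.2, ?_⟩
    have h4 : IsMorphism (X := Y.sub U) (Y := X s) θ :=
      (hE s).2.2 _ _ ((sub_val (X := Y) U).congr fun t => (hθ t).symm)
    have h5 : IsMorphism (X := X s) (Y := FnSpace.sigma X) (fun p => ⟨s, p⟩) :=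
      final_incl X (fun i x => (⟨i, x⟩ : Σ s, X s)) s
    exact (h5.comp h4).congr fun t => E.eq_symm_apply.2 (hθ t)
  refine ⟨⟨⟨E, h1, h2⟩, ?_⟩, fun s a b => rfl⟩
  rintro ⟨s, a, b⟩
  change (∃ z ∈ joinTuples s a b, z ∈ (P.sum Q).subv) ↔
    (∃ x ∈ (id a : Sym P.amb s), x ∈ P.subv) ∨ ∃ y ∈ (id b : Sym Q.amb (n - s)), y ∈ Q.subv
  constructor
  · rintro ⟨z, hz, hzP⟩
    rcases mem_joinSym (h := Nat.add_sub_cancel' (Nat.lt_succ_iff.1 s.2)).1 hz with ⟨x, hx, rfl⟩ | ⟨y, hy, rfl⟩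
    exacts [Or.inl ⟨x, hx, inl_mem_sum.1 hzP⟩, Or.inr ⟨y, hy, inr_mem_sum.1 hzP⟩]
  · rintro (⟨x, hx, h⟩ | ⟨y, hy, h⟩)
    exacts [⟨_, mem_joinSym (h := Nat.add_sub_cancel' (Nat.lt_succ_iff.1 s.2)).2
      (Or.inl ⟨x, hx, rfl⟩), inl_mem_sum.2 h⟩,
      ⟨_, mem_joinSym (h := Nat.add_sub_cancel' (Nat.lt_succ_iff.1 s.2)).2
      (Or.inr ⟨y, hy, rfl⟩), inr_mem_sum.2 h⟩]
/-! ### Pairs with a locally closed subvariety -/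

theorem IsLCPair.restrict {P : SpacePair} (h : IsLCPair P) {S : Set P.amb}
    (hS : IsLocallyClosed S) : IsLCPair (P.restrict S) :=
  ⟨h.1.sub hS, h.2.preimage (sub_val S).1⟩

/-- A function whose level sets form a stratification such that the subset of the pair is locally
closed in each stratum. -/
structure IsStratification (P : SpacePair) (f : P.amb → ℕ) (n : ℕ) : Prop where
  isClosed : ∀ k, IsClosed {x | k ≤ f x}
  le : ∀ x, f x ≤ n
  isLocallyClosed : ∀ s, IsLocallyClosed (P.subv ∩ {x | f x = s})

theorem IsStratification.isLCPair {P : SpacePair} {f : P.amb → ℕ} {n : ℕ}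
    (h : IsStratification P f n) (hP : IsQuasiProjective P.amb) (s : ℕ) :
    IsLCPair (P.restrict {x | f x = s}) := by
  refine ⟨hP.sub (isLocallyClosed_level h.isClosed s), ?_⟩
  have h1 := (h.isLocallyClosed s).preimage (sub_val {x | f x = s}).1
  have h2 : (Subtype.val : {x | f x = s} → P.amb) ⁻¹' (P.subv ∩ {x | f x = s}) =
      Subtype.val ⁻¹' P.subv := by
    ext x
    exact ⟨fun h => h.1, fun h => ⟨h, x.2⟩⟩
  exact (congrArg (fun S => IsLocallyClosed (X := P.amb.sub {x | f x = s}) S) h2).mp h1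

theorem IsStratification.preimage {P Q : SpacePair} {φ : P.amb → Q.amb} (hφ : Continuous φ)
    (hm : ∀ x, φ x ∈ Q.subv ↔ x ∈ P.subv) {f : Q.amb → ℕ} {n : ℕ} (h : IsStratification Q f n) :
    IsStratification P (fun x => f (φ x)) n where
  isClosed k := (h.isClosed k).preimage hφ
  le x := h.le (φ x)
  isLocallyClosed s := by
    have h1 : P.subv ∩ {x | f (φ x) = s} = φ ⁻¹' (Q.subv ∩ {x | f x = s}) := by
      ext x
      exact and_congr (hm x).symm Iff.rfl
    exact h1 ▸ (h.isLocallyClosed s).preimage hφ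

/-- Write the pieces as `U ∩ Z` and let `f x` count the closed sets `Z` and `Uᶜ` that contain `x`.
The pattern of these sets determines membership in the subset, and within a level of `f` no pattern
strictly contains another. -/
theorem exists_isStratification {P : SpacePair} (hP : IsConstructibleSet P.subv) :
    ∃ f n, IsStratification P f n := by
  obtain ⟨F, hF, hl, hY⟩ := hP
  choose U Z hU hZ hT using hl
  have := hF.to_subtype
  let D : F ⊕ F → Set P.amb := Sum.elim (fun T => Z T.1 T.2) fun T => (U T.1 T.2)ᶜ
  have hD (i) : IsClosed (D i) := by
    rcases i with T | T
    exacts [hZ _ _, (hU _ _).isClosed_compl]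
  have hsat {x y : P.amb} (hxy : {i | x ∈ D i} = {i | y ∈ D i}) (hx : x ∈ P.subv) :
      y ∈ P.subv := by
    rw [hY] at hx ⊢
    obtain ⟨T, hTF, hxT⟩ := hx
    refine ⟨T, hTF, ?_⟩
    rw [hT T hTF] at hxT ⊢
    have h1 : x ∈ D (Sum.inl ⟨T, hTF⟩) ↔ y ∈ D (Sum.inl ⟨T, hTF⟩) :=
      Set.ext_iff.1 hxy (Sum.inl ⟨T, hTF⟩)
    have h2 : x ∈ D (Sum.inr ⟨T, hTF⟩) ↔ y ∈ D (Sum.inr ⟨T, hTF⟩) :=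
      Set.ext_iff.1 hxy (Sum.inr ⟨T, hTF⟩)
    exact ⟨(not_iff_not.1 h2).1 hxT.1, h1.1 hxT.2⟩
  have hcl (p : Set (F ⊕ F) → Prop) : IsClosed (⋃ I : {I // p I}, ⋂ i ∈ I.1, D i) :=
    isClosed_iUnion_of_finite fun I => isClosed_iInter fun i => isClosed_iInter fun _ => hD i
  have hk (k : ℕ) : IsClosed {x | k ≤ {i | x ∈ D i}.ncard} := by
    have h : {x | k ≤ {i | x ∈ D i}.ncard} = ⋃ I : {I : Set (F ⊕ F) // k ≤ I.ncard}, ⋂ i ∈ I.1, D i := by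
      ext x
      simp only [Set.mem_ofPred_eq, Set.mem_iUnion, Set.mem_iInter, Subtype.exists, exists_prop]
      exact ⟨fun h => ⟨_, h, fun i hi => hi⟩,
        fun ⟨I, hI, h⟩ => hI.trans (Set.ncard_le_ncard h (Set.toFinite _))⟩
    exact h ▸ hcl _
  refine ⟨fun x => {i | x ∈ D i}.ncard, Nat.card (F ⊕ F), hk, fun x => Set.ncard_le_card _,
    fun s => ?_⟩
  -- At level `s`, lying in the closed sets of an `s`-element pattern means having exactly that
  -- pattern; so the subset is cut out there by a finite union of closed sets.
  have h : P.subv ∩ {x | {i | x ∈ D i}.ncard = s} = {x | {i | x ∈ D i}.ncard = s} ∩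
      ⋃ I : {I : Set (F ⊕ F) // I.ncard = s ∧ ∃ y ∈ P.subv, {i | y ∈ D i} = I},
        ⋂ i ∈ I.1, D i := by
    ext x
    simp only [Set.mem_inter_iff, Set.mem_ofPred_eq, Set.mem_iUnion, Set.mem_iInter,
      Subtype.exists, exists_prop]
    constructor
    · rintro ⟨hx, hs⟩
      exact ⟨hs, _, ⟨hs, x, hx, rfl⟩, fun i hi => hi⟩
    · rintro ⟨hs, _, ⟨hs', y, hy, rfl⟩, h⟩
      exact ⟨hsat (Set.eq_of_subset_of_ncard_le h (hs.trans hs'.symm).le (Set.toFinite _)) hy, hs⟩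
  exact h ▸ (isLocallyClosed_level hk s).inter (hcl _).isLocallyClosed

/-- The sum of the classes of the strata. -/
def stratSum {P : SpacePair} (hP : IsQuasiProjective P.amb) {f : P.amb → ℕ} {n : ℕ}
    (h : IsStratification P f n) : Groth IsLCPair :=
  ∑ s ∈ Finset.range (n + 1), Groth.cls (P.restrict {x | f x = s}) (h.isLCPair hP s)

theorem SpacePair.restrict_comm_iso (P : SpacePair) (S T : Set P.amb) :
    Nonempty (((P.restrict S).restrict ((Subtype.val : S → P.amb) ⁻¹' T)).Iso
      ((P.restrict T).restrict ((Subtype.val : T → P.amb) ⁻¹' S))) := by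
  refine iso_of_isEmb (A := (P.restrict S).restrict ((Subtype.val : S → P.amb) ⁻¹' T))
    (P := (P.restrict T).restrict ((Subtype.val : T → P.amb) ⁻¹' S))
    (φ := fun x : ((Subtype.val : S → P.amb) ⁻¹' T) =>
      (⟨⟨x.1.1, x.2⟩, x.1.2⟩ : ((Subtype.val : T → P.amb) ⁻¹' S))) ⟨?_, ?_, ?_⟩ ?_
      (fun _ => Iff.rfl)
  · exact fun x y h => Subtype.ext (Subtype.ext (congrArg (fun z => z.1.1) h))
  · exact sub_lift (X := P.amb.sub T) (sub_lift ((sub_val S).comp (sub_val (X := P.amb.sub S) _)))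
  · exact fun W ψ hψ => sub_lift (X := P.amb.sub S) (sub_lift
      (((sub_val T).comp (sub_val (X := P.amb.sub T) _)).comp hψ))
  · rintro ⟨⟨x, h1⟩, h2⟩
    exact ⟨(⟨⟨x, h2⟩, h1⟩ : ((Subtype.val : S → P.amb) ⁻¹' T)), rfl⟩

/-- Both sums equal the sum over the common refinement, computed in the group of locally closed
pairs. -/
theorem stratSum_eq {P : SpacePair} (hP : IsQuasiProjective P.amb) {f g : P.amb → ℕ} {n m : ℕ}
    (hf : IsStratification P f n) (hg : IsStratification P g m) :
    stratSum hP hf = stratSum hP hg := by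
  have key {f g : P.amb → ℕ} {n m : ℕ} (hf : IsStratification P f n)
      (hg : IsStratification P g m) : stratSum hP hf =
      ∑ s ∈ Finset.range (n + 1), ∑ t ∈ Finset.range (m + 1),
        Groth.cls ((P.restrict {x | f x = s}).restrict {x : {x | f x = s} | g x.1 = t})
          ((hf.isLCPair hP s).restrict (isLocallyClosed_level (X := P.amb.sub {x | f x = s})
            (fun k => (hg.isClosed k).preimage (sub_val _).1) t)) :=
    Finset.sum_congr rfl fun s _ => cls_eq_sum_levels IsLCPair.restrict (hf.isLCPair hP s)
      (fun k => (hg.isClosed k).preimage (sub_val _).1) fun x => hg.le x.1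
  rw [key hf hg, key hg hf, Finset.sum_comm]
  exact Finset.sum_congr rfl fun t _ => Finset.sum_congr rfl fun s _ =>
    Groth.cls_iso _ _ (P.restrict_comm_iso {x | f x = s} {x | g x = t}).some

/-- The class of a pair in the Grothendieck group of pairs with a locally closed subvariety. -/
def lcClass (P : SpacePair) (hP : IsVarPair P) : Groth IsLCPair :=
  stratSum hP.1 (exists_isStratification hP.2).choose_spec.choose_spec

theorem lcClass_eq {P : SpacePair} (hP : IsVarPair P) {f : P.amb → ℕ} {n : ℕ}
    (h : IsStratification P f n) : lcClass P hP = stratSum hP.1 h :=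
  stratSum_eq _ _ _

theorem lcClass_iso {P Q : SpacePair} (hP : IsVarPair P) (hQ : IsVarPair Q) (e : P.Iso Q) :
    lcClass P hP = lcClass Q hQ := by
  obtain ⟨f, n, hf⟩ := exists_isStratification hQ.2
  rw [lcClass_eq hQ hf, lcClass_eq hP (hf.preimage e.isMorphism.1 e.mem_iff)]
  refine Finset.sum_congr rfl fun s _ => Groth.cls_iso _ _ (SpacePair.restrict_iso e ?_).some
  exact Set.image_preimage_eq {x | f x = s} e.toEquiv.surjective

/-- One stratification of `P` restricts to both pieces, and each stratum is then cut by `Z` inside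
the group of locally closed pairs. -/
theorem lcClass_scissor {P : SpacePair} (hP : IsVarPair P) {Z : Set P.amb} (hZ : IsClosed Z)
    (hA : IsVarPair (P.restrict Z)) (hB : IsVarPair (P.restrict Zᶜ)) :
    lcClass P hP = lcClass _ hA + lcClass _ hB := by
  obtain ⟨f, n, hf⟩ := exists_isStratification hP.2
  rw [lcClass_eq hP hf, lcClass_eq hA (hf.preimage (P := P.restrict Z) (sub_val Z).1 fun _ => Iff.rfl),
    lcClass_eq hB (hf.preimage (P := P.restrict Zᶜ) (sub_val Zᶜ).1 fun _ => Iff.rfl), stratSum, stratSum, stratSum,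
    ← Finset.sum_add_distrib]
  refine Finset.sum_congr rfl fun s _ => ?_
  have hZ' := hZ.preimage (sub_val {x | f x = s}).1
  rw [Groth.cls_scissor (hf.isLCPair hP.1 s) hZ'
    ((hf.isLCPair hP.1 s).restrict hZ'.isLocallyClosed)
    ((hf.isLCPair hP.1 s).restrict hZ'.isOpen_compl.isLocallyClosed)]
  exact congrArg₂ _ (Groth.cls_iso _ _ (P.restrict_comm_iso {x | f x = s} Z).some)
    (Groth.cls_iso _ _ (P.restrict_comm_iso {x | f x = s} Zᶜ).some)

theorem map_isVarPair_bijective : Function.Bijective (Groth.map IsLCPair.isVarPair) := by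
  -- The inverse sends a pair to the sum of its strata. Both composites are the identity because
  -- `cls_eq_sum_levels` holds in either group.
  let g : K0Pairs →+ Groth IsLCPair := Groth.lift lcClass
    (fun _ _ hP hQ ⟨e⟩ => lcClass_iso hP hQ e) fun _ hP _ hA hB hZ => lcClass_scissor hP hZ hA hB
  have hmap (P : SpacePair) (hP : IsLCPair P) : Groth.map IsLCPair.isVarPair (Groth.cls P hP) =
      Groth.cls P (hP.isVarPair P) := Groth.lift_cls _ _ _ P hP
  have hg (P : SpacePair) (hP : IsVarPair P) : g (Groth.cls P hP) = lcClass P hP :=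
    Groth.lift_cls _ _ _ P hP
  refine ⟨Function.LeftInverse.injective (g := g) fun x => ?_,
    Function.RightInverse.surjective (g := g) fun x => ?_⟩
  · induction x using Groth.induction with
    | cls P hP =>
      obtain ⟨f, n, hf⟩ := exists_isStratification (hP.isVarPair P).2
      rw [hmap, hg, lcClass_eq _ hf]
      exact (cls_eq_sum_levels IsLCPair.restrict hP hf.isClosed hf.le).symm
    | zero => rw [map_zero, map_zero]
    | add x y hx hy => rw [map_add, map_add, hx, hy]
    | neg x hx => rw [map_neg, map_neg, hx]
  · induction x using Groth.induction with
    | cls P hP =>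
      obtain ⟨f, n, hf⟩ := exists_isStratification hP.2
      rw [hg, lcClass_eq hP hf, stratSum, map_sum]
      simp_rw [hmap]
      exact (cls_eq_sum_levels IsVarPair.restrict hP hf.isClosed hf.le).symm
    | zero => rw [map_zero, map_zero]
    | add x y hx hy => rw [map_add, map_add, hx, hy]
    | neg x hx => rw [map_neg, map_neg, hx]
end KPairs

end

/-- The Kapranov zeta function defines a pre-`λ`-structure on `K_0^pairs(Var_ℂ)`. -/
theorem mainTheorem2 :
    -- symmetric products of pairs of varieties are pairs of varieties, as are disjoint unions
    ∃ (hS : ∀ (P : KPairs.SpacePair) (n : ℕ), KPairs.IsVarPair P → KPairs.IsVarPair (P.symPow n))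
      (hU : ∀ P Q : KPairs.SpacePair, KPairs.IsVarPair P → KPairs.IsVarPair Q →
        KPairs.IsVarPair (P.sum Q)),
      -- the pairs with locally closed subvariety define the same Grothendieck group
      Function.Bijective (KPairs.Groth.map KPairs.IsLCPair.isVarPair) ∧
      -- the Kapranov zeta function defines a pre-λ-structure
      (∃! L : KPairs.LambdaStructure KPairs.K0Pairs,
        ∀ (P : KPairs.SpacePair) (hP : KPairs.IsVarPair P),
          L.series (KPairs.Groth.cls P hP) = KPairs.kapranovZeta hS P hP) ∧
      -- it is multiplicative under disjoint union
      (∀ (P Q : KPairs.SpacePair) (hP : KPairs.IsVarPair P) (hQ : KPairs.IsVarPair Q),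
        KPairs.kapranovZeta hS (P.sum Q) (hU P Q hP hQ) =
          KPairs.kapranovZeta hS P hP * KPairs.kapranovZeta hS Q hQ) ∧
      -- the union of tuples is an isomorphism of pairs ⊔_s S^s P × S^(n-s) Q ≅ S^n (P ⊔ Q)
      (∀ (P Q : KPairs.SpacePair) (n : ℕ), KPairs.IsVarPair P → KPairs.IsVarPair Q →
        ∃ e : (KPairs.SpacePair.sigma fun s : Fin (n + 1) =>
            (P.symPow s).prod (Q.symPow (n - s))).Iso ((P.sum Q).symPow n),
          ∀ (s : Fin (n + 1)) (a : Sym P.amb s) (b : Sym Q.amb (n - s)),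
            e.toEquiv ⟨s, (a, b)⟩ = KPairs.joinTuples s a b) :=
  ⟨KPairs.IsVarPair.symPow, KPairs.IsVarPair.sum, KPairs.map_isVarPair_bijective,
    KPairs.existsUnique_lambdaStructure, KPairs.kapranovZeta_sum, KPairs.sum_symPow_iso⟩
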